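/- Let $d\in\mathbb{N}$. For $z=(x,\omega)\in\mathbb{R}^{2d}$ let $\pi(z)$ be the time-frequency shift on $L^2(\mathbb{R}^d)$, $\pi(z)\psi(t)=e^{2\pi i\omega\cdot t}\psi(t-x)$. For $\psi,\phi\in L^2(\mathbb{R}^d)$ let $V_\phi\psi(z)=\langle\psi,\pi(z)\phi\rangle$ be the short-time Fourier transform (inner products are linear in the first argument) and $A(\psi,\phi)(z)=e^{\pi i x\cdot\omega}V_\phi\psi(z)$ the cross-ambiguity function. For $\varphi_1,\varphi_2\in L^2(\mathbb{R}^d)$ and a function $f$ on $\mathbb{R}^{2d}$, the localization operator $\mathcal{A}_f^{\varphi_1,\varphi_2}$ is the bounded operator on $L^2(\mathbb{R}^d)$ given by $$\mathcal{A}_f^{\varphi_1,\varphi_2}\psi=\int_{\mathbb{R}^{2d}}f(z)\,V_{\varphi_1}\psi(z)\,\pi(z)\varphi_2\,dz\qquad(\psi\in L^2(\mathbb{R}^d)),$$ where the integral is understood weakly: after applying any bounded linear functional, the integrand is integrable and its integral is the value of the functional at $\mathcal{A}_f^{\varphi_1,\varphi_2}\psi$. Let $\mathcal{T}^1$ and $\mathcal{T}^2$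 be the trace class and the Hilbert–Schmidt operators on $L^2(\mathbb{R}^d)$, with the norms $\|T\|_{\mathcal{T}^p}=(\mathrm{tr}\,|T|^p)^{1/p}$, and let $B(L^2(\mathbb{R}^d))$ carry the weak* topology as the dual of $\mathcal{T}^1$ under the pairing $(T,S)\mapsto\mathrm{tr}(TS^*)$. **Theorem.** Fix two windows $\varphi_1,\varphi_2\in L^2(\mathbb{R}^d)$, and let $Z=\{z\in\mathbb{R}^{2d}:A(\varphi_2,\varphi_1)(z)=0\}$. For $f\in L^p(\mathbb{R}^{2d})$ with $p\in\{1,2,\infty\}$ the operator $\mathcal{A}_f^{\varphi_1,\varphi_2}$ is well defined, and: 1. $\{\mathcal{A}_f^{\varphi_1,\varphi_2}:f\in L^1(\mathbb{R}^{2d})\}$ is a dense subset of $\mathcal{T}^1$ (in the $\mathcal{T}^1$-norm) if and only if $Z$ is empty. 2. $\{\mathcal{A}_f^{\varphi_1,\varphi_2}:f\in L^2(\mathbb{R}^{2d})\}$ is a dense subset of $\mathcal{T}^2$ (in the $\mathcal{T}^2$-norm) if and only if $Z$ has Lebesgue measure zero. 3. $\{\mathcal{A}_f^{\varphi_1,\varphi_2}:f\in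 L^\infty(\mathbb{R}^{2d})\}$ is weak* dense in $B(L^2(\mathbb{R}^d))$ if and only if $\mathbb{R}^{2d}\setminus Z$ is dense in $\mathbb{R}^{2d}$. -/

import Mathlib

open MeasureTheory
open scoped ENNReal

noncomputable section

namespace LocOp

/-! ### Schatten classes and the weak* topology on `B(H)` -/

section Schatten

/-- Parseval's identity. -/
theorem ofReal_norm_sq_eq_tsum {H ι : Type*} [NormedAddCommGroup H] [InnerProductSpace ℂ H]
    (b : HilbertBasis ι ℂ H) (x : H) :
    ENNReal.ofReal (‖x‖ ^ 2) = ∑' i, ENNReal.ofReal (‖inner ℂ (b i) x‖ ^ 2) := by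
  have h := b.hasSum_inner_mul_inner x x
  have h2 : HasSum (fun i => ‖inner ℂ (b i) x‖ ^ 2) (‖x‖ ^ 2) := by
    have h3 := Complex.hasSum_re h
    convert h3 using 1
    · funext i
      rw [← inner_conj_symm x (b i), mul_comm, RCLike.mul_conj]
      norm_cast
    · rw [inner_self_eq_norm_sq_to_K]
      norm_cast
  rw [← h2.tsum_eq, ENNReal.ofReal_tsum_of_nonneg (fun i => by positivity) h2.summable]

variable {H : Type*} [NormedAddCommGroup H] [InnerProductSpace ℂ H] [CompleteSpace H]

variable (H) in
/-- The index set of a fixed orthonormal basis of `H`. -/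
def basisIndex : Set H := (exists_hilbertBasis ℂ H).choose

variable (H) in
/-- A fixed orthonormal basis of `H`. -/
def onb : HilbertBasis (basisIndex H) ℂ H := (exists_hilbertBasis ℂ H).choose_spec.choose

/-- The trace `∑ₙ ⟨A eₙ, eₙ⟩ ∈ [0, ∞]` of a positive bounded operator `A`
(see `posTrace_eq` for the independence of the orthonormal basis). -/
def posTrace (A : H →L[ℂ] H) : ℝ≥0∞ :=
  ∑' i, ENNReal.ofReal (inner ℂ (onb H i) (A (onb H i))).re

/-- The Schatten `p`-norm `(tr |T|ᵖ)^(1/p) ∈ [0, ∞]`, where `|T| = (T* T)^(1/2)`; this is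
the `ℓᵖ`-norm of the sequence of singular values of `T` (and `∞` if `T` is not compact). -/
def schattenNorm (p : ℝ) (T : H →L[ℂ] H) : ℝ≥0∞ :=
  posTrace (CFC.abs T ^ p) ^ (1 / p)

variable (H) in
/-- The Schatten class `𝒯ᵖ` of `H`, for `1 ≤ p < ∞`: trace class operators for `p = 1`,
Hilbert–Schmidt operators for `p = 2`. -/
def schattenClass (p : ℝ) : Set (H →L[ℂ] H) := {T | schattenNorm p T < ∞}

/-- `M` is a subset of `𝒯ᵖ` that is dense with respect to the norm of `𝒯ᵖ`. -/
def DenseInSchatten (p : ℝ) (M : Set (H →L[ℂ] H)) : Prop :=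
  M ⊆ schattenClass H p ∧
    ∀ T ∈ schattenClass H p, ∀ ε : ℝ≥0∞, 0 < ε → ∃ A ∈ M, schattenNorm p (T - A) < ε

/-- The trace `∑ₙ ⟨T eₙ, eₙ⟩` of a trace class operator. -/
def trace (T : H →L[ℂ] H) : ℂ := ∑' i, inner ℂ (onb H i) (T (onb H i))

variable (H) in
/-- The weak* topology of `B(H)` as the dual space of `𝒯¹`, for the duality
`⟨A, S⟩ = tr (A S*)`: the coarsest topology for which `A ↦ tr (A S*)` is continuous for
every trace class operator `S`. -/
@[reducible] def weakStarTopology : TopologicalSpace (H →L[ℂ] H) :=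
  ⨅ S ∈ schattenClass H 1,
    TopologicalSpace.induced (fun A => trace (A ∘L ContinuousLinearMap.adjoint S)) inferInstance

/-- Weak* density in `B(H)`. -/
def WeakStarDense (M : Set (H →L[ℂ] H)) : Prop := @Dense _ (weakStarTopology H) M

/-- The trace of a positive operator does not depend on the orthonormal basis. -/
theorem posTrace_eq {ι : Type*} (b : HilbertBasis ι ℂ H) {A : H →L[ℂ] H} (hA : 0 ≤ A) :
    posTrace A = ∑' i, ENNReal.ofReal (inner ℂ (b i) (A (b i))).re := by
  set R : H →L[ℂ] H := CFC.sqrt A with hR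
  have hRR : R * R = A := CFC.sqrt_mul_sqrt_self A hA
  have hRsa : ContinuousLinearMap.adjoint R = R :=
    (IsSelfAdjoint.of_nonneg (CFC.sqrt_nonneg A)).star_eq
  have hsymm : ∀ x y : H, inner ℂ (R x) y = inner ℂ x (R y) := by
    intro x y
    rw [← ContinuousLinearMap.adjoint_inner_right, hRsa]
  have key : ∀ x : H, (inner ℂ x (A x)).re = ‖R x‖ ^ 2 := by
    intro x
    rw [← hRR, mul_apply_eq_comp, ← hsymm, inner_self_eq_norm_sq_to_K]
    norm_cast
  simp only [posTrace, key]
  calc ∑' i, ENNReal.ofReal (‖R (onb H i)‖ ^ 2)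
      = ∑' i, ∑' j, ENNReal.ofReal (‖inner ℂ (b j) (R (onb H i))‖ ^ 2) := by
        simp only [← ofReal_norm_sq_eq_tsum b]
    _ = ∑' j, ∑' i, ENNReal.ofReal (‖inner ℂ (b j) (R (onb H i))‖ ^ 2) := ENNReal.tsum_comm
    _ = ∑' j, ∑' i, ENNReal.ofReal (‖inner ℂ (onb H i) (R (b j))‖ ^ 2) := by
        refine tsum_congr fun j => tsum_congr fun i => ?_
        rw [← hsymm, norm_inner_symm]
    _ = ∑' j, ENNReal.ofReal (‖R (b j)‖ ^ 2) := by
        simp only [← ofReal_norm_sq_eq_tsum (onb H)]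

end Schatten

/-! ### Weak integrals -/

/-- `v` is the (weak) integral of the vector-valued function `F` with respect to `μ`:
`φ ∘ F` is integrable with integral `φ v`, for every bounded linear functional `φ`. -/
def IsWeakIntegral {G X : Type*} [MeasurableSpace G] [NormedAddCommGroup X] [NormedSpace ℂ X]
    (μ : Measure G) (F : G → X) (v : X) : Prop :=
  ∀ φ : X →L[ℂ] ℂ, Integrable (fun z => φ (F z)) μ ∧ ∫ z, φ (F z) ∂μ = φ v

/-! ### Time-frequency analysis -/

/-- The space `ℝᵈ`. -/
abbrev Space (d : ℕ) : Type := EuclideanSpace ℝ (Fin d)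

/-- The phase space `ℝ²ᵈ`, with points `z = (x, ω)`, the product topology and Lebesgue measure
(`volume`). -/
abbrev Phase (d : ℕ) : Type := Space d × Space d

/-- The Hilbert space `L²(ℝᵈ)`. -/
abbrev L2 (d : ℕ) : Type := Lp ℂ 2 (volume : Measure (Space d))

/-- The function `t ↦ e^{2πi ω·t} ψ(t - x)`. -/
def tfShiftFun {d : ℕ} (z : Phase d) (ψ : Space d → ℂ) (t : Space d) : ℂ :=
  Complex.exp (2 * Real.pi * Complex.I * (inner ℝ z.2 t : ℝ)) * ψ (t - z.1)

theorem memLp_tfShiftFun {d : ℕ} (z : Phase d) (ψ : L2 d) :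
    MemLp (tfShiftFun z ψ) 2 (volume : Measure (Space d)) := by
  have h : MemLp (fun t => ψ (t - z.1)) 2 (volume : Measure (Space d)) :=
    (Lp.memLp ψ).comp_measurePreserving (measurePreserving_sub_right volume z.1)
  refine h.congr_norm ?_ ?_
  · refine AEStronglyMeasurable.mul ?_ h.1
    exact Continuous.aestronglyMeasurable (by fun_prop)
  · refine Filter.Eventually.of_forall fun t => ?_
    have : (2 * Real.pi * Complex.I * (inner ℝ z.2 t : ℝ) : ℂ)
        = ((2 * Real.pi * inner ℝ z.2 t : ℝ) : ℂ) * Complex.I := by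
      push_cast; ring
    rw [tfShiftFun, norm_mul, this, Complex.norm_exp_ofReal_mul_I, one_mul]

/-- The time-frequency shift `π(z) = M_ω T_x` on `L²(ℝᵈ)`, `z = (x, ω)`. -/
def tfShift {d : ℕ} (z : Phase d) (ψ : L2 d) : L2 d := (memLp_tfShiftFun z ψ).toLp _

/-- The short-time Fourier transform `V_φ ψ(z) = ⟨ψ, π(z) φ⟩` with window `φ`
(Mathlib's inner product is linear in its second argument). -/
def stft {d : ℕ} (φ ψ : L2 d) (z : Phase d) : ℂ := inner ℂ (tfShift z φ) ψ

/-- The cross-ambiguity function `A(ψ, φ)(z) = e^{πi x·ω} V_φ ψ(z)`. -/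
def crossAmbiguity {d : ℕ} (ψ φ : L2 d) (z : Phase d) : ℂ :=
  Complex.exp (Real.pi * Complex.I * (inner ℝ z.1 z.2 : ℝ)) * stft φ ψ z

/-- `T` is the localization operator with windows `φ₁, φ₂` and symbol `f`:
`T ψ = ∫ f(z) V_{φ₁} ψ(z) π(z) φ₂ dz` for all `ψ`, as a weak integral. -/
def IsLocalizationOperator {d : ℕ} (φ₁ φ₂ : L2 d) (f : Phase d → ℂ) (T : L2 d →L[ℂ] L2 d) :
    Prop :=
  ∀ ψ : L2 d, IsWeakIntegral volume (fun z => (f z * stft φ₁ ψ z) • tfShift z φ₂) (T ψ)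

open Classical in
/-- The localization operator `𝒜_f^{φ₁,φ₂}`. -/
def localizationOperator {d : ℕ} (φ₁ φ₂ : L2 d) (f : Phase d → ℂ) : L2 d →L[ℂ] L2 d :=
  if h : ∃ T, IsLocalizationOperator φ₁ φ₂ f T then h.choose else 0

/-- A weak integral is unique, hence so is the localization operator. -/
theorem IsLocalizationOperator.eq {d : ℕ} {φ₁ φ₂ : L2 d} {f : Phase d → ℂ}
    {T : L2 d →L[ℂ] L2 d} (hT : IsLocalizationOperator φ₁ φ₂ f T) :
    localizationOperator φ₁ φ₂ f = T := by
  have h : ∃ T, IsLocalizationOperator φ₁ φ₂ f T := ⟨T, hT⟩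
  rw [localizationOperator, dif_pos h]
  ext1 ψ
  refine ext_inner_left ℂ fun η => ?_
  have h1 := (h.choose_spec ψ (innerSL ℂ η)).2
  have h2 := (hT ψ (innerSL ℂ η)).2
  simpa using h1.symm.trans h2

/-- The set `{𝒜_f^{φ₁,φ₂} : f ∈ Lᵖ(ℝ²ᵈ)}`. -/
def localizationOperators {d : ℕ} (φ₁ φ₂ : L2 d) (p : ℝ≥0∞) : Set (L2 d →L[ℂ] L2 d) :=
  {T | ∃ f : Phase d → ℂ, MemLp f p volume ∧ T = localizationOperator φ₁ φ₂ f}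

/-- The zero set of `A(φ₂, φ₁)`. -/
def ambiguityZeros {d : ℕ} (φ₁ φ₂ : L2 d) : Set (Phase d) :=
  {z | crossAmbiguity φ₂ φ₁ z = 0}

end LocOp

end

/-! Write `π(ζ)` for the time-frequency shifts, `chi` for the symplectic character of phase space
and `sft` for the symplectic Fourier transform. Conjugating `π(ζ)` by `π(z)` multiplies it by `chi ζ
z` (`tfShift_comm`). Together with Moyal's identity (`integral_stft_mul`) this gives the Weyl form
of a localization operator with integrable symbol: `∫ sft f(ζ) · V_{φ₁}φ₂(ζ) · π(ζ) dζ`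
(`integral_mul_stft_mul`). Its spreading function is a multiple of `V_{φ₁}φ₂`, which differs from
the ambiguity function `A(φ₂, φ₁)` by a unimodular factor only. The three density statements thus
ask how large the multiples of this one continuous function are.

Necessity is duality. If the spreading function of `S` is carried by the zero set, then `⟨S π(z)φ₁,
π(z)φ₂⟩ = 0` for all `z`, and so `S` is orthogonal to every localization operator. A nonzero such
`S` is `π(ζ₀)` when there is a zero `ζ₀`, a Hilbert–Schmidt operator when the zeros have positive
measure, and a trace class operator when they have interior.

Sufficiency for `𝒯¹`: rank one operators are limits of localization operators with other windows and
band-limited symbols (`schattenNorm_rankOne_sub_le`), and Wiener's division lemma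
(`exists_sft_mul_eq`) trades those windows for `φ₁, φ₂`. For `𝒯²`: the Hilbert–Schmidt norm is at
most the `L²`-norm of the spreading function, and smooth multiples of an a.e. nonvanishing function
are dense in `L²`. For weak* density: every `π(ζ)` with `V_{φ₁}φ₂(ζ) ≠ 0` is itself a localization
operator with bounded symbol, and a trace class operator annihilated by a dense set of shifts is
zero (`eq_zero_of_trace_tfCLM_comp`). -/

noncomputable section

namespace LocOp

/-! ### Trace class and Hilbert–Schmidt operators. -/

section SchattenTheory

variable {H : Type*} [NormedAddCommGroup H] [InnerProductSpace ℂ H] [CompleteSpace H]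

/-- Douglas' factorization lemma for contractions. -/
theorem exists_contraction_comp_eq (T P : H →L[ℂ] H) (h : ∀ x, ‖T x‖ ≤ ‖P x‖) :
    ∃ U : H →L[ℂ] H, ‖U‖ ≤ 1 ∧ U ∘L P = T := by
  let K : Submodule ℂ H := (LinearMap.range P.toLinearMap).topologicalClosure
  have hK : IsClosed (K : Set H) := Submodule.isClosed_topologicalClosure _
  have : CompleteSpace K := hK.completeSpace_coe
  have hmem : ∀ x, P x ∈ K := fun x =>
    Submodule.le_topologicalClosure _ (LinearMap.mem_range_self _ x)
  let e : H →ₗ[ℂ] K := P.toLinearMap.codRestrict K hmem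
  have hd : DenseRange e := by
    intro y
    rw [closure_subtype]
    have : (Subtype.val '' Set.range e) = (LinearMap.range P.toLinearMap : Set H) := by
      ext z; constructor
      · rintro ⟨_, ⟨x, rfl⟩, rfl⟩; exact ⟨x, rfl⟩
      · rintro ⟨x, rfl⟩; exact ⟨e x, ⟨x, rfl⟩, rfl⟩
    rw [this]
    exact y.2
  have hn : ∀ x, ‖T.toLinearMap x‖ ≤ 1 * ‖e x‖ := fun x => by
    simpa [e] using h x
  -- The map `P x ↦ T x` is well defined and contractive; it extends continuously to the closure of
  -- the range of `P`, and by zero to the orthogonal complement.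
  refine ⟨(T.toLinearMap.extendOfNorm e) ∘L K.orthogonalProjectionOnto, ?_, ?_⟩
  · refine (ContinuousLinearMap.opNorm_comp_le _ _).trans ?_
    refine mul_le_one₀ (LinearMap.opNorm_extendOfNorm_le hd zero_le_one hn) (norm_nonneg _) ?_
    exact K.orthogonalProjectionOnto_norm_le
  · ext x
    have h1 : K.orthogonalProjectionOnto (P x) = e x :=
      K.orthogonalProjectionOnto_mem_subspace_eq_self (e x)
    rw [ContinuousLinearMap.comp_apply, ContinuousLinearMap.comp_apply, h1]
    exact LinearMap.extendOfNorm_eq hd ⟨1, hn⟩ x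

theorem norm_sq_eq_re_inner_adjoint_mul (T : H →L[ℂ] H) (x : H) :
    ‖T x‖ ^ 2 = (inner ℂ x ((star T * T) x)).re := by
  rw [mul_apply_eq_comp, ContinuousLinearMap.star_eq_adjoint,
    ContinuousLinearMap.adjoint_inner_right, inner_self_eq_norm_sq_to_K]
  norm_cast

theorem norm_abs_apply (T : H →L[ℂ] H) (x : H) : ‖CFC.abs T x‖ = ‖T x‖ := by
  have h : ‖CFC.abs T x‖ ^ 2 = ‖T x‖ ^ 2 := by
    rw [norm_sq_eq_re_inner_adjoint_mul, norm_sq_eq_re_inner_adjoint_mul,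
      (IsSelfAdjoint.of_nonneg (CFC.abs_nonneg T)).star_eq, CFC.abs_mul_abs]
  exact (pow_left_inj₀ (norm_nonneg _) (norm_nonneg _) two_ne_zero).1 h

theorem schattenNorm_one_eq (T : H →L[ℂ] H) :
    schattenNorm 1 T = ∑' i, ENNReal.ofReal (inner ℂ (onb H i) (CFC.abs T (onb H i))).re := by
  rw [schattenNorm, CFC.rpow_one _ (CFC.abs_nonneg T), posTrace]
  simp

theorem schattenNorm_two_eq (T : H →L[ℂ] H) :
    schattenNorm 2 T = (∑' i, ENNReal.ofReal (‖T (onb H i)‖ ^ 2)) ^ (1 / 2 : ℝ) := by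
  have : CFC.abs T ^ (2 : ℝ) = star T * T := by
    rw [← CFC.abs_mul_abs T, ← sq]
    exact_mod_cast CFC.rpow_natCast (CFC.abs T) 2 (CFC.abs_nonneg T)
  rw [schattenNorm, this, posTrace]
  simp only [norm_sq_eq_re_inner_adjoint_mul]

theorem schattenNorm_two_lt_top_iff (T : H →L[ℂ] H) :
    schattenNorm 2 T < ∞ ↔ ∑' i, ENNReal.ofReal (‖T (onb H i)‖ ^ 2) < ∞ := by
  rw [schattenNorm_two_eq, ENNReal.rpow_lt_top_iff_of_pos (by norm_num)]

/-- A bound for the trace norm by duality with contractions. -/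
theorem schattenNorm_one_le {T : H →L[ℂ] H} {C : ℝ}
    (h : ∀ V : H →L[ℂ] H, ‖V‖ ≤ 1 → ∀ F : Finset (basisIndex H),
      ‖∑ i ∈ F, inner ℂ (onb H i) (V (T (onb H i)))‖ ≤ C) :
    schattenNorm 1 T ≤ ENNReal.ofReal C := by
  -- Half of a polar decomposition: `|T| = W T`, so the partial sums of `tr |T|` are the tested sums
  -- with `V = W`.
  obtain ⟨W, hW, hWT⟩ := exists_contraction_comp_eq (CFC.abs T) T
    (fun x => (norm_abs_apply T x).le)
  rw [schattenNorm_one_eq, ENNReal.tsum_eq_iSup_sum]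
  refine iSup_le fun F => ?_
  have hpos : ∀ x : H, 0 ≤ (inner ℂ x (CFC.abs T x)).re := fun x =>
    ((ContinuousLinearMap.nonneg_iff_isPositive _).1 (CFC.abs_nonneg T)).re_inner_nonneg_right x
  rw [← ENNReal.ofReal_sum_of_nonneg fun i _ => hpos _]
  refine ENNReal.ofReal_le_ofReal ?_
  rw [← Complex.re_sum]
  refine (Complex.re_le_norm _).trans ?_
  have := h W hW F
  simpa only [← ContinuousLinearMap.comp_apply, hWT] using this

/-- `T = ∑ᵢ ⟨·, vᵢ⟩ uᵢ` is a nuclear representation of `T`. -/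
structure IsNuclear {ι : Type*} (T : H →L[ℂ] H) (u v : ι → H) : Prop where
  summable : Summable fun i => ‖u i‖ * ‖v i‖
  hasSum : ∀ x y, HasSum (fun i => inner ℂ y (u i) * inner ℂ (v i) x) (inner ℂ y (T x))

/-- With `T = U |T|` and `R = |T|^(1/2)`, inserting the basis between the two factors of `T = (U R)
R` gives `T = ∑ᵢ ⟨·, R eᵢ⟩ U R eᵢ`, and `∑ᵢ ‖R eᵢ‖² = tr |T|`. -/
theorem exists_isNuclear {T : H →L[ℂ] H} (hT : schattenNorm 1 T < ∞) :
    ∃ u v : basisIndex H → H, IsNuclear T u v ∧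
      ∑' i, ‖u i‖ * ‖v i‖ ≤ (schattenNorm 1 T).toReal := by
  obtain ⟨U, hU, hUT⟩ := exists_contraction_comp_eq T (CFC.abs T)
    (fun x => (norm_abs_apply T x).ge)
  set R : H →L[ℂ] H := CFC.sqrt (CFC.abs T) with hR
  have hRR : R * R = CFC.abs T := CFC.sqrt_mul_sqrt_self _ (CFC.abs_nonneg T)
  have hRsa : star R = R := (IsSelfAdjoint.of_nonneg (CFC.sqrt_nonneg (CFC.abs T))).star_eq
  have hsymm : ∀ x y : H, inner ℂ (R x) y = inner ℂ x (R y) := by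
    intro x y
    rw [← ContinuousLinearMap.adjoint_inner_right, ← ContinuousLinearMap.star_eq_adjoint, hRsa]
  have key : ∀ x, ‖R x‖ ^ 2 = (inner ℂ x (CFC.abs T x)).re := by
    intro x
    rw [norm_sq_eq_re_inner_adjoint_mul, hRsa, hRR]
  have hle : ∀ i, ‖U (R (onb H i))‖ * ‖R (onb H i)‖ ≤ ‖R (onb H i)‖ ^ 2 := by
    intro i
    rw [sq]
    gcongr
    simpa using U.le_of_opNorm_le hU (R (onb H i))
  rw [schattenNorm_one_eq] at hT ⊢
  simp only [← key] at hT ⊢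
  have hs : Summable fun i => ‖R (onb H i)‖ ^ 2 := by
    have := ENNReal.summable_toReal hT.ne
    simpa only [ENNReal.toReal_ofReal (sq_nonneg _)] using this
  have hs' : Summable fun i => ‖U (R (onb H i))‖ * ‖R (onb H i)‖ :=
    hs.of_nonneg_of_le (fun i => by positivity) hle
  refine ⟨fun i => U (R (onb H i)), fun i => R (onb H i), ⟨hs', ?_⟩, ?_⟩
  · intro x y
    have h := (onb H).hasSum_inner_mul_inner (R (ContinuousLinearMap.adjoint U y)) (R x)
    have e1 : inner ℂ (R (ContinuousLinearMap.adjoint U y)) (R x) = inner ℂ y (T x) := by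
      rw [hsymm, ← mul_apply_eq_comp, hRR, ContinuousLinearMap.adjoint_inner_left,
        ← ContinuousLinearMap.comp_apply, hUT]
    rw [e1] at h
    refine h.congr_fun fun i => ?_
    rw [hsymm (onb H i), hsymm (ContinuousLinearMap.adjoint U y),
      ContinuousLinearMap.adjoint_inner_left]
  · rw [ENNReal.tsum_toReal_eq (fun i => ENNReal.ofReal_ne_top)]
    simp only [ENNReal.toReal_ofReal (sq_nonneg _)]
    exact hs'.tsum_le_tsum hle hs

/-- Bessel's inequality in bilinear form. -/
theorem sum_norm_inner_mul_inner_le {ι : Type*} {e : ι → H} (he : Orthonormal ℂ e) (a b : H)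
    (F : Finset ι) :
    ∑ j ∈ F, ‖inner ℂ (e j) b * inner ℂ a (e j)‖ ≤ ‖b‖ * ‖a‖ := by
  simp only [norm_mul]
  refine (Real.sum_mul_le_sqrt_mul_sqrt F _ _).trans ?_
  gcongr
  · exact Real.sqrt_le_iff.2 ⟨norm_nonneg _, he.sum_inner_products_le b⟩
  · simp only [norm_inner_symm a]
    exact Real.sqrt_le_iff.2 ⟨norm_nonneg _, he.sum_inner_products_le a⟩

theorem norm_sum_inner_mul_inner_le {ι : Type*} {e : ι → H} (he : Orthonormal ℂ e) (a b : H)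
    (F : Finset ι) :
    ‖∑ j ∈ F, inner ℂ (e j) b * inner ℂ a (e j)‖ ≤ ‖b‖ * ‖a‖ :=
  (norm_sum_le _ _).trans (sum_norm_inner_mul_inner_le he a b F)

theorem norm_apply_le_of_contraction {V : H →L[ℂ] H} (hV : ‖V‖ ≤ 1) (x : H) : ‖V x‖ ≤ ‖x‖ := by
  simpa using V.le_of_opNorm_le hV x

namespace IsNuclear

variable {ι : Type*} {T : H →L[ℂ] H} {u v : ι → H}

theorem comp_left (h : IsNuclear T u v) (V : H →L[ℂ] H) :
    IsNuclear (V ∘L T) (fun i => V (u i)) v where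
  summable := by
    refine (h.summable.mul_left ‖V‖).of_nonneg_of_le (fun i => by positivity) fun i => ?_
    rw [← mul_assoc]
    gcongr
    exact V.le_opNorm _
  hasSum x y := by
    simpa only [ContinuousLinearMap.adjoint_inner_left, ContinuousLinearMap.comp_apply] using
      h.hasSum x (ContinuousLinearMap.adjoint V y)

theorem adjoint (h : IsNuclear T u v) : IsNuclear (ContinuousLinearMap.adjoint T) v u where
  summable := by simpa only [mul_comm] using h.summable
  hasSum x y := by
    have := (h.hasSum y x).map (starRingEnd ℂ) Complex.continuous_conj
    rw [inner_conj_symm, ← ContinuousLinearMap.adjoint_inner_right] at this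
    convert this using 2 with i
    simp [inner_conj_symm, mul_comm]

/-- The trace does not depend on the orthonormal basis. -/
theorem hasSum_trace (h : IsNuclear T u v) {κ : Type*} (b : HilbertBasis κ ℂ H) :
    HasSum (fun j => inner ℂ (b j) (T (b j))) (∑' i, inner ℂ (v i) (u i)) := by
  have hfib : ∀ i, HasSum (fun j => inner ℂ (b j) (u i) * inner ℂ (v i) (b j))
      (inner ℂ (v i) (u i)) := fun i => by
    simpa only [mul_comm] using b.hasSum_inner_mul_inner (v i) (u i)
  have hle : ∀ i, ∀ F : Finset κ, ∑ j ∈ F, ‖inner ℂ (b j) (u i) * inner ℂ (v i) (b j)‖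
      ≤ ‖u i‖ * ‖v i‖ := fun i F => sum_norm_inner_mul_inner_le b.orthonormal _ _ F
  have hs1 : ∀ i, Summable fun j => ‖inner ℂ (b j) (u i) * inner ℂ (v i) (b j)‖ := fun i =>
    summable_of_sum_le (fun j => norm_nonneg _) (hle i)
  have hsum : Summable fun p : ι × κ => inner ℂ (b p.2) (u p.1) * inner ℂ (v p.1) (b p.2) := by
    refine Summable.of_norm ((summable_prod_of_nonneg fun p => norm_nonneg _).2 ⟨hs1, ?_⟩)
    exact h.summable.of_nonneg_of_le (fun i => tsum_nonneg fun j => norm_nonneg _)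
      fun i => (hs1 i).tsum_le_of_sum_le (hle i)
  -- The double family is absolutely summable by Bessel, so it may be summed over `j` first or over
  -- `i` first.
  have h1 := hsum.hasSum
  have h2 : ∑' p : ι × κ, inner ℂ (b p.2) (u p.1) * inner ℂ (v p.1) (b p.2)
      = ∑' i, inner ℂ (v i) (u i) := ((h1.prod_fiberwise hfib).tsum_eq).symm
  rw [h2] at h1
  exact ((Equiv.prodComm κ ι).hasSum_iff.2 h1).prod_fiberwise fun j => h.hasSum (b j) (b j)

theorem schattenNorm_le (h : IsNuclear T u v) :
    schattenNorm 1 T ≤ ENNReal.ofReal (∑' i, ‖u i‖ * ‖v i‖) := by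
  refine schattenNorm_one_le fun V hV F => ?_
  have h1 := hasSum_sum fun j (_ : j ∈ F) => (h.comp_left V).hasSum (onb H j) (onb H j)
  have hle : ∀ i, ‖∑ j ∈ F, inner ℂ (onb H j) (V (u i)) * inner ℂ (v i) (onb H j)‖
      ≤ ‖u i‖ * ‖v i‖ := fun i =>
    (norm_sum_inner_mul_inner_le (onb H).orthonormal _ _ F).trans <| by
      gcongr
      exact norm_apply_le_of_contraction hV _
  exact h1.norm_le_of_bounded h.summable.hasSum hle

end IsNuclear

/-- Converse to `schattenNorm_one_le`: the trace norm is a supremum over contractions, which yields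
its triangle inequality below without any calculus of `|S + T|`. -/
theorem norm_sum_inner_le_schattenNorm {T : H →L[ℂ] H} (hT : schattenNorm 1 T < ∞)
    {V : H →L[ℂ] H} (hV : ‖V‖ ≤ 1) (F : Finset (basisIndex H)) :
    ‖∑ i ∈ F, inner ℂ (onb H i) (V (T (onb H i)))‖ ≤ (schattenNorm 1 T).toReal := by
  obtain ⟨u, v, h, hle⟩ := exists_isNuclear hT
  refine le_trans ?_ hle
  have h1 := hasSum_sum fun j (_ : j ∈ F) => (h.comp_left V).hasSum (onb H j) (onb H j)
  have hle : ∀ i, ‖∑ j ∈ F, inner ℂ (onb H j) (V (u i)) * inner ℂ (v i) (onb H j)‖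
      ≤ ‖u i‖ * ‖v i‖ := fun i =>
    (norm_sum_inner_mul_inner_le (onb H).orthonormal _ _ F).trans <| by
      gcongr
      exact norm_apply_le_of_contraction hV _
  exact h1.norm_le_of_bounded h.summable.hasSum hle

/-- The trace is continuous for the trace norm. -/
theorem norm_trace_comp_le {T V : H →L[ℂ] H} (hT : schattenNorm 1 T < ∞) (hV : ‖V‖ ≤ 1) :
    ‖trace (V ∘L T)‖ ≤ (schattenNorm 1 T).toReal := by
  obtain ⟨u, v, h, -⟩ := exists_isNuclear hT
  have h1 := (h.comp_left V).hasSum_trace (onb H)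
  rw [trace, h1.tsum_eq]
  refine le_of_tendsto h1.norm (Filter.Eventually.of_forall fun F => ?_)
  exact norm_sum_inner_le_schattenNorm hT hV F

theorem schattenNorm_one_add_le (S T : H →L[ℂ] H) :
    schattenNorm 1 (S + T) ≤ schattenNorm 1 S + schattenNorm 1 T := by
  by_cases hS : schattenNorm 1 S < ∞
  swap
  · simp [not_lt_top_iff.1 hS]
  by_cases hT : schattenNorm 1 T < ∞
  swap
  · simp [not_lt_top_iff.1 hT]
  rw [← ENNReal.ofReal_toReal (ENNReal.add_lt_top.2 ⟨hS, hT⟩).ne, ENNReal.toReal_add hS.ne hT.ne]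
  refine schattenNorm_one_le fun V hV F => ?_
  simp only [add_apply, map_add, inner_add_right, Finset.sum_add_distrib]
  exact (norm_add_le _ _).trans (add_le_add (norm_sum_inner_le_schattenNorm hS hV F)
    (norm_sum_inner_le_schattenNorm hT hV F))

theorem schattenNorm_one_smul_lt_top (c : ℂ) {T : H →L[ℂ] H} (hT : schattenNorm 1 T < ∞) :
    schattenNorm 1 (c • T) < ∞ := by
  refine lt_of_le_of_lt (schattenNorm_one_le (C := ‖c‖ * (schattenNorm 1 T).toReal)
    fun V hV F => ?_) ENNReal.ofReal_lt_top
  simp only [smul_apply, map_smul, inner_smul_right, ← Finset.mul_sum,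
    norm_mul]
  gcongr
  exact norm_sum_inner_le_schattenNorm hT hV F

/-- A quasi-triangle inequality is enough for density arguments, and it follows termwise from `‖a +
b‖² ≤ 2 (‖a‖² + ‖b‖²)`. -/
theorem schattenNorm_two_add_le (S T : H →L[ℂ] H) :
    schattenNorm 2 (S + T) ≤ 2 * (schattenNorm 2 S + schattenNorm 2 T) := by
  simp only [schattenNorm_two_eq]
  set A := ∑' i, ENNReal.ofReal (‖S (onb H i)‖ ^ 2)
  set B := ∑' i, ENNReal.ofReal (‖T (onb H i)‖ ^ 2)
  have h : ∑' i, ENNReal.ofReal (‖(S + T) (onb H i)‖ ^ 2) ≤ 4 * (max A B) := by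
    calc _ ≤ ∑' i, 2 * (ENNReal.ofReal (‖S (onb H i)‖ ^ 2) + ENNReal.ofReal (‖T (onb H i)‖ ^ 2)) := by
          refine ENNReal.tsum_le_tsum fun i => ?_
          rw [← ENNReal.ofReal_add (by positivity) (by positivity),
            show (2 : ℝ≥0∞) = ENNReal.ofReal 2 by simp, ← ENNReal.ofReal_mul (by norm_num)]
          refine ENNReal.ofReal_le_ofReal ?_
          have := norm_add_le (S (onb H i)) (T (onb H i))
          rw [add_apply]
          nlinarith [sq_nonneg (‖S (onb H i)‖ - ‖T (onb H i)‖), norm_nonneg (S (onb H i) + T (onb H i))]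
      _ = 2 * (A + B) := by rw [ENNReal.tsum_mul_left, ENNReal.tsum_add]
      _ ≤ 2 * (max A B + max A B) := by gcongr <;> simp
      _ = 4 * max A B := by ring
  calc _ ≤ (4 * max A B) ^ (1 / 2 : ℝ) := by gcongr
    _ = 2 * (max A B) ^ (1 / 2 : ℝ) := by
        rw [ENNReal.mul_rpow_of_nonneg _ _ (by norm_num)]
        congr 1
        rw [show (4 : ℝ≥0∞) = 2 ^ (2 : ℝ) by norm_num, ← ENNReal.rpow_mul]
        norm_num
    _ ≤ _ := by
        gcongr
        rcases max_cases A B with ⟨h, -⟩ | ⟨h, -⟩ <;> rw [h] <;> simp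

/-- The rank one operator `⟨·, v⟩ u`. -/
def rankOne (u v : H) : H →L[ℂ] H := (innerSL ℂ v).smulRight u

theorem inner_rankOne (u v x y : H) :
    inner ℂ y (rankOne u v x) = inner ℂ y u * inner ℂ v x := by
  simp [rankOne, mul_comm]

theorem isNuclear_rankOne (u v : H) :
    IsNuclear (rankOne u v) (fun _ : Unit => u) (fun _ => v) where
  summable := Summable.of_finite
  hasSum x y := by
    rw [inner_rankOne]
    exact hasSum_unique _

/-- `T` is in the closure of `M` for the Schatten norm. -/
def SchattenApprox (p : ℝ) (M : Set (H →L[ℂ] H)) (T : H →L[ℂ] H) : Prop :=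
  ∀ ε : ℝ≥0∞, 0 < ε → ∃ A ∈ M, schattenNorm p (T - A) < ε

theorem exists_two_mul_add_lt {ε : ℝ≥0∞} (hε : 0 < ε) :
    ∃ δ : ℝ≥0∞, 0 < δ ∧ ∀ a b, a < δ → b < δ → 2 * (a + b) < ε := by
  by_cases h : ε = ∞
  · refine ⟨1, one_pos, fun a b ha hb => h ▸ ?_⟩
    exact ENNReal.mul_lt_top (by simp) (ENNReal.add_lt_top.2 ⟨ha.trans_le le_top, hb.trans_le le_top⟩)
  · refine ⟨ε / 4, ENNReal.div_pos hε.ne' (by simp), fun a b ha hb => ?_⟩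
    calc 2 * (a + b) < 2 * (ε / 4 + ε / 4) := by
          refine (ENNReal.mul_lt_mul_iff_right (by simp) (by simp)).2 (ENNReal.add_lt_add ha hb)
      _ = 4 * (ε / 4) := by ring
      _ = ε := ENNReal.mul_div_cancel (by simp) (by simp)

theorem SchattenApprox.add {p : ℝ} {M : Set (H →L[ℂ] H)}
    (hp : ∀ S T : H →L[ℂ] H, schattenNorm p (S + T) ≤ 2 * (schattenNorm p S + schattenNorm p T))
    (hM : ∀ A ∈ M, ∀ B ∈ M, A + B ∈ M) {S T : H →L[ℂ] H}
    (hS : SchattenApprox p M S) (hT : SchattenApprox p M T) : SchattenApprox p M (S + T) := by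
  intro ε hε
  obtain ⟨δ, hδ, h⟩ := exists_two_mul_add_lt hε
  obtain ⟨A, hA, hA'⟩ := hS δ hδ
  obtain ⟨B, hB, hB'⟩ := hT δ hδ
  refine ⟨A + B, hM A hA B hB, ?_⟩
  rw [add_sub_add_comm]
  exact (hp _ _).trans_lt (h _ _ hA' hB')

theorem SchattenApprox.trans {p : ℝ} {M N : Set (H →L[ℂ] H)}
    (hp : ∀ S T : H →L[ℂ] H, schattenNorm p (S + T) ≤ 2 * (schattenNorm p S + schattenNorm p T))
    {T : H →L[ℂ] H} (hT : SchattenApprox p N T) (hN : ∀ S ∈ N, SchattenApprox p M S) :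
    SchattenApprox p M T := by
  intro ε hε
  obtain ⟨δ, hδ, h⟩ := exists_two_mul_add_lt hε
  obtain ⟨A, hA, hA'⟩ := hT δ hδ
  obtain ⟨B, hB, hB'⟩ := hN A hA δ hδ
  refine ⟨B, hB, ?_⟩
  rw [← sub_add_sub_cancel T A B]
  exact (hp _ _).trans_lt (h _ _ hA' hB')

/-- Finite sums of rank one operators. -/
def finiteRankSums (H : Type*) [NormedAddCommGroup H] [InnerProductSpace ℂ H] [CompleteSpace H] :
    Set (H →L[ℂ] H) :=
  {T | ∃ (F : Finset (basisIndex H)) (u v : basisIndex H → H), T = ∑ i ∈ F, rankOne (u i) (v i)}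

/-- The reduction shared by `p = 1` and `p = 2`: once finite rank sums are dense and `M` is
additive, only rank one operators need to be approximated. -/
theorem denseInSchatten_of_rankOne {p : ℝ} {M : Set (H →L[ℂ] H)}
    (hp : ∀ S T : H →L[ℂ] H, schattenNorm p (S + T) ≤ 2 * (schattenNorm p S + schattenNorm p T))
    (hfin : ∀ T : H →L[ℂ] H, schattenNorm p T < ∞ → SchattenApprox p (finiteRankSums H) T)
    (hMp : M ⊆ schattenClass H p) (h0 : (0 : H →L[ℂ] H) ∈ M)
    (hM : ∀ A ∈ M, ∀ B ∈ M, A + B ∈ M) (h1 : ∀ u v : H, SchattenApprox p M (rankOne u v))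
    (h00 : schattenNorm p (0 : H →L[ℂ] H) = 0) :
    DenseInSchatten p M := by
  refine ⟨hMp, fun T hT => ?_⟩
  refine SchattenApprox.trans hp (hfin T hT) ?_
  rintro _ ⟨F, u, v, rfl⟩
  induction F using Finset.cons_induction with
  | empty =>
    intro ε hε
    exact ⟨0, h0, by simpa [h00] using hε⟩
  | cons i F hi ih =>
    rw [Finset.sum_cons]
    exact (h1 _ _).add hp hM ih

theorem schattenNorm_two_zero : schattenNorm 2 (0 : H →L[ℂ] H) = 0 := by
  rw [schattenNorm_two_eq]; simp

theorem schattenNorm_one_zero : schattenNorm 1 (0 : H →L[ℂ] H) = 0 := by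
  rw [schattenNorm_one_eq]; simp

/-- Truncate a nuclear representation; the remainder is again nuclear, and the tail of the series
bounds its trace norm. -/
theorem schattenApprox_one_finiteRankSums {T : H →L[ℂ] H} (hT : schattenNorm 1 T < ∞) :
    SchattenApprox 1 (finiteRankSums H) T := by
  obtain ⟨u, v, h, -⟩ := exists_isNuclear hT
  intro ε hε
  obtain ⟨r, hr0, hr⟩ : ∃ r : ℝ, 0 < r ∧ ENNReal.ofReal r ≤ ε := by
    by_cases hε' : ε = ∞
    · exact ⟨1, one_pos, by simp [hε']⟩
    · exact ⟨ε.toReal, ENNReal.toReal_pos hε.ne' hε', ENNReal.ofReal_toReal_le⟩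
  have ht := tendsto_tsum_compl_atTop_zero fun i => ‖u i‖ * ‖v i‖
  obtain ⟨F, hF⟩ := (ht.eventually (gt_mem_nhds hr0)).exists
  refine ⟨∑ i ∈ F, rankOne (u i) (v i), ⟨F, u, v, rfl⟩, ?_⟩
  have hnuc : IsNuclear (T - ∑ i ∈ F, rankOne (u i) (v i))
      (fun i : {i // i ∉ F} => u i) (fun i => v i) := by
    refine ⟨h.summable.subtype _, fun x y => ?_⟩
    refine (Finset.hasSum_compl_iff F (f := fun i => inner ℂ y (u i) * inner ℂ (v i) x)).2 ?_
    have he : inner ℂ y ((T - ∑ i ∈ F, rankOne (u i) (v i)) x)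
        + ∑ i ∈ F, inner ℂ y (u i) * inner ℂ (v i) x = inner ℂ y (T x) := by
      simp [sum_apply, inner_rankOne]
    have := h.hasSum x y
    rwa [← he] at this
  refine lt_of_lt_of_le (hnuc.schattenNorm_le.trans_lt ?_) hr
  exact (ENNReal.ofReal_lt_ofReal_iff hr0).2 hF

theorem schattenApprox_two_finiteRankSums {T : H →L[ℂ] H} (hT : schattenNorm 2 T < ∞) :
    SchattenApprox 2 (finiteRankSums H) T := by
  classical
  rw [schattenNorm_two_lt_top_iff] at hT
  intro ε hε
  have ht := ENNReal.tendsto_tsum_compl_atTop_zero hT.ne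
  have ht2 := (ENNReal.continuous_rpow_const (y := (1 / 2 : ℝ))).continuousAt.tendsto.comp ht
  rw [ENNReal.zero_rpow_of_pos (by norm_num)] at ht2
  obtain ⟨F, hF⟩ := (ht2.eventually (gt_mem_nhds hε)).exists
  -- This is `T` composed with the projection onto the span of the `eᵢ`, `i ∈ F`; the difference
  -- kills these `eᵢ` and equals `T` on the others.
  refine ⟨∑ i ∈ F, rankOne (T (onb H i)) (onb H i), ⟨F, _, _, rfl⟩, ?_⟩
  rw [schattenNorm_two_eq]
  refine lt_of_le_of_lt ?_ hF
  simp only [Function.comp_apply]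
  gcongr ?_ ^ _
  have hval : ∀ j, (T - ∑ i ∈ F, rankOne (T (onb H i)) (onb H i)) (onb H j)
      = if j ∈ F then 0 else T (onb H j) := by
    intro j
    have : ∀ i, rankOne (T (onb H i)) (onb H i) (onb H j)
        = if i = j then T (onb H j) else 0 := by
      intro i
      rw [rankOne, ContinuousLinearMap.smulRight_apply, innerSL_apply_apply,
        orthonormal_iff_ite.1 (onb H).orthonormal]
      by_cases hij : i = j <;> simp [hij]
    rw [sub_apply, sum_apply]
    simp only [this, Finset.sum_ite_eq']
    split_ifs <;> simp
  simp only [hval]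
  refine le_of_le_of_eq ?_
    (tsum_subtype {j | j ∉ F} fun j => ENNReal.ofReal (‖T (onb H j)‖ ^ 2)).symm
  refine ENNReal.tsum_le_tsum fun j => ?_
  by_cases hj : j ∈ F <;> simp [hj, Set.indicator]

/-- Distinct basis vectors are at distance `√2`, so their balls of radius `1/2` are disjoint.
Countability is what permits exchanging sums over the basis with integrals. -/
theorem countable_basisIndex [TopologicalSpace.SeparableSpace H] : Countable (basisIndex H) := by
  have hd : Pairwise fun i j : basisIndex H =>
      Disjoint (Metric.ball (onb H i) (1 / 2)) (Metric.ball (onb H j) (1 / 2)) := by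
    intro i j hij
    refine Metric.ball_disjoint_ball ?_
    have h : dist (onb H i) (onb H j) ^ 2 = 2 := by
      rw [dist_eq_norm, @norm_sub_sq ℂ, (onb H).orthonormal.1, (onb H).orthonormal.1,
        (onb H).orthonormal.2 hij]
      norm_num
    nlinarith [dist_nonneg (x := onb H i) (y := onb H j)]
  exact Pairwise.countable_of_isOpen_disjoint hd (fun i => Metric.isOpen_ball)
    fun i => ⟨onb H i, Metric.mem_ball_self (by norm_num)⟩

end SchattenTheory

end LocOp

namespace LocOp

/-! ### Plancherel's theorem for the Fourier integral. -/

section Plancherel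

open FourierTransform SchwartzMap
open scoped ContDiff

variable {E : Type*} [NormedAddCommGroup E] [InnerProductSpace ℝ E] [FiniteDimensional ℝ E]
  [MeasurableSpace E] [BorelSpace E]

/-- The `L²` Fourier transform and the Fourier integral have the same pairing with every test
function, since in both cases the transform can be moved onto the test function. -/
theorem fourier_toLp_ae_eq {f : E → ℂ} (hf : Integrable f) (hf2 : MemLp f 2 volume) :
    (𝓕 (hf2.toLp f) : Lp ℂ 2 (volume : Measure E)) =ᵐ[volume] 𝓕 f := by
  have hcont : Continuous (𝓕 f) :=
    VectorFourier.fourierIntegral_continuous Real.continuous_fourierChar continuous_inner hf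
  have hloc : LocallyIntegrable ((𝓕 (hf2.toLp f) : Lp ℂ 2 (volume : Measure E)) : E → ℂ) volume :=
    (Lp.memLp _).locallyIntegrable (by norm_num)
  refine ae_eq_of_integral_contDiff_smul_eq hloc hcont.locallyIntegrable fun g hg hgc => ?_
  have hgc' : HasCompactSupport fun x => (g x : ℂ) := hgc.comp_left Complex.ofReal_zero
  have hg' : ContDiff ℝ ∞ fun x => (g x : ℂ) := Complex.ofRealCLM.contDiff.comp hg
  let G : 𝓢(E, ℂ) := hgc'.toSchwartzMap hg'
  have hG : ∀ x, G x = (g x : ℂ) := fun x => rfl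
  have h1 := congrArg (fun T => T G) (Lp.fourier_toTemperedDistribution_eq (hf2.toLp f))
  simp only [TemperedDistribution.fourier_apply, Lp.toTemperedDistribution_apply] at h1
  have h2 := VectorFourier.integral_fourierIntegral_smul_eq_flip (μ := volume) (ν := volume)
    (L := innerₗ E) Real.continuous_fourierChar continuous_inner (G.integrable (μ := volume)) hf
  have h3 : ∫ x, (𝓕 G) x • (hf2.toLp f : E → ℂ) x = ∫ x, 𝓕 (G : E → ℂ) x • f x := by
    refine integral_congr_ae ?_
    filter_upwards [hf2.coeFn_toLp] with x hx
    rw [hx]; rfl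
  calc ∫ x, g x • ((𝓕 (hf2.toLp f) : Lp ℂ 2 (volume : Measure E)) : E → ℂ) x
      = ∫ x, G x • ((𝓕 (hf2.toLp f) : Lp ℂ 2 (volume : Measure E)) : E → ℂ) x := by simp [hG]
    _ = ∫ x, 𝓕 (G : E → ℂ) x • f x := by rw [← h1, h3]
    _ = ∫ x, G x • 𝓕 f x := by
      rw [show (innerₗ E).flip = innerₗ E from flip_innerₗ E] at h2
      exact h2
    _ = ∫ x, g x • 𝓕 f x := by simp [hG]

/-- Plancherel's theorem for functions in `L¹ ∩ L²`. -/
theorem eLpNorm_fourier_eq {f : E → ℂ} (hf : Integrable f) (hf2 : MemLp f 2 volume) :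
    eLpNorm (𝓕 f) 2 volume = eLpNorm f 2 volume := by
  rw [← eLpNorm_congr_ae (fourier_toLp_ae_eq hf hf2), ← eLpNorm_congr_ae hf2.coeFn_toLp,
    ← Lp.enorm_def, ← Lp.enorm_def, enorm_eq_nnnorm, enorm_eq_nnnorm]
  congr 1
  exact NNReal.eq (Lp.norm_fourier_eq _)

end Plancherel

variable {d : ℕ}

/-! ### Time-frequency shifts, their commutation relation and strong continuity. -/

section TFShift

theorem tfShift_ae (z : Phase d) (ψ : L2 d) :
    tfShift z ψ =ᵐ[volume] tfShiftFun z ψ := (memLp_tfShiftFun z ψ).coeFn_toLp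

theorem norm_exp_two_pi_I (r : ℝ) : ‖Complex.exp (2 * Real.pi * Complex.I * r)‖ = 1 := by
  rw [show (2 * Real.pi * Complex.I * r : ℂ) = ((2 * Real.pi * r : ℝ) : ℂ) * Complex.I by
    push_cast; ring, Complex.norm_exp_ofReal_mul_I]

theorem ae_comp_sub {α : Type*} {f g : Space d → α} (h : f =ᵐ[volume] g) (x : Space d) :
    (fun t => f (t - x)) =ᵐ[volume] fun t => g (t - x) :=
  (measurePreserving_sub_right volume x).quasiMeasurePreserving.ae_eq_comp h

/-- The time-frequency shift as a linear isometry. -/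
def tfIso (z : Phase d) : L2 d →ₗᵢ[ℂ] L2 d where
  toFun := tfShift z
  map_add' f g := by
    refine Lp.ext ?_
    filter_upwards [tfShift_ae z (f + g), tfShift_ae z f, tfShift_ae z g,
      Lp.coeFn_add (tfShift z f) (tfShift z g), ae_comp_sub (Lp.coeFn_add f g) z.1]
      with t h1 h2 h3 h4 h5
    rw [h1, h4, Pi.add_apply, h2, h3]
    simp only [tfShiftFun, h5, Pi.add_apply, mul_add]
  map_smul' c f := by
    refine Lp.ext ?_
    filter_upwards [tfShift_ae z (c • f), tfShift_ae z f,
      Lp.coeFn_smul c (tfShift z f), ae_comp_sub (Lp.coeFn_smul c f) z.1]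
      with t h1 h2 h4 h5
    rw [h1, RingHom.id_apply, h4, Pi.smul_apply, h2]
    simp only [tfShiftFun, h5, Pi.smul_apply, smul_eq_mul]
    ring
  norm_map' f := by
    have h : MemLp (fun t => f (t - z.1)) 2 (volume : Measure (Space d)) :=
      (Lp.memLp f).comp_measurePreserving (measurePreserving_sub_right volume z.1)
    simp only [LinearMap.coe_mk, AddHom.coe_mk]
    rw [Lp.norm_def, Lp.norm_def, eLpNorm_congr_ae (tfShift_ae z f)]
    congr 1
    rw [← eLpNorm_comp_measurePreserving (Lp.aestronglyMeasurable f)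
      (measurePreserving_sub_right volume z.1)]
    refine eLpNorm_congr_norm_ae (Filter.Eventually.of_forall fun t => ?_)
    rw [tfShiftFun, norm_mul, norm_exp_two_pi_I, one_mul, Function.comp_apply]

theorem tfShift_add (z : Phase d) (f g : L2 d) :
    tfShift z (f + g) = tfShift z f + tfShift z g := map_add (tfIso z) f g

theorem tfShift_sub (z : Phase d) (f g : L2 d) :
    tfShift z (f - g) = tfShift z f - tfShift z g := map_sub (tfIso z) f g

theorem tfShift_smul (z : Phase d) (c : ℂ) (f : L2 d) :
    tfShift z (c • f) = c • tfShift z f := map_smul (tfIso z) c f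

@[simp] theorem norm_tfShift (z : Phase d) (f : L2 d) : ‖tfShift z f‖ = ‖f‖ :=
  (tfIso z).norm_map f

theorem inner_tfShift (z : Phase d) (f g : L2 d) :
    inner ℂ (tfShift z f) (tfShift z g) = inner ℂ f g := (tfIso z).inner_map_map f g

theorem tfShift_zero (f : L2 d) : tfShift 0 f = f := by
  refine Lp.ext ?_
  filter_upwards [tfShift_ae 0 f] with t ht
  rw [ht]; simp [tfShiftFun]

theorem tfShift_tfShift (z w : Phase d) (f : L2 d) :
    tfShift z (tfShift w f)
      = Complex.exp (-(2 * Real.pi * Complex.I * (inner ℝ w.2 z.1 : ℝ))) • tfShift (z + w) f := by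
  refine Lp.ext ?_
  filter_upwards [tfShift_ae z (tfShift w f), ae_comp_sub (tfShift_ae w f) z.1,
    Lp.coeFn_smul (Complex.exp (-(2 * Real.pi * Complex.I * (inner ℝ w.2 z.1 : ℝ))))
      (tfShift (z + w) f), tfShift_ae (z + w) f] with t h1 h2 h3 h4
  rw [h1, h3, Pi.smul_apply, h4, smul_eq_mul]
  simp only [tfShiftFun, h2, ← mul_assoc, ← Complex.exp_add, Prod.fst_add, Prod.snd_add,
    inner_add_left, inner_sub_right, sub_sub]
  congr 2
  push_cast
  ring

/-- The symplectic character `e^{2πi [ζ, z]}` of phase space. -/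
def chi (ζ z : Phase d) : ℂ :=
  Complex.exp (2 * Real.pi * Complex.I * ((inner ℝ ζ.2 z.1 - inner ℝ ζ.1 z.2 : ℝ)))

@[simp] theorem norm_chi (ζ z : Phase d) : ‖chi ζ z‖ = 1 := norm_exp_two_pi_I _

theorem chi_add_right (ζ z w : Phase d) : chi ζ (z + w) = chi ζ z * chi ζ w := by
  simp only [chi, ← Complex.exp_add, Prod.fst_add, Prod.snd_add, inner_add_right]
  congr 1; push_cast; ring

theorem chi_add_left (ζ z w : Phase d) : chi (z + w) ζ = chi z ζ * chi w ζ := by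
  simp only [chi, ← Complex.exp_add, Prod.fst_add, Prod.snd_add, inner_add_left]
  congr 1; push_cast; ring

@[simp] theorem chi_zero_right (ζ : Phase d) : chi ζ 0 = 1 := by simp [chi]

theorem chi_neg_left (ζ z : Phase d) : chi (-z) ζ = chi ζ z := by
  simp only [chi, Prod.fst_neg, Prod.snd_neg, inner_neg_left, real_inner_comm]
  congr 2; push_cast; ring

theorem chi_neg_right (ζ z : Phase d) : chi ζ (-z) = chi z ζ := by
  simp only [chi, Prod.fst_neg, Prod.snd_neg, inner_neg_right, real_inner_comm]
  congr 2; push_cast; ring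

theorem continuous_chi : Continuous fun p : Phase d × Phase d => chi p.1 p.2 := by
  unfold chi; fun_prop

theorem continuous_chi_left (z : Phase d) : Continuous fun ζ : Phase d => chi ζ z := by
  unfold chi; fun_prop

theorem continuous_chi_right (ζ : Phase d) : Continuous fun z : Phase d => chi ζ z := by
  unfold chi; fun_prop

/-- The source of every Fourier-analytic statement below: it turns inner products of shifted vectors
into symplectic characters. -/
theorem tfShift_comm (ζ z : Phase d) (f : L2 d) :
    tfShift ζ (tfShift z f) = chi ζ z • tfShift z (tfShift ζ f) := by
  rw [tfShift_tfShift, tfShift_tfShift, smul_smul, chi, ← Complex.exp_add, add_comm z ζ,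
    real_inner_comm z.2]
  congr 2; push_cast; ring

theorem tfShift_surjective (z : Phase d) (f : L2 d) : ∃ g, tfShift z g = f := by
  refine ⟨Complex.exp (2 * Real.pi * Complex.I * (inner ℝ (-z).2 z.1 : ℝ)) • tfShift (-z) f, ?_⟩
  rw [tfShift_smul, tfShift_tfShift, smul_smul, ← Complex.exp_add, add_neg_cancel,
    add_neg_cancel, Complex.exp_zero, one_smul, tfShift_zero]

theorem continuous_tfShift (f : L2 d) : Continuous fun z : Phase d => tfShift z f := by
  have hT : Continuous fun x : Space d => tfShift (x, 0) f := by
    have : Fact ((2 : ℝ≥0∞) ≠ ∞) := ⟨by simp⟩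
    have h : Continuous fun x : Space d => (DomAddAct.mk (-x)) +ᵥ f :=
      ((DomAddAct.continuous_mk.comp continuous_neg).vadd continuous_const)
    refine h.congr fun x => Lp.ext ?_
    filter_upwards [DomAddAct.vadd_Lp_ae_eq (DomAddAct.mk (-x)) f, tfShift_ae (x, 0) f]
      with t h1 h2
    rw [h1, h2]
    simp [tfShiftFun, sub_eq_neg_add]
  -- For modulations, weak continuity (dominated convergence) suffices: all the vectors have norm
  -- `‖g‖`, so inner products determine distances.
  have hM : ∀ g : L2 d, Continuous fun ω : Space d => tfShift ((0 : Space d), ω) g := by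
    intro g
    have hw : ∀ ω₀ : Space d, Continuous fun ω : Space d =>
        inner ℂ (tfShift ((0 : Space d), ω₀) g) (tfShift ((0 : Space d), ω) g) := by
      intro ω₀
      have hg2 : Integrable (fun t => ‖g t‖ * ‖g t‖) volume := by
        have := (L2.integrable_inner (𝕜 := ℂ) g g).norm
        refine this.congr (Filter.Eventually.of_forall fun t => ?_)
        simp [inner_self_eq_norm_sq_to_K, sq]
      have h : Continuous fun ω : Space d => ∫ t : Space d,
          inner ℂ (tfShiftFun ((0 : Space d), ω₀) g t) (tfShiftFun ((0 : Space d), ω) g t) := by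
        refine continuous_of_dominated (bound := fun t => ‖g t‖ * ‖g t‖) ?_ ?_ hg2 ?_
        · intro ω
          exact (memLp_tfShiftFun _ g).1.inner (memLp_tfShiftFun _ g).1
        · intro ω
          refine Filter.Eventually.of_forall fun t => (norm_inner_le_norm _ _).trans ?_
          simp [tfShiftFun, norm_exp_two_pi_I]
        · refine Filter.Eventually.of_forall fun t => ?_
          simp only [tfShiftFun]
          fun_prop
      refine h.congr fun ω => ?_
      rw [L2.inner_def]
      refine integral_congr_ae ?_
      filter_upwards [tfShift_ae ((0 : Space d), ω₀) g, tfShift_ae ((0 : Space d), ω) g]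
        with t h1 h2
      rw [h1, h2]
    rw [continuous_iff_continuousAt]
    intro ω₀
    rw [ContinuousAt, tendsto_iff_norm_sub_tendsto_zero]
    have h : Continuous fun ω : Space d =>
        √(‖g‖ ^ 2 - 2 * (inner ℂ (tfShift ((0 : Space d), ω₀) g)
          (tfShift ((0 : Space d), ω) g)).re + ‖g‖ ^ 2) :=
      ((continuous_const.sub (continuous_const.mul
        (Complex.continuous_re.comp (hw ω₀)))).add continuous_const).sqrt
    have h2 := h.tendsto ω₀
    have e0 : ∀ ω : Space d, √(‖g‖ ^ 2 - 2 * (inner ℂ (tfShift ((0 : Space d), ω₀) g)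
          (tfShift ((0 : Space d), ω) g)).re + ‖g‖ ^ 2)
        = ‖tfShift ((0 : Space d), ω) g - tfShift ((0 : Space d), ω₀) g‖ := by
      intro ω
      rw [norm_sub_rev, ← Real.sqrt_sq (norm_nonneg (_ - _)), @norm_sub_sq ℂ, norm_tfShift,
        norm_tfShift]
      rfl
    simp only [e0, sub_self, norm_zero] at h2
    exact h2
  rw [continuous_iff_continuousAt]
  intro z₀
  have hdec : ∀ z : Phase d, tfShift z f = tfShift ((0 : Space d), z.2) (tfShift (z.1, 0) f) := by
    intro z
    rw [tfShift_tfShift]; simp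
  rw [ContinuousAt, tendsto_iff_norm_sub_tendsto_zero]
  have h1 : Filter.Tendsto (fun z : Phase d => ‖tfShift (z.1, (0 : Space d)) f
      - tfShift (z₀.1, (0 : Space d)) f‖ + ‖tfShift ((0 : Space d), z.2) (tfShift (z₀.1, 0) f)
      - tfShift ((0 : Space d), z₀.2) (tfShift (z₀.1, 0) f)‖) (nhds z₀) (nhds (0 + 0)) := by
    refine Filter.Tendsto.add ?_ ?_
    · exact tendsto_iff_norm_sub_tendsto_zero.1 ((hT.comp continuous_fst).tendsto z₀)
    · exact tendsto_iff_norm_sub_tendsto_zero.1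
        (((hM (tfShift (z₀.1, 0) f)).comp continuous_snd).tendsto z₀)
  rw [add_zero] at h1
  -- Joint continuity from separate continuity: modulations are isometries, so the error in the
  -- translation passes through them unchanged.
  refine squeeze_zero (fun _ => norm_nonneg _) (fun z => ?_) h1
  rw [hdec z, hdec z₀]
  refine (norm_sub_le_norm_sub_add_norm_sub _ (tfShift ((0 : Space d), z.2) (tfShift (z₀.1, 0) f))
    _).trans ?_
  rw [← tfShift_sub, norm_tfShift]

end TFShift

/-! ### Square integrability of the short-time Fourier transform and Moyal's identity. -/

section Moyal

theorem continuous_stft (a u : L2 d) : Continuous (stft a u) :=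
  (continuous_tfShift a).inner continuous_const

theorem norm_stft_le (a u : L2 d) (z : Phase d) : ‖stft a u z‖ ≤ ‖a‖ * ‖u‖ := by
  simpa only [stft, norm_tfShift] using norm_inner_le_norm (𝕜 := ℂ) (tfShift z a) u

theorem stft_add_right (a u v : L2 d) (z : Phase d) :
    stft a (u + v) z = stft a u z + stft a v z := inner_add_right _ _ _

theorem stft_smul_right (a : L2 d) (c : ℂ) (u : L2 d) (z : Phase d) :
    stft a (c • u) z = c * stft a u z := inner_smul_right _ _ _

theorem stft_add_left (a b u : L2 d) (z : Phase d) :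
    stft (a + b) u z = stft a u z + stft b u z := by
  rw [stft, tfShift_add, inner_add_left]; rfl

theorem stft_smul_left (a : L2 d) (c : ℂ) (u : L2 d) (z : Phase d) :
    stft (c • a) u z = starRingEnd ℂ c * stft a u z := by
  rw [stft, tfShift_smul, inner_smul_left]; rfl

open FourierTransform in
theorem stft_eq_fourier (a u : L2 d) (x ω : Space d) :
    stft a u (x, ω) = 𝓕 (fun t => starRingEnd ℂ (a (t - x)) * u t) ω := by
  rw [stft, L2.inner_def, Real.fourier_eq']
  refine integral_congr_ae ?_
  filter_upwards [tfShift_ae (x, ω) a] with t ht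
  rw [ht, tfShiftFun, RCLike.inner_apply, map_mul, ← Complex.exp_conj, smul_eq_mul]
  have : (starRingEnd ℂ) (2 * Real.pi * Complex.I * (inner ℝ ω t : ℝ))
      = ((-2 * Real.pi * inner ℝ t ω : ℝ) : ℂ) * Complex.I := by
    simp only [map_mul, Complex.conj_ofReal, Complex.conj_I, real_inner_comm t ω]
    rw [show (2 : ℂ) = ((2 : ℝ) : ℂ) by simp, Complex.conj_ofReal]
    push_cast
    ring
  rw [this]
  ring

/-- For fixed `x`, `ω ↦ stft a u (x, ω)` is the Fourier transform of `t ↦ conj a(t - x) · u(t)`.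
Plancherel in `ω` reduces the claim to Tonelli in `(x, t)`. -/
theorem lintegral_enorm_stft_sq (a u : L2 d) :
    ∫⁻ z, ‖stft a u z‖ₑ ^ 2 = (‖a‖ₑ * ‖u‖ₑ) ^ 2 := by
  have hL : ∀ f : Space d → ℂ, eLpNorm f 2 volume ^ 2 = ∫⁻ t, ‖f t‖ₑ ^ 2 := by
    intro f
    have := eLpNorm_nnreal_pow_eq_lintegral (f := f) (μ := volume) (p := 2) (by norm_num)
    norm_num at this
    exact this
  set h : Space d → Space d → ℂ := fun x t => starRingEnd ℂ (a (t - x)) * u t with hh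
  have hmeas : AEStronglyMeasurable (fun p : Space d × Space d => h p.1 p.2)
      (volume.prod volume) := by
    refine AEStronglyMeasurable.mul ?_ ((Lp.aestronglyMeasurable u).comp_snd)
    refine Complex.continuous_conj.comp_aestronglyMeasurable ?_
    have := (Lp.aestronglyMeasurable a).comp_quasiMeasurePreserving
      (quasiMeasurePreserving_sub (volume : Measure (Space d)) volume)
    exact this.comp_quasiMeasurePreserving
      (Measure.measurePreserving_swap (μ := (volume : Measure (Space d)))
        (ν := (volume : Measure (Space d)))).quasiMeasurePreserving
  have htot : ∫⁻ x, ∫⁻ t, ‖h x t‖ₑ ^ 2 = (‖a‖ₑ * ‖u‖ₑ) ^ 2 := by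
    rw [lintegral_lintegral_swap]
    swap
    · exact hmeas.enorm.pow_const 2
    have : ∀ t, ∫⁻ x, ‖h x t‖ₑ ^ 2 = ‖a‖ₑ ^ 2 * ‖u t‖ₑ ^ 2 := by
      intro t
      simp only [hh, enorm_mul, mul_pow]
      rw [lintegral_mul_const', ]
      swap
      · exact (ENNReal.pow_lt_top enorm_lt_top).ne
      congr 1
      have := lintegral_sub_left_eq_self (μ := (volume : Measure (Space d)))
        (fun x => ‖a x‖ₑ ^ 2) t
      rw [Lp.enorm_def, hL, ← this]
      simp [enorm_eq_nnnorm]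
    simp only [this]
    rw [lintegral_const_mul', ← hL, ← Lp.enorm_def, mul_pow]
    exact (ENNReal.pow_lt_top enorm_lt_top).ne
  have hint : ∀ x, Integrable (h x) volume := by
    intro x
    have h1 : MemLp (fun t => starRingEnd ℂ (a (t - x))) 2 (volume : Measure (Space d)) :=
      ((Lp.memLp a).comp_measurePreserving (measurePreserving_sub_right volume x)).star
    exact MemLp.integrable_mul h1 (Lp.memLp u)
  -- The product `h x` is integrable for every `x`, but square integrable only for almost every `x`.
  have hfin : ∀ᵐ x, ∫⁻ t, ‖h x t‖ₑ ^ 2 < ∞ := by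
    refine ae_lt_top' ?_ ?_
    · exact (hmeas.enorm.pow_const 2).lintegral_prod_right'
    · rw [htot]
      exact (ENNReal.pow_lt_top (ENNReal.mul_lt_top enorm_lt_top enorm_lt_top)).ne
  rw [← htot, Measure.volume_eq_prod, lintegral_prod]
  swap
  · exact (continuous_stft a u).enorm.aemeasurable.pow_const 2
  refine lintegral_congr_ae ?_
  filter_upwards [hfin] with x hx
  simp only [stft_eq_fourier]
  rw [← hL] at hx
  rw [← hL, ← hL, eLpNorm_fourier_eq (hint x)]
  exact ⟨(hint x).1, by simpa using hx⟩

theorem memLp_stft (a u : L2 d) : MemLp (stft a u) 2 volume := by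
  refine ⟨(continuous_stft a u).aestronglyMeasurable, ?_⟩
  have h : eLpNorm (stft a u) 2 volume ^ 2 = (‖a‖ₑ * ‖u‖ₑ) ^ 2 := by
    have := eLpNorm_nnreal_pow_eq_lintegral (f := stft a u) (μ := volume) (p := 2) (by norm_num)
    norm_num at this
    rw [← lintegral_enorm_stft_sq]
    exact this
  have h2 : eLpNorm (stft a u) 2 volume ^ 2 < ∞ := by
    rw [h]; exact ENNReal.pow_lt_top (ENNReal.mul_lt_top enorm_lt_top enorm_lt_top)
  simpa using h2

theorem integrable_stft_mul (a b u v : L2 d) :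
    Integrable (fun z => stft a u z * starRingEnd ℂ (stft b v z)) :=
  MemLp.integrable_mul (memLp_stft a u) (memLp_stft b v).star

/-- Polarization, from the vanishing at `x + y` and `x + iy`. -/
theorem eq_zero_of_sesquilinear_diag {V : Type*} [AddCommGroup V] [Module ℂ V] (B : V → V → ℂ)
    (h1 : ∀ x y z, B (x + y) z = B x z + B y z) (h2 : ∀ x y z, B x (y + z) = B x y + B x z)
    (h3 : ∀ (c : ℂ) x y, B (c • x) y = c * B x y)
    (h4 : ∀ (c : ℂ) x y, B x (c • y) = starRingEnd ℂ c * B x y) (h0 : ∀ x, B x x = 0) (x y : V) :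
    B x y = 0 := by
  have e1 := h0 (x + y)
  have e2 := h0 (x + Complex.I • y)
  simp only [h1, h2, h3, h4, h0, Complex.conj_I] at e1 e2
  have h : Complex.I * Complex.I = -1 := Complex.I_mul_I
  linear_combination (1 / 2) * e1 + (Complex.I / 2) * e2 + (1 / 2 * B x y - 1 / 2 * B y x) * h

/-- Moyal's identity. -/
theorem integral_stft_mul (a b u v : L2 d) :
    ∫ z, stft a u z * starRingEnd ℂ (stft b v z) = inner ℂ v u * inner ℂ a b := by
  have hdiag : ∀ a u : L2 d, ∫ z, stft a u z * starRingEnd ℂ (stft a u z)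
      = inner ℂ u u * inner ℂ a a := by
    intro a u
    simp only [Complex.mul_conj, Complex.normSq_eq_norm_sq, integral_complex_ofReal]
    rw [integral_eq_lintegral_of_nonneg_ae (f := fun z => ‖stft a u z‖ ^ 2)
      (Filter.Eventually.of_forall fun z => sq_nonneg _)
      ((continuous_stft a u).norm.pow 2).aestronglyMeasurable]
    have : ∀ z, ENNReal.ofReal (‖stft a u z‖ ^ 2) = ‖stft a u z‖ₑ ^ 2 := fun z => by
      rw [ENNReal.ofReal_pow (norm_nonneg _), ofReal_norm]
    simp only [this, lintegral_enorm_stft_sq, ENNReal.toReal_pow, ENNReal.toReal_mul,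
      toReal_enorm, inner_self_eq_norm_sq_to_K]
    push_cast
    simp
    ring
  have hstep : ∀ a u v : L2 d, (∫ z, stft a u z * starRingEnd ℂ (stft a v z))
      - inner ℂ v u * inner ℂ a a = 0 := by
    intro a u v
    refine eq_zero_of_sesquilinear_diag
      (fun u v => (∫ z, stft a u z * starRingEnd ℂ (stft a v z)) - inner ℂ v u * inner ℂ a a)
      ?_ ?_ ?_ ?_ (fun x => sub_eq_zero.2 (hdiag a x)) u v
    · intro x y z
      simp only [stft_add_right, add_mul, inner_add_right]
      rw [integral_add (integrable_stft_mul _ _ _ _) (integrable_stft_mul _ _ _ _)]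
      ring
    · intro x y z
      simp only [stft_add_right, map_add, mul_add, inner_add_left]
      rw [integral_add (integrable_stft_mul _ _ _ _) (integrable_stft_mul _ _ _ _)]
      ring
    · intro c x y
      simp only [stft_smul_right, mul_assoc, inner_smul_right]
      rw [integral_const_mul]
      ring
    · intro c x y
      simp only [stft_smul_right, map_mul, mul_left_comm _ (starRingEnd ℂ c), inner_smul_left]
      rw [integral_const_mul]
      ring
  -- Second polarization, now in the windows. The transform is antilinear in its window, so `b`,
  -- which sits under a conjugate, takes the linear slot.
  refine sub_eq_zero.1 (eq_zero_of_sesquilinear_diag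
    (fun b a => (∫ z, stft a u z * starRingEnd ℂ (stft b v z)) - inner ℂ v u * inner ℂ a b)
    ?_ ?_ ?_ ?_ (fun x => hstep x u v) b a)
  · intro x y z
    simp only [stft_add_left, map_add, mul_add, inner_add_right]
    rw [integral_add (integrable_stft_mul _ _ _ _) (integrable_stft_mul _ _ _ _)]
    ring
  · intro x y z
    simp only [stft_add_left, add_mul, inner_add_left, mul_add]
    rw [integral_add (integrable_stft_mul _ _ _ _) (integrable_stft_mul _ _ _ _)]
    ring
  · intro c x y
    simp only [stft_smul_left, map_mul, Complex.conj_conj, mul_left_comm _ c, inner_smul_right]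
    rw [integral_const_mul]
    ring
  · intro c x y
    simp only [stft_smul_left, mul_assoc, inner_smul_left]
    rw [integral_const_mul]
    ring

end Moyal

end LocOp

namespace LocOp

variable {d : ℕ}

instance : (volume : Measure (Phase d)).IsAddHaarMeasure :=
  inferInstanceAs ((volume : Measure (Space d)).prod volume).IsAddHaarMeasure

instance : (volume : Measure (Phase d)).IsNegInvariant :=
  Measure.IsAddHaarMeasure.isNegInvariant_of_regular _

/-! ### The symplectic Fourier transform and the Weyl form. -/

section FourierWigner

/-- The time-frequency shift as a bounded operator. -/
def tfCLM (z : Phase d) : L2 d →L[ℂ] L2 d := (tfIso z).toContinuousLinearMap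

@[simp] theorem tfCLM_apply (z : Phase d) (f : L2 d) : tfCLM z f = tfShift z f := rfl

theorem norm_tfCLM_le (z : Phase d) : ‖tfCLM z‖ ≤ 1 := (tfIso z).norm_toContinuousLinearMap_le

theorem norm_adjoint_tfCLM_le (z : Phase d) : ‖ContinuousLinearMap.adjoint (tfCLM z)‖ ≤ 1 := by
  rw [LinearIsometryEquiv.norm_map]
  exact norm_tfCLM_le z

theorem adjoint_tfCLM_tfShift (z : Phase d) (f : L2 d) :
    ContinuousLinearMap.adjoint (tfCLM z) (tfShift z f) = f := by
  refine ext_inner_left ℂ fun g => ?_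
  rw [ContinuousLinearMap.adjoint_inner_right, tfCLM_apply, inner_tfShift]

theorem tfShift_adjoint_tfCLM (z : Phase d) (f : L2 d) :
    tfShift z (ContinuousLinearMap.adjoint (tfCLM z) f) = f := by
  obtain ⟨g, rfl⟩ := tfShift_surjective z f
  rw [adjoint_tfCLM_tfShift]

/-- Moyal's identity for the vectors `π(ζ)* b` and `π(ζ)* q`: commuting `π(ζ)` past `π(z)` produces
the character. -/
theorem integral_chi_mul_stft (ζ : Phase d) (a b p q : L2 d) :
    ∫ z, chi ζ z * (stft a p z * starRingEnd ℂ (stft b q z))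
      = inner ℂ q (tfShift ζ p) * stft a b ζ := by
  have h := integral_stft_mul a (ContinuousLinearMap.adjoint (tfCLM ζ) b) p
    (ContinuousLinearMap.adjoint (tfCLM ζ) q)
  rw [ContinuousLinearMap.adjoint_inner_left, ContinuousLinearMap.adjoint_inner_right,
    tfCLM_apply, tfCLM_apply] at h
  rw [stft, ← h]
  refine integral_congr_ae (Filter.Eventually.of_forall fun z => ?_)
  simp only [stft, inner_conj_symm]
  rw [ContinuousLinearMap.adjoint_inner_left, tfCLM_apply, tfShift_comm, inner_smul_right,
    tfShift_adjoint_tfCLM]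
  ring

theorem conj_stft (a b : L2 d) (z : Phase d) :
    starRingEnd ℂ (stft a b z) = inner ℂ b (tfShift z a) := inner_conj_symm _ _

/-- The previous formula with `p` and `b` exchanged. It serves as an explicit Fourier inversion for
products of short-time Fourier transforms. -/
theorem integral_chi_mul_inner (z : Phase d) (a b p q : L2 d) :
    ∫ ζ, chi z ζ * (stft a b ζ * inner ℂ q (tfShift ζ p))
      = stft a p z * starRingEnd ℂ (stft b q z) := by
  simp only [← conj_stft]
  rw [integral_chi_mul_stft, conj_stft, mul_comm]

theorem integrable_stft_mul_inner (a b p q : L2 d) :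
    Integrable (fun ζ => stft a b ζ * inner ℂ q (tfShift ζ p)) := by
  simp only [← conj_stft]
  exact integrable_stft_mul a p b q

/-- Reproducing formula for rank one operators. -/
theorem integral_stft_mul_inner (a b p q : L2 d) :
    ∫ ζ, stft a b ζ * inner ℂ q (tfShift ζ p) = inner ℂ q b * inner ℂ a p := by
  simp only [← conj_stft]
  exact integral_stft_mul a p b q

/-- The symplectic Fourier transform. -/
def sft (f : Phase d → ℂ) (ζ : Phase d) : ℂ := ∫ z, chi z ζ * f z

theorem integrable_chi_mul {f : Phase d → ℂ} (hf : Integrable f) (ζ : Phase d) :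
    Integrable (fun z => chi z ζ * f z) :=
  hf.bdd_mul (continuous_chi_left ζ).aestronglyMeasurable
    (Filter.Eventually.of_forall fun z => (norm_chi z ζ).le)

theorem norm_sft_le (f : Phase d → ℂ) (ζ : Phase d) : ‖sft f ζ‖ ≤ ∫ z, ‖f z‖ := by
  refine (norm_integral_le_integral_norm _).trans_eq ?_
  simp

theorem sft_congr_ae {f g : Phase d → ℂ} (h : f =ᵐ[volume] g) : sft f = sft g := by
  funext ζ
  refine integral_congr_ae ?_
  filter_upwards [h] with z hz
  rw [hz]

theorem sft_add {f g : Phase d → ℂ} (hf : Integrable f) (hg : Integrable g) (ζ : Phase d) :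
    sft (fun z => f z + g z) ζ = sft f ζ + sft g ζ := by
  simp only [sft, mul_add]
  exact integral_add (integrable_chi_mul hf ζ) (integrable_chi_mul hg ζ)

theorem sft_sub {f g : Phase d → ℂ} (hf : Integrable f) (hg : Integrable g) (ζ : Phase d) :
    sft (fun z => f z - g z) ζ = sft f ζ - sft g ζ := by
  simp only [sft, mul_sub]
  exact integral_sub (integrable_chi_mul hf ζ) (integrable_chi_mul hg ζ)

theorem sft_const_mul (c : ℂ) (f : Phase d → ℂ) (ζ : Phase d) :
    sft (fun z => c * f z) ζ = c * sft f ζ := by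
  simp only [sft, mul_left_comm _ c]
  exact integral_const_mul _ _

theorem sft_zero (f : Phase d → ℂ) : sft f 0 = ∫ z, f z := by simp [sft]

theorem sft_modulation (f : Phase d → ℂ) (η ζ : Phase d) :
    sft (fun z => chi z η * f z) ζ = sft f (ζ + η) := by
  simp only [sft, chi_add_right, mul_assoc]

theorem integral_mul_integral_chi {f Y : Phase d → ℂ} (hf : Integrable f) (hY : Integrable Y) :
    ∫ z, f z * ∫ ζ, chi z ζ * Y ζ = ∫ ζ, sft f ζ * Y ζ := by
  simp only [sft, ← integral_const_mul, ← integral_mul_const]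
  rw [integral_integral_swap]
  · refine integral_congr_ae (Filter.Eventually.of_forall fun ζ => ?_)
    refine integral_congr_ae (Filter.Eventually.of_forall fun z => ?_)
    simp only
    ring
  · have h := (hf.mul_prod hY).bdd_mul (c := 1)
      (continuous_chi (d := d)).aestronglyMeasurable
      (Filter.Eventually.of_forall fun p => (norm_chi p.1 p.2).le)
    refine h.congr (Filter.Eventually.of_forall fun p => ?_)
    simp only [Function.uncurry]
    ring

/-- The Weyl form of a localization operator with integrable symbol. -/
theorem integral_mul_stft_mul {f : Phase d → ℂ} (hf : Integrable f) (a b p q : L2 d) :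
    ∫ z, f z * (stft a p z * starRingEnd ℂ (stft b q z))
      = ∫ ζ, sft f ζ * (stft a b ζ * inner ℂ q (tfShift ζ p)) := by
  simp only [← integral_chi_mul_inner]
  exact integral_mul_integral_chi hf (integrable_stft_mul_inner a b p q)

end FourierWigner

/-! ### Inversion of the symplectic Fourier transform on test functions. -/

section Inversion

open FourierTransform SchwartzMap
open scoped ContDiff

/-- The linear map `ζ ↦ (ζ₂, -ζ₁)` from phase space to the Euclidean space `ℝ²ᵈ`. -/
def phaseRotation : Phase d ≃ₜ WithLp 2 (Phase d) :=
  ((Homeomorph.prodComm _ _).trans ((Homeomorph.refl _).prodCongr (Homeomorph.neg _))).trans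
    (WithLp.homeomorphProd 2 _ _).symm

theorem phaseRotation_apply (ζ : Phase d) : phaseRotation ζ = WithLp.toLp 2 (ζ.2, -ζ.1) := rfl

theorem measurePreserving_phaseRotation :
    MeasurePreserving (phaseRotation : Phase d → WithLp 2 (Phase d)) volume volume := by
  have h1 : MeasurePreserving (Prod.swap : Phase d → Phase d) volume volume :=
    Measure.measurePreserving_swap
  have h2 : MeasurePreserving (Prod.map id Neg.neg : Phase d → Phase d) volume volume :=
    (MeasurePreserving.id volume).prod (Measure.measurePreserving_neg volume)
  exact (WithLp.volume_preserving_toLp (Space d) (Space d)).comp (h2.comp h1)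

/-- The rotation `(ζ₁, ζ₂) ↦ (ζ₂, -ζ₁)` turns the symplectic form into the Euclidean inner product.
It preserves volume, so Schwartz theory applies to `sft`. -/
theorem sft_eq_fourier (G : Phase d → ℂ) (ζ : Phase d) :
    sft G ζ = 𝓕 (fun v : WithLp 2 (Phase d) => G (WithLp.ofLp v)) (phaseRotation ζ) := by
  rw [Real.fourier_eq', sft,
    ← (WithLp.volume_preserving_toLp (Space d) (Space d)).integral_comp
      (WithLp.homeomorphProd 2 (Space d) (Space d)).symm.measurableEmbedding]
  refine integral_congr_ae (Filter.Eventually.of_forall fun z => ?_)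
  simp only [chi, phaseRotation_apply, WithLp.prod_inner_apply, inner_neg_right, smul_eq_mul]
  congr 2
  push_cast
  ring

variable {G : Phase d → ℂ}

theorem exists_schwartz_sft_eq (hG : ContDiff ℝ ∞ G) (hGc : HasCompactSupport G) :
    ∃ g : 𝓢(WithLp 2 (Phase d), ℂ), (∀ v, g v = G (WithLp.ofLp v)) ∧
      sft G = fun ζ => (𝓕 g) (phaseRotation ζ) := by
  have hlin : ContDiff ℝ ∞ fun v : WithLp 2 (Phase d) => WithLp.ofLp v :=
    (WithLp.prodContinuousLinearEquiv 2 ℝ (Space d) (Space d)).contDiff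
  have hc : HasCompactSupport fun v : WithLp 2 (Phase d) => G (WithLp.ofLp v) :=
    hGc.comp_homeomorph (WithLp.homeomorphProd 2 (Space d) (Space d))
  refine ⟨hc.toSchwartzMap (hG.comp hlin), fun v => rfl, ?_⟩
  funext ζ
  exact sft_eq_fourier G ζ

theorem memLp_sft (hG : ContDiff ℝ ∞ G) (hGc : HasCompactSupport G) (p : ℝ≥0∞) :
    MemLp (sft G) p volume := by
  obtain ⟨g, -, hg⟩ := exists_schwartz_sft_eq hG hGc
  rw [hg]
  exact ((𝓕 g).memLp p volume).comp_measurePreserving measurePreserving_phaseRotation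

theorem integrable_sft (hG : ContDiff ℝ ∞ G) (hGc : HasCompactSupport G) :
    Integrable (sft G) := memLp_one_iff_integrable.1 (memLp_sft hG hGc 1)

/-- Inversion of the symplectic Fourier transform. -/
theorem sft_sft (hG : ContDiff ℝ ∞ G) (hGc : HasCompactSupport G) : sft (sft G) = G := by
  obtain ⟨g, hg, hgG⟩ := exists_schwartz_sft_eq hG hGc
  funext η
  have h1 : (𝓕⁻ (𝓕 g)) (WithLp.toLp 2 η) = G η := by
    rw [fourierInv_fourier_eq, hg]
  rw [← h1, hgG, sft, SchwartzMap.fourierInv_coe, Real.fourierInv_eq',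
    ← measurePreserving_phaseRotation.integral_comp phaseRotation.measurableEmbedding]
  refine integral_congr_ae (Filter.Eventually.of_forall fun z => ?_)
  simp only [chi, phaseRotation_apply, WithLp.prod_inner_apply, inner_neg_left, smul_eq_mul]
  congr 2
  push_cast
  ring

theorem sft_comp_inv_smul (G : Phase d → ℂ) {r : ℝ} (hr : 0 < r) (z : Phase d) :
    sft (fun ζ => G (r⁻¹ • ζ)) z
      = (r ^ Module.finrank ℝ (Phase d) : ℝ) * sft G (r • z) := by
  have h := Measure.integral_comp_inv_smul (volume : Measure (Phase d))
    (fun ζ => chi ζ (r • z) * G ζ) r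
  rw [abs_of_pos (by positivity)] at h
  rw [sft, sft, ← Complex.real_smul, ← h]
  refine integral_congr_ae (Filter.Eventually.of_forall fun ζ => ?_)
  simp only [chi, Prod.smul_fst, Prod.smul_snd, inner_smul_left, inner_smul_right]
  congr 4
  simp
  field_simp

end Inversion

end LocOp

namespace LocOp

variable {d : ℕ}

/-! ### Convolution as an operator on `L¹` of phase space. -/

section Convolution

/-- Convolution on phase space. -/
def conv (f g : Phase d → ℂ) (z : Phase d) : ℂ := ∫ w, f w * g (z - w)

variable {f g h : Phase d → ℂ}

theorem integrable_conv_integrand (hf : Integrable f) (hg : Integrable g) :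
    Integrable (fun p : Phase d × Phase d => f p.2 * g (p.1 - p.2)) (volume.prod volume) :=
  hf.convolution_integrand (ContinuousLinearMap.mul ℂ ℂ) hg

theorem integrable_conv (hf : Integrable f) (hg : Integrable g) : Integrable (conv f g) :=
  hf.integrable_convolution (ContinuousLinearMap.mul ℂ ℂ) hg

theorem integral_conv (hf : Integrable f) (hg : Integrable g) :
    ∫ z, conv f g z = (∫ z, f z) * ∫ z, g z :=
  integral_convolution (ContinuousLinearMap.mul ℂ ℂ) hf hg

theorem integral_norm_conv_le (hf : Integrable f) (hg : Integrable g) :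
    ∫ z, ‖conv f g z‖ ≤ (∫ z, ‖f z‖) * ∫ z, ‖g z‖ := by
  have h1 := integral_convolution (ContinuousLinearMap.mul ℝ ℝ) hf.norm hg.norm
    (μ := volume) (ν := volume)
  have h2 := hf.norm.integrable_convolution (ContinuousLinearMap.mul ℝ ℝ) hg.norm
    (μ := volume)
  refine le_of_le_of_eq (integral_mono (integrable_conv hf hg).norm h2 fun z => ?_) h1
  refine (norm_integral_le_integral_norm _).trans_eq ?_
  simp only [norm_mul]
  rfl

theorem sft_conv (hf : Integrable f) (hg : Integrable g) (ζ : Phase d) :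
    sft (conv f g) ζ = sft f ζ * sft g ζ := by
  rw [sft, sft, sft, ← integral_conv (integrable_chi_mul hf ζ) (integrable_chi_mul hg ζ)]
  congr 1
  funext z
  rw [conv, conv, ← integral_const_mul]
  congr 1
  funext w
  have : chi z ζ = chi w ζ * chi (z - w) ζ := by rw [← chi_add_left, add_sub_cancel]
  rw [this]; ring

theorem conv_congr_ae_right {g' : Phase d → ℂ} (h : g =ᵐ[volume] g') : conv f g = conv f g' := by
  funext z
  refine integral_congr_ae ?_
  filter_upwards [(Measure.measurePreserving_sub_left volume z).quasiMeasurePreserving.ae_eq_comp h]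
    with w hw
  simp only [Function.comp_apply] at hw
  rw [hw]

/-- Convolution with an integrable function as an operator on `L¹`. -/
def convOp (h : Phase d → ℂ) (hh : Integrable h) :
    Lp ℂ 1 (volume : Measure (Phase d)) →L[ℂ] Lp ℂ 1 (volume : Measure (Phase d)) :=
  LinearMap.mkContinuous
    { toFun := fun k => (integrable_conv hh (L1.integrable_coeFn k)).toL1 _
      map_add' := fun k l => by
        rw [← Integrable.toL1_add]
        refine (Integrable.toL1_eq_toL1_iff _ _ _ _).2 ?_
        rw [conv_congr_ae_right (Lp.coeFn_add k l)]
        have hk := hh.ae_convolution_exists (ContinuousLinearMap.mul ℂ ℂ)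
          (L1.integrable_coeFn k)
        have hl := hh.ae_convolution_exists (ContinuousLinearMap.mul ℂ ℂ)
          (L1.integrable_coeFn l)
        filter_upwards [hk, hl] with z h1 h2
        simp only [conv, Pi.add_apply, mul_add]
        exact integral_add h1 h2
      map_smul' := fun c k => by
        rw [RingHom.id_apply, ← Integrable.toL1_smul]
        refine (Integrable.toL1_eq_toL1_iff _ _ _ _).2 ?_
        rw [conv_congr_ae_right (Lp.coeFn_smul c k)]
        refine Filter.Eventually.of_forall fun z => ?_
        simp only [conv, Pi.smul_apply, smul_eq_mul, mul_left_comm _ c]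
        exact integral_const_mul _ _ }
    (∫ z, ‖h z‖) fun k => by
      simp only [LinearMap.coe_mk, AddHom.coe_mk, L1.norm_eq_integral_norm]
      refine le_of_eq_of_le ?_ (integral_norm_conv_le hh (L1.integrable_coeFn k))
      refine integral_congr_ae ?_
      filter_upwards [Integrable.coeFn_toL1 (integrable_conv hh (L1.integrable_coeFn k))] with z hz
      rw [hz]

theorem norm_convOp_le (hh : Integrable h) : ‖convOp h hh‖ ≤ ∫ z, ‖h z‖ :=
  LinearMap.mkContinuous_norm_le _ (integral_nonneg fun _ => norm_nonneg _) _

theorem convOp_ae (hh : Integrable h) (k : Lp ℂ 1 (volume : Measure (Phase d))) :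
    convOp h hh k =ᵐ[volume] conv h k :=
  Integrable.coeFn_toL1 (integrable_conv hh (L1.integrable_coeFn k))

/-- Solving `c k = g + h * k` in `L¹` when `‖h‖₁ < |c|`. -/
theorem exists_sft_eq_of_norm_lt {c : ℂ} (hh : Integrable h) (hc : ∫ z, ‖h z‖ < ‖c‖)
    (hg : Integrable g) :
    ∃ k : Phase d → ℂ, Integrable k ∧ ∀ ζ, sft k ζ * (c - sft h ζ) = sft g ζ := by
  have hc0 : 0 < ‖c‖ := (integral_nonneg fun _ => norm_nonneg _).trans_lt hc
  have hc1 : c ≠ 0 := norm_pos_iff.1 hc0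
  have hlt : ‖c⁻¹ • convOp h hh‖ < 1 := by
    refine (norm_smul_le c⁻¹ (convOp h hh)).trans_lt ?_
    rw [norm_inv, inv_mul_lt_one₀ hc0]
    exact (norm_convOp_le hh).trans_lt hc
  -- `1 - c⁻¹ (h * ·)` is invertible on `L¹` by the Neumann series.
  let u : (Lp ℂ 1 (volume : Measure (Phase d)) →L[ℂ] Lp ℂ 1 (volume : Measure (Phase d)))ˣ :=
    Units.oneSub (c⁻¹ • convOp h hh) hlt
  let k := (↑u⁻¹ : Lp ℂ 1 (volume : Measure (Phase d)) →L[ℂ] Lp ℂ 1 (volume : Measure (Phase d)))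
    (c⁻¹ • hg.toL1 g)
  have hk : (1 - c⁻¹ • convOp h hh) k = c⁻¹ • hg.toL1 g := by
    exact DFunLike.congr_fun u.mul_inv (c⁻¹ • hg.toL1 g)
  have hk2 : c • k - convOp h hh k = hg.toL1 g := by
    have := congrArg (fun x => c • x) hk
    simpa [smul_sub, smul_smul, hc1] using this
  have hki : Integrable (k : Phase d → ℂ) := L1.integrable_coeFn k
  refine ⟨k, hki, fun ζ => ?_⟩
  have hae : (fun z => c * k z - conv h k z) =ᵐ[volume] g := by
    filter_upwards [hg.coeFn_toL1, Lp.coeFn_sub (c • k) (convOp h hh k), Lp.coeFn_smul c k,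
      convOp_ae hh k] with z h1 h2 h3 h4
    rw [← h1, ← hk2, h2, Pi.sub_apply, h3, h4]
    simp
  rw [← sft_congr_ae hae, sft_sub (hki.const_mul c) (integrable_conv hh hki), sft_const_mul,
    sft_conv hh hki]
  ring

end Convolution

/-! ### Wiener's division lemma. -/

section Wiener

open Filter Topology
open scoped ContDiff

/-- The `L¹` modulus of continuity. -/
def modulus (s : Phase d → ℂ) (v : Phase d) : ℝ := ∫ z, ‖s z - s (z - v)‖

theorem integrable_modulus {s : Phase d → ℂ} (hs : Integrable s) (v : Phase d) :
    Integrable fun z => ‖s z - s (z - v)‖ := (hs.sub (hs.comp_sub_right v)).norm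

theorem modulus_nonneg (s : Phase d → ℂ) (v : Phase d) : 0 ≤ modulus s v :=
  integral_nonneg fun _ => norm_nonneg _

theorem modulus_zero (s : Phase d → ℂ) : modulus s 0 = 0 := by simp [modulus]

theorem modulus_le {s : Phase d → ℂ} (hs : Integrable s) (v : Phase d) :
    modulus s v ≤ 2 * ∫ z, ‖s z‖ := by
  calc modulus s v ≤ ∫ z, (‖s z‖ + ‖s (z - v)‖) :=
        integral_mono (integrable_modulus hs v) (hs.norm.add (hs.comp_sub_right v).norm)
          fun z => norm_sub_le _ _
    _ = 2 * ∫ z, ‖s z‖ := by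
        rw [integral_add hs.norm (hs.comp_sub_right v).norm,
          integral_sub_right_eq_self (fun z => ‖s z‖) v]
        ring

theorem continuous_modulus {s : Phase d → ℂ} (hs : Integrable s) : Continuous (modulus s) := by
  have : Fact ((1 : ℝ≥0∞) ≠ ⊤) := ⟨by simp⟩
  have : ContinuousVAdd (Phase d)ᵈᵃᵃ (Lp ℂ 1 (volume : Measure (Phase d))) :=
    Lp.instContinuousVAddDomAddAct
  have h : Continuous fun v : Phase d => ‖hs.toL1 s - ((DomAddAct.mk (-v)) +ᵥ hs.toL1 s)‖ :=
    (continuous_const.sub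
      ((DomAddAct.continuous_mk.comp continuous_neg).vadd continuous_const)).norm
  refine h.congr fun v => ?_
  rw [L1.norm_eq_integral_norm]
  refine integral_congr_ae ?_
  filter_upwards [Lp.coeFn_sub (hs.toL1 s) ((DomAddAct.mk (-v)) +ᵥ hs.toL1 s),
    DomAddAct.vadd_Lp_ae_eq (DomAddAct.mk (-v)) (hs.toL1 s), hs.coeFn_toL1,
    (measurePreserving_sub_right volume v).quasiMeasurePreserving.ae_eq_comp hs.coeFn_toL1]
    with z h1 h2 h3 h4
  rw [h1, Pi.sub_apply, h2, h3]
  simp only [Function.comp_apply] at h4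
  simp only [Equiv.symm_apply_apply, vadd_eq_add, neg_add_eq_sub, h4]

/-- Minkowski's inequality applied to `(∫ m) s - m * s = ∫ m(w) (s - s(· - w)) dw`. -/
theorem integral_norm_sub_conv_le {m s : Phase d → ℂ} (hm : Integrable m) (hs : Integrable s) :
    ∫ z, ‖(∫ w, m w) * s z - conv m s z‖ ≤ ∫ w, ‖m w‖ * modulus s w := by
  have h1 : Integrable (fun p : Phase d × Phase d => m p.2 * s p.1) (volume.prod volume) := by
    simpa only [mul_comm] using hs.mul_prod hm
  have h2 := integrable_conv_integrand hm hs
  have h3 := h1.sub h2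
  have hexp := hm.ae_convolution_exists (ContinuousLinearMap.mul ℂ ℂ) hs
  have hae : (fun z => ‖(∫ w, m w) * s z - conv m s z‖)
      =ᵐ[volume] fun z => ‖∫ w, (m w * s z - m w * s (z - w))‖ := by
    filter_upwards [hexp] with z hz
    have hz' : Integrable fun w => m w * s (z - w) := hz
    rw [integral_sub (hm.mul_const _) hz', integral_mul_const]
    rfl
  rw [integral_congr_ae hae]
  calc ∫ z, ‖∫ w, (m w * s z - m w * s (z - w))‖
      ≤ ∫ z, ∫ w, ‖m w * s z - m w * s (z - w)‖ :=
        integral_mono h3.integral_prod_left.norm h3.integral_norm_prod_left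
          fun z => norm_integral_le_integral_norm _
    _ = ∫ w, ∫ z, ‖m w * s z - m w * s (z - w)‖ := integral_integral_swap h3.norm
    _ = ∫ w, ‖m w‖ * modulus s w := by
        simp only [modulus, ← integral_const_mul, ← mul_sub, norm_mul]

/-- The `L¹`-normalized dilation. -/
def dilate (r : ℝ) (s : Phase d → ℂ) (z : Phase d) : ℂ :=
  (r ^ Module.finrank ℝ (Phase d) : ℝ) * s (r • z)

theorem integrable_dilate {s : Phase d → ℂ} (hs : Integrable s) {r : ℝ} (hr : 0 < r) :
    Integrable (dilate r s) := (hs.comp_smul hr.ne').const_mul _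

theorem integral_dilate_mul {r : ℝ} (hr : 0 < r) (φ : Phase d → ℝ) :
    ∫ z, (r ^ Module.finrank ℝ (Phase d) : ℝ) * φ (r • z) = ∫ z, φ z := by
  have h := Measure.integral_comp_smul (volume : Measure (Phase d)) φ r
  rw [abs_of_pos (by positivity), smul_eq_mul] at h
  rw [integral_const_mul, h, ← mul_assoc, mul_inv_cancel₀ (by positivity), one_mul]

theorem modulus_dilate {s : Phase d → ℂ} {r : ℝ} (hr : 0 < r) (v : Phase d) :
    modulus (dilate r s) v = modulus s (r • v) := by
  rw [modulus, modulus, ← integral_dilate_mul hr fun z => ‖s z - s (z - r • v)‖]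
  congr 1
  funext z
  simp only [dilate, ← mul_sub, norm_mul, smul_sub]
  rw [Complex.norm_of_nonneg (by positivity)]

/-- Dominated convergence. It is used for the modulus of continuity in Wiener's lemma and for the
approximate identity in the trace class argument. -/
theorem tendsto_integral_norm_mul_dilate {m : Phase d → ℂ} (hm : Integrable m)
    {w : Phase d → ℝ} (hw : Continuous w) {C : ℝ} (hC : ∀ z, ‖w z‖ ≤ C) (hw0 : w 0 = 0) :
    Tendsto (fun r : ℝ => ∫ z, ‖m z‖ * w (r • z)) (𝓝[>] 0) (𝓝 0) := by
  have h : Tendsto (fun r : ℝ => ∫ z, ‖m z‖ * w (r • z)) (𝓝[>] 0)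
      (𝓝 (∫ z : Phase d, ‖m z‖ * w ((0 : ℝ) • z))) := by
    refine tendsto_integral_filter_of_dominated_convergence
      (fun z => ‖m z‖ * C) ?_ ?_ (hm.norm.mul_const _) ?_
    · exact Eventually.of_forall fun r =>
        hm.norm.1.mul (hw.comp (continuous_const_smul r)).aestronglyMeasurable
    · refine Eventually.of_forall fun r => Eventually.of_forall fun z => ?_
      rw [norm_mul, norm_norm]
      gcongr
      exact hC _
    · refine Eventually.of_forall fun z => ?_
      refine Tendsto.const_mul _ ?_
      have : Continuous fun r : ℝ => w (r • z) := hw.comp (continuous_id.smul continuous_const)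
      exact (this.tendsto 0).mono_left nhdsWithin_le_nhds
  simpa [hw0] using h

/-- A smooth bump function on phase space with complex values. -/
theorem exists_bump (ζ₀ : Phase d) {r : ℝ} (hr : 0 < r) :
    ∃ G : Phase d → ℂ, ContDiff ℝ ∞ G ∧ HasCompactSupport G ∧
      (∀ ζ ∈ Metric.ball ζ₀ (r / 2), G ζ = 1) ∧ ∀ ζ, ζ ∉ Metric.ball ζ₀ r → G ζ = 0 := by
  let χ : ContDiffBump ζ₀ := ⟨r / 2, r, by positivity, by linarith⟩
  refine ⟨fun ζ => (χ ζ : ℂ), Complex.ofRealCLM.contDiff.comp χ.contDiff,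
    χ.hasCompactSupport.comp_left Complex.ofReal_zero, fun ζ hζ => ?_, fun ζ hζ => ?_⟩
  · simp only
    rw [χ.one_of_mem_closedBall (Metric.ball_subset_closedBall hζ), Complex.ofReal_one]
  · simp only
    rw [χ.zero_of_le_dist (by simpa using hζ), Complex.ofReal_zero]

/-- Near `0` the function `sft m` is close to the constant `c = sft m 0` in the Wiener algebra: with
a dilated kernel `s` whose transform is `1` near `0`, the function `h = c s - m * s` has `L¹`-norm
below `|c|`. Hence `c - sft h` can be divided by, and there it agrees with `sft m`. -/
theorem exists_sft_mul_eq_at_zero {m : Phase d → ℂ} (hm : Integrable m) (h0 : sft m 0 ≠ 0) :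
    ∃ r > 0, ∀ g : Phase d → ℂ, Integrable g → (∀ ζ, ζ ∉ Metric.ball 0 r → sft g ζ = 0) →
      ∃ k : Phase d → ℂ, Integrable k ∧ ∀ ζ, sft k ζ * sft m ζ = sft g ζ := by
  -- With this radius `G = 1` on the unit ball, so the transform of the dilated kernel is `1` on the
  -- ball of radius `r`.
  obtain ⟨G, hG, hGc, hG1, -⟩ := exists_bump (0 : Phase d) (r := 2) two_pos
  have hs := integrable_sft hG hGc
  set c := sft m 0 with hc
  have hcint : ∫ w, m w = c := (sft_zero m).symm
  have hev := (tendsto_integral_norm_mul_dilate hm (continuous_modulus hs)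
    (C := 2 * ∫ z, ‖sft G z‖) (fun v => by
      rw [Real.norm_of_nonneg (modulus_nonneg _ _)]; exact modulus_le hs v)
    (modulus_zero _)).eventually (gt_mem_nhds (norm_pos_iff.2 h0))
  obtain ⟨r, hr, hr0⟩ := (hev.and self_mem_nhdsWithin).exists
  have hr0 : 0 < r := hr0
  have hsr := integrable_dilate hs hr0
  have hsft : ∀ ζ, sft (dilate r (sft G)) ζ = G (r⁻¹ • ζ) := by
    have hcd : ContDiff ℝ ∞ fun ζ : Phase d => G (r⁻¹ • ζ) := hG.comp (contDiff_const_smul _)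
    have hcc : HasCompactSupport fun ζ : Phase d => G (r⁻¹ • ζ) :=
      hGc.comp_homeomorph (Homeomorph.smulOfNeZero r⁻¹ (inv_ne_zero hr0.ne'))
    have h1 : dilate r (sft G) = sft fun ζ => G (r⁻¹ • ζ) := by
      funext z; rw [sft_comp_inv_smul G hr0]; rfl
    rw [h1, sft_sft hcd hcc]
    exact fun ζ => rfl
  set h : Phase d → ℂ := fun z => c * dilate r (sft G) z - conv m (dilate r (sft G)) z with hh
  have hhi : Integrable h := (hsr.const_mul c).sub (integrable_conv hm hsr)
  have hlt : ∫ z, ‖h z‖ < ‖c‖ := by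
    refine lt_of_le_of_lt ?_ hr
    have := integral_norm_sub_conv_le hm hsr
    simp only [modulus_dilate hr0, hcint] at this
    exact this
  refine ⟨r, hr0, fun g hg hgz => ?_⟩
  obtain ⟨k, hk, hk2⟩ := exists_sft_eq_of_norm_lt hhi hlt hg
  refine ⟨k, hk, fun ζ => ?_⟩
  by_cases hζ : ζ ∈ Metric.ball 0 r
  · have h1 : sft h ζ = c - sft m ζ := by
      rw [hh, sft_sub (hsr.const_mul c) (integrable_conv hm hsr), sft_const_mul, sft_conv hm hsr,
        hsft, hG1, mul_one, mul_one]
      rw [mem_ball_zero_iff, norm_smul, norm_inv, Real.norm_of_nonneg hr0.le, inv_mul_lt_iff₀ hr0]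
      simpa using hζ
    rw [← hk2 ζ, h1, sub_sub_cancel]
  -- Off the ball `c - sft h` need not equal `sft m`, but it does not vanish; since `sft g ζ = 0`,
  -- also `sft k ζ = 0`.
  · have h2 := hk2 ζ
    rw [hgz ζ hζ] at h2 ⊢
    have h3 : c - sft h ζ ≠ 0 := by
      intro h4
      have : ‖c‖ ≤ ∫ z, ‖h z‖ := by rw [sub_eq_zero.1 h4]; exact norm_sft_le _ _
      exact absurd hlt this.not_gt
    rw [(mul_eq_zero.1 h2).resolve_right h3, zero_mul]

/-- Modulating all functions by a character translates their transforms, which moves `ζ₀` to the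
origin. -/
theorem exists_sft_mul_eq_at {m : Phase d → ℂ} (hm : Integrable m) (ζ₀ : Phase d)
    (h0 : sft m ζ₀ ≠ 0) :
    ∃ r > 0, ∀ g : Phase d → ℂ, Integrable g → (∀ ζ, ζ ∉ Metric.ball ζ₀ r → sft g ζ = 0) →
      ∃ k : Phase d → ℂ, Integrable k ∧ ∀ ζ, sft k ζ * sft m ζ = sft g ζ := by
  obtain ⟨r, hr, H⟩ := exists_sft_mul_eq_at_zero (integrable_chi_mul hm ζ₀)
    (by rwa [sft_modulation, zero_add])
  refine ⟨r, hr, fun g hg hgz => ?_⟩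
  obtain ⟨k, hk, hk2⟩ := H _ (integrable_chi_mul hg ζ₀) fun ζ hζ => by
    rw [sft_modulation]
    refine hgz _ ?_
    simpa [dist_eq_norm] using hζ
  refine ⟨_, integrable_chi_mul hk (-ζ₀), fun ζ => ?_⟩
  have := hk2 (ζ + -ζ₀)
  rwa [sft_modulation, sft_modulation, neg_add_cancel_right, ← sft_modulation] at this

/-- Wiener's division lemma. -/
theorem exists_sft_mul_eq {m : Phase d → ℂ} (hm : Integrable m) (h0 : ∀ ζ, sft m ζ ≠ 0)
    {G : Phase d → ℂ} (hG : ContDiff ℝ ∞ G) (hGc : HasCompactSupport G) :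
    ∃ k : Phase d → ℂ, Integrable k ∧ ∀ ζ, sft k ζ * sft m ζ = G ζ := by
  choose r hr H using fun ζ₀ => exists_sft_mul_eq_at hm ζ₀ (h0 ζ₀)
  obtain ⟨s, hs⟩ := hGc.elim_finite_subcover (fun ζ₀ => Metric.ball ζ₀ (r ζ₀ / 2))
    (fun _ => Metric.isOpen_ball)
    fun ζ _ => Set.mem_iUnion.2 ⟨ζ, Metric.mem_ball_self (half_pos (hr ζ))⟩
  have hs' : ∀ ζ, G ζ ≠ 0 → ∃ i ∈ s, ζ ∈ Metric.ball i (r i / 2) := fun ζ hζ => by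
    simpa using hs (subset_tsupport G hζ)
  clear hs
  induction s using Finset.cons_induction generalizing G with
  | empty =>
    refine ⟨0, integrable_zero _ _ _, fun ζ => ?_⟩
    have : G ζ = 0 := by by_contra h; simpa using hs' ζ h
    simp [this, sft]
  | cons i s hi ih =>
    obtain ⟨χ, hχ, hχc, hχ1, hχ0⟩ := exists_bump i (hr i)
    -- `G χ` lives in the ball around `i`, where division is possible; `G (1 - χ)` vanishes on the
    -- half ball, so the remaining half balls cover its nonzero set.
    have h1 : ContDiff ℝ ∞ fun ζ => G ζ * χ ζ := hG.mul hχ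
    have h1c : HasCompactSupport fun ζ => G ζ * χ ζ := hGc.mul_right
    have h2 : ContDiff ℝ ∞ fun ζ => G ζ * (1 - χ ζ) := hG.mul (contDiff_const.sub hχ)
    have h2c : HasCompactSupport fun ζ => G ζ * (1 - χ ζ) := hGc.mul_right
    obtain ⟨k, hk, hk2⟩ := H i _ (integrable_sft h1 h1c) fun ζ hζ => by
      simp only [sft_sft h1 h1c, hχ0 ζ hζ, mul_zero]
    rw [sft_sft h1 h1c] at hk2
    obtain ⟨l, hl, hl2⟩ := ih h2 h2c fun ζ hζ => by
      obtain ⟨j, hj, hζj⟩ := hs' ζ (left_ne_zero_of_mul hζ)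
      rcases Finset.mem_cons.1 hj with rfl | hj
      · exact absurd (hχ1 ζ hζj) fun h => by simp [h] at hζ
      · exact ⟨j, hj, hζj⟩
    refine ⟨_, hk.add hl, fun ζ => ?_⟩
    have := sft_add hk hl ζ
    rw [show k + l = fun z => k z + l z from rfl, this, add_mul, hk2, hl2]
    ring

end Wiener

end LocOp

namespace LocOp

variable {d : ℕ}

/-! ### Existence and linearity of localization operators. -/

section Existence

/-- A bounded sesquilinear form given by weak integrals is represented by an operator. -/
theorem exists_clm_of_weak (W : Phase d → L2 d → L2 d)
    (hadd : ∀ z p q, W z (p + q) = W z p + W z q) (hsmul : ∀ z (c : ℂ) p, W z (c • p) = c • W z p)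
    (hint : ∀ p q, Integrable fun z => (inner ℂ q (W z p) : ℂ)) (C : ℝ)
    (hC : ∀ p q, ‖∫ z, (inner ℂ q (W z p) : ℂ)‖ ≤ C * ‖q‖ * ‖p‖) :
    ∃ T : L2 d →L[ℂ] L2 d, ∀ p q, inner ℂ q (T p) = ∫ z, (inner ℂ q (W z p) : ℂ) := by
  let B₀ : L2 d →ₗ⋆[ℂ] L2 d →ₗ[ℂ] ℂ :=
    LinearMap.mk₂'ₛₗ (starRingEnd ℂ) (RingHom.id ℂ) (fun q p => ∫ z, (inner ℂ q (W z p) : ℂ))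
      (fun q q' p => by
        simp only [inner_add_left]
        exact integral_add (hint _ _) (hint _ _))
      (fun c q p => by
        simp only [inner_smul_left]
        exact integral_const_mul _ _)
      (fun q p p' => by
        simp only [hadd, inner_add_right]
        exact integral_add (hint _ _) (hint _ _))
      (fun c q p => by
        simp only [hsmul, inner_smul_right]
        exact integral_const_mul _ _)
  let B : L2 d →L⋆[ℂ] L2 d →L[ℂ] ℂ := B₀.mkContinuous₂ C fun q p => hC p q
  refine ⟨ContinuousLinearMap.adjoint (InnerProductSpace.continuousLinearMapOfBilin B),
    fun p q => ?_⟩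
  rw [ContinuousLinearMap.adjoint_inner_right,
    InnerProductSpace.continuousLinearMapOfBilin_apply]
  rfl

theorem integral_norm_mul_norm_le {u v : Phase d → ℂ} (hu : MemLp u 2 volume)
    (hv : MemLp v 2 volume) :
    ∫ z, ‖u z‖ * ‖v z‖ ≤ √(∫ z, ‖u z‖ ^ 2) * √(∫ z, ‖v z‖ ^ 2) := by
  have h := integral_mul_norm_le_Lp_mul_Lq (μ := (volume : Measure (Phase d))) (f := u) (g := v)
    Real.HolderConjugate.two_two (by simpa using hu) (by simpa using hv)
  simp only [Real.sqrt_eq_rpow]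
  exact_mod_cast h

theorem integral_norm_sq_stft (a u : L2 d) : ∫ z, ‖stft a u z‖ ^ 2 = (‖a‖ * ‖u‖) ^ 2 := by
  have h := integral_stft_mul a a u u
  simp only [Complex.mul_conj, Complex.normSq_eq_norm_sq, inner_self_eq_norm_sq_to_K] at h
  rw [integral_complex_ofReal] at h
  have h2 : ((∫ z, ‖stft a u z‖ ^ 2 : ℝ) : ℂ) = (((‖a‖ * ‖u‖) ^ 2 : ℝ) : ℂ) := by
    rw [h]; push_cast; simp only [Complex.coe_algebraMap]; ring
  exact_mod_cast h2

variable {φ₁ φ₂ : L2 d} {f : Phase d → ℂ} {T : L2 d →L[ℂ] L2 d}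

theorem inner_weak_integrand (φ₁ φ₂ : L2 d) (f : Phase d → ℂ) (p q : L2 d) (z : Phase d) :
    inner ℂ q ((f z * stft φ₁ p z) • tfShift z φ₂)
      = f z * (stft φ₁ p z * starRingEnd ℂ (stft φ₂ q z)) := by
  rw [inner_smul_right, conj_stft, mul_assoc]

theorem isLocalizationOperator_iff :
    IsLocalizationOperator φ₁ φ₂ f T ↔ ∀ p q : L2 d,
      Integrable (fun z => f z * (stft φ₁ p z * starRingEnd ℂ (stft φ₂ q z))) ∧
      ∫ z, f z * (stft φ₁ p z * starRingEnd ℂ (stft φ₂ q z)) = inner ℂ q (T p) := by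
  simp only [← inner_weak_integrand]
  constructor
  · intro h p q
    exact h p (innerSL ℂ q)
  · intro h p φ
    have := h p ((InnerProductSpace.toDual ℂ _).symm φ)
    simpa only [InnerProductSpace.toDual_symm_apply] using this

theorem norm_stft_mul_le (p q : L2 d) (z : Phase d) :
    ‖stft φ₁ p z * starRingEnd ℂ (stft φ₂ q z)‖ ≤ ‖φ₁‖ * ‖φ₂‖ * ‖q‖ * ‖p‖ := by
  rw [norm_mul, RCLike.norm_conj]
  calc ‖stft φ₁ p z‖ * ‖stft φ₂ q z‖ ≤ (‖φ₁‖ * ‖p‖) * (‖φ₂‖ * ‖q‖) := by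
        gcongr <;> exact norm_stft_le _ _ _
    _ = _ := by ring

theorem memLp_mul_stft (hf : MemLp f 2 volume) (a u : L2 d) :
    MemLp (fun z => f z * stft a u z) 2 volume := by
  refine (hf.const_mul ((‖a‖ * ‖u‖ : ℝ) : ℂ)).mono
    (hf.1.mul (continuous_stft a u).aestronglyMeasurable)
    (Filter.Eventually.of_forall fun z => ?_)
  rw [norm_mul, norm_mul, Complex.norm_of_nonneg (by positivity), mul_comm]
  gcongr
  exact norm_stft_le a u z

theorem integrable_norm_sq {u : Phase d → ℂ} (hu : MemLp u 2 volume) :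
    Integrable fun z => ‖u z‖ ^ 2 := hu.integrable_norm_pow two_ne_zero

theorem exists_isLocalizationOperator_of_bound
    (hint : ∀ p q : L2 d,
      Integrable (fun z => f z * (stft φ₁ p z * starRingEnd ℂ (stft φ₂ q z)))) (C : ℝ)
    (hC : ∀ p q : L2 d, ∫ z, ‖f z * (stft φ₁ p z * starRingEnd ℂ (stft φ₂ q z))‖
      ≤ C * ‖q‖ * ‖p‖) :
    ∃ T, IsLocalizationOperator φ₁ φ₂ f T := by
  obtain ⟨T, hT⟩ := exists_clm_of_weak (fun z p => (f z * stft φ₁ p z) • tfShift z φ₂)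
    (fun z p q => by rw [stft_add_right, mul_add, add_smul])
    (fun z c p => by rw [stft_smul_right, smul_smul, mul_left_comm])
    (fun p q => by simpa only [inner_weak_integrand] using hint p q) C
    (fun p q => by
      simp only [inner_weak_integrand]
      exact (norm_integral_le_integral_norm _).trans (hC p q))
  refine ⟨T, isLocalizationOperator_iff.2 fun p q => ⟨hint p q, ?_⟩⟩
  rw [hT]
  simp only [inner_weak_integrand]

theorem exists_isLocalizationOperator_one (hf : MemLp f 1 volume) :
    ∃ T, IsLocalizationOperator φ₁ φ₂ f T := by
  have hf' := memLp_one_iff_integrable.1 hf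
  have hint : ∀ p q : L2 d,
      Integrable (fun z => f z * (stft φ₁ p z * starRingEnd ℂ (stft φ₂ q z))) := fun p q =>
    hf'.mul_bdd (integrable_stft_mul _ _ _ _).1
      (Filter.Eventually.of_forall fun z => norm_stft_mul_le p q z)
  refine exists_isLocalizationOperator_of_bound hint ((∫ z, ‖f z‖) * (‖φ₁‖ * ‖φ₂‖)) fun p q => ?_
  simp only [norm_mul (f _)]
  calc _ ≤ ∫ z, ‖f z‖ * (‖φ₁‖ * ‖φ₂‖ * ‖q‖ * ‖p‖) := by
        refine integral_mono (by simpa only [norm_mul (f _)] using (hint p q).norm)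
          (hf'.norm.mul_const _) fun z => ?_
        simp only
        gcongr
        exact norm_stft_mul_le p q z
    _ = _ := by rw [integral_mul_const]; ring

/-- One transform is bounded, so its product with `f` stays in `L²`; Cauchy–Schwarz against the
other transform gives the bound. -/
theorem exists_isLocalizationOperator_two (hf : MemLp f 2 volume) :
    ∃ T, IsLocalizationOperator φ₁ φ₂ f T := by
  have hint : ∀ p q : L2 d,
      Integrable (fun z => f z * (stft φ₁ p z * starRingEnd ℂ (stft φ₂ q z))) := fun p q => by
    refine (MemLp.integrable_mul (memLp_mul_stft hf φ₁ p) (memLp_stft φ₂ q).star).congr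
      (Filter.Eventually.of_forall fun z => ?_)
    exact mul_assoc _ _ _
  refine exists_isLocalizationOperator_of_bound hint (√(∫ z, ‖f z‖ ^ 2) * ‖φ₁‖ * ‖φ₂‖)
    fun p q => ?_
  simp only [← mul_assoc, norm_mul _ (starRingEnd ℂ _), RCLike.norm_conj]
  refine (integral_norm_mul_norm_le (memLp_mul_stft hf φ₁ p) (memLp_stft φ₂ q)).trans ?_
  rw [integral_norm_sq_stft, Real.sqrt_sq (by positivity)]
  have hle : √(∫ z, ‖f z * stft φ₁ p z‖ ^ 2) ≤ √(∫ z, ‖f z‖ ^ 2) * (‖φ₁‖ * ‖p‖) := by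
    rw [← Real.sqrt_sq (show 0 ≤ ‖φ₁‖ * ‖p‖ by positivity),
      ← Real.sqrt_mul (integral_nonneg fun _ => sq_nonneg _), ← integral_mul_const]
    refine Real.sqrt_le_sqrt (integral_mono (integrable_norm_sq (memLp_mul_stft hf φ₁ p))
      ((integrable_norm_sq hf).mul_const _) fun z => ?_)
    simp only [norm_mul, mul_pow]
    gcongr
    rw [← mul_pow]
    gcongr
    exact norm_stft_le _ _ _
  calc _ ≤ √(∫ z, ‖f z‖ ^ 2) * (‖φ₁‖ * ‖p‖) * (‖φ₂‖ * ‖q‖) := by gcongr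
    _ = _ := by ring

theorem exists_isLocalizationOperator_top (hf : MemLp f ∞ volume) :
    ∃ T, IsLocalizationOperator φ₁ φ₂ f T := by
  set M := (eLpNormEssSup f volume).toReal
  have hM : ∀ᵐ z, ‖f z‖ ≤ M := by
    have := hf.2
    rw [eLpNorm_exponent_top] at this
    filter_upwards [ae_le_eLpNormEssSup (f := f) (μ := volume)] with z hz
    rw [← toReal_enorm]
    exact ENNReal.toReal_mono this.ne hz
  have hint : ∀ p q : L2 d,
      Integrable (fun z => f z * (stft φ₁ p z * starRingEnd ℂ (stft φ₂ q z))) := fun p q =>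
    (integrable_stft_mul _ _ _ _).bdd_mul hf.1 hM
  refine exists_isLocalizationOperator_of_bound hint (M * ‖φ₁‖ * ‖φ₂‖) fun p q => ?_
  calc _ ≤ ∫ z, M * ‖stft φ₁ p z * starRingEnd ℂ (stft φ₂ q z)‖ := by
        refine integral_mono_ae (hint p q).norm ((integrable_stft_mul _ _ _ _).norm.const_mul _) ?_
        filter_upwards [hM] with z hz
        rw [norm_mul (f z)]
        gcongr
    _ ≤ M * ((‖φ₁‖ * ‖p‖) * (‖φ₂‖ * ‖q‖)) := by
        rw [integral_const_mul]
        gcongr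
        have := integral_norm_mul_norm_le (memLp_stft φ₁ p) (memLp_stft φ₂ q)
        rw [integral_norm_sq_stft, integral_norm_sq_stft, Real.sqrt_sq (by positivity),
          Real.sqrt_sq (by positivity)] at this
        simpa only [norm_mul, RCLike.norm_conj] using this
    _ = _ := by ring

theorem isLocalizationOperator_localizationOperator {p : ℝ≥0∞} (hp : p = 1 ∨ p = 2 ∨ p = ∞)
    (hf : MemLp f p volume) :
    IsLocalizationOperator φ₁ φ₂ f (localizationOperator φ₁ φ₂ f) := by
  have h : ∃ T, IsLocalizationOperator φ₁ φ₂ f T := by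
    rcases hp with rfl | rfl | rfl
    · exact exists_isLocalizationOperator_one hf
    · exact exists_isLocalizationOperator_two hf
    · exact exists_isLocalizationOperator_top hf
  obtain ⟨T, hT⟩ := h
  rwa [hT.eq]

theorem mem_localizationOperators_iff {p : ℝ≥0∞} (hp : p = 1 ∨ p = 2 ∨ p = ∞) :
    T ∈ localizationOperators φ₁ φ₂ p ↔
      ∃ f, MemLp f p volume ∧ IsLocalizationOperator φ₁ φ₂ f T := by
  constructor
  · rintro ⟨f, hf, rfl⟩
    exact ⟨f, hf, isLocalizationOperator_localizationOperator hp hf⟩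
  · rintro ⟨f, hf, hT⟩
    exact ⟨f, hf, hT.eq.symm⟩

theorem zero_mem_localizationOperators {p : ℝ≥0∞} (hp : p = 1 ∨ p = 2 ∨ p = ∞) :
    (0 : L2 d →L[ℂ] L2 d) ∈ localizationOperators φ₁ φ₂ p :=
  (mem_localizationOperators_iff hp).2 ⟨0, MemLp.zero,
    isLocalizationOperator_iff.2 fun p q => by simp⟩

theorem add_mem_localizationOperators {p : ℝ≥0∞} (hp : p = 1 ∨ p = 2 ∨ p = ∞)
    {A B : L2 d →L[ℂ] L2 d} (hA : A ∈ localizationOperators φ₁ φ₂ p)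
    (hB : B ∈ localizationOperators φ₁ φ₂ p) : A + B ∈ localizationOperators φ₁ φ₂ p := by
  rw [mem_localizationOperators_iff hp] at *
  obtain ⟨f, hf, hA⟩ := hA
  obtain ⟨g, hg, hB⟩ := hB
  rw [isLocalizationOperator_iff] at hA hB
  refine ⟨f + g, hf.add hg, isLocalizationOperator_iff.2 fun p q => ?_⟩
  simp only [Pi.add_apply, add_mul, add_apply, inner_add_right, ← (hA p q).2, ← (hB p q).2]
  exact ⟨(hA p q).1.add (hB p q).1, integral_add (hA p q).1 (hB p q).1⟩

theorem smul_mem_localizationOperators {p : ℝ≥0∞} (hp : p = 1 ∨ p = 2 ∨ p = ∞) (c : ℂ)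
    {A : L2 d →L[ℂ] L2 d} (hA : A ∈ localizationOperators φ₁ φ₂ p) :
    c • A ∈ localizationOperators φ₁ φ₂ p := by
  rw [mem_localizationOperators_iff hp] at *
  obtain ⟨f, hf, hA⟩ := hA
  rw [isLocalizationOperator_iff] at hA
  refine ⟨c • f, hf.const_smul c, isLocalizationOperator_iff.2 fun p q => ?_⟩
  simp only [Pi.smul_apply, smul_eq_mul, mul_assoc, smul_apply, inner_smul_right, ← (hA p q).2]
  exact ⟨(hA p q).1.const_mul c, integral_const_mul _ _⟩

end Existence

/-! ### Schatten norms of localization operators. -/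

section SchattenBounds

variable {φ₁ φ₂ : L2 d} {f : Phase d → ℂ} {T : L2 d →L[ℂ] L2 d}

/-- Minkowski's inequality for weak integrals in the trace norm; `hle` is the dual form of a
pointwise trace norm bound `w z` for the integrand. -/
theorem schattenNorm_one_le_of_weak {W : Phase d → L2 d → L2 d}
    (hint : ∀ p q, Integrable fun z => (inner ℂ q (W z p) : ℂ))
    (hT : ∀ p q, inner ℂ q (T p) = ∫ z, (inner ℂ q (W z p) : ℂ)) {w : Phase d → ℝ}
    (hw : Integrable w)
    (hle : ∀ z, ∀ V : L2 d →L[ℂ] L2 d, ‖V‖ ≤ 1 → ∀ F : Finset (basisIndex (L2 d)),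
      ‖∑ i ∈ F, inner ℂ (onb (L2 d) i) (V (W z (onb (L2 d) i)))‖ ≤ w z) :
    schattenNorm 1 T ≤ ENNReal.ofReal (∫ z, w z) := by
  refine schattenNorm_one_le fun V hV F => ?_
  simp only [← ContinuousLinearMap.adjoint_inner_left V, hT]
  rw [← integral_finsetSum _ fun i _ => hint _ _]
  refine norm_integral_le_of_norm_le hw (Filter.Eventually.of_forall fun z => ?_)
  simpa only [ContinuousLinearMap.adjoint_inner_left] using hle z V hV F

theorem schattenNorm_one_lt_top (hf : Integrable f) (hT : IsLocalizationOperator φ₁ φ₂ f T) :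
    schattenNorm 1 T < ∞ := by
  rw [isLocalizationOperator_iff] at hT
  simp only [← inner_weak_integrand] at hT
  refine (schattenNorm_one_le_of_weak (fun p q => (hT p q).1) (fun p q => (hT p q).2.symm)
    (hf.norm.mul_const (‖φ₂‖ * ‖φ₁‖)) fun z V hV F => ?_).trans_lt ENNReal.ofReal_lt_top
  simp only [map_smul, inner_smul_right, mul_assoc, ← Finset.mul_sum, norm_mul]
  gcongr
  simp only [mul_comm (stft _ _ _)]
  refine (norm_sum_inner_mul_inner_le (onb (L2 d)).orthonormal (tfShift z φ₁) _ F).trans ?_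
  rw [norm_tfShift]
  gcongr
  simpa using norm_apply_le_of_contraction hV (tfShift z φ₂)

/-- Test the weak integral against `T p` itself, apply Cauchy–Schwarz and cancel one factor `‖T p‖`.
-/
theorem norm_localizationOperator_apply_le (hf : MemLp f 2 volume)
    (hT : IsLocalizationOperator φ₁ φ₂ f T) (p : L2 d) :
    ‖T p‖ ^ 2 ≤ ‖φ₂‖ ^ 2 * ∫ z, ‖f z * stft φ₁ p z‖ ^ 2 := by
  have h := (isLocalizationOperator_iff.1 hT p (T p)).2
  have h1 : ‖T p‖ ^ 2 ≤ √(∫ z, ‖f z * stft φ₁ p z‖ ^ 2) * (‖φ₂‖ * ‖T p‖) := by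
    have e : ‖(inner ℂ (T p) (T p) : ℂ)‖ = ‖T p‖ ^ 2 := by
      rw [inner_self_eq_norm_sq_to_K]; simp
    rw [← e, ← h]
    refine (norm_integral_le_integral_norm _).trans ?_
    simp only [← mul_assoc, norm_mul _ (starRingEnd ℂ _), RCLike.norm_conj]
    refine (integral_norm_mul_norm_le (memLp_mul_stft hf φ₁ p) (memLp_stft φ₂ (T p))).trans ?_
    rw [integral_norm_sq_stft, Real.sqrt_sq (by positivity)]
    exact le_of_eq (by ring)
  have h2 : ‖T p‖ ≤ ‖φ₂‖ * √(∫ z, ‖f z * stft φ₁ p z‖ ^ 2) := by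
    rcases (norm_nonneg (T p)).eq_or_lt with h0 | h0
    · rw [← h0]; positivity
    · refine le_of_mul_le_mul_right ?_ h0
      calc _ = ‖T p‖ ^ 2 := (sq _).symm
        _ ≤ _ := h1
        _ = _ := by ring
  calc ‖T p‖ ^ 2 ≤ (‖φ₂‖ * √(∫ z, ‖f z * stft φ₁ p z‖ ^ 2)) ^ 2 := by gcongr
    _ = _ := by rw [mul_pow, Real.sq_sqrt (integral_nonneg fun _ => sq_nonneg _)]

/-- Bessel's inequality for `π(z)a`, applied under the integral. -/
theorem summable_integral_norm_sq_mul_stft (hf : MemLp f 2 volume) (a : L2 d) :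
    Summable fun i => ∫ z, ‖f z * stft a (onb (L2 d) i) z‖ ^ 2 := by
  refine summable_of_sum_le (c := ∫ z, ‖f z‖ ^ 2 * ‖a‖ ^ 2)
    (fun i => integral_nonneg fun _ => sq_nonneg _) fun F => ?_
  rw [← integral_finsetSum _ fun i _ => integrable_norm_sq (memLp_mul_stft hf _ _)]
  refine integral_mono
    (integrable_finsetSum _ fun i _ => integrable_norm_sq (memLp_mul_stft hf _ _))
    ((integrable_norm_sq hf).mul_const _) fun z => ?_
  simp only [norm_mul, mul_pow, ← Finset.mul_sum]
  gcongr
  have := (onb (L2 d)).orthonormal.sum_inner_products_le (tfShift z a) (s := F)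
  simpa only [stft, norm_inner_symm _ (tfShift z a), norm_tfShift] using this

theorem schattenNorm_two_lt_top_of_summable {T : L2 d →L[ℂ] L2 d}
    (h : Summable fun i => ‖T (onb (L2 d) i)‖ ^ 2) : schattenNorm 2 T < ∞ := by
  rw [schattenNorm_two_lt_top_iff, ← ENNReal.ofReal_tsum_of_nonneg (fun _ => sq_nonneg _) h]
  exact ENNReal.ofReal_lt_top

theorem summable_of_schattenNorm_two_lt_top {T : L2 d →L[ℂ] L2 d} (h : schattenNorm 2 T < ∞) :
    Summable fun i => ‖T (onb (L2 d) i)‖ ^ 2 := by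
  rw [schattenNorm_two_lt_top_iff] at h
  simpa only [ENNReal.toReal_ofReal (sq_nonneg _)] using ENNReal.summable_toReal h.ne

theorem schattenNorm_two_lt_top (hf : MemLp f 2 volume)
    (hT : IsLocalizationOperator φ₁ φ₂ f T) : schattenNorm 2 T < ∞ :=
  schattenNorm_two_lt_top_of_summable <|
    ((summable_integral_norm_sq_mul_stft hf φ₁).mul_left (‖φ₂‖ ^ 2)).of_nonneg_of_le
      (fun _ => sq_nonneg _) fun _ => norm_localizationOperator_apply_le hf hT _

end SchattenBounds

/-! ### Operators given by a spreading function. -/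

section Weyl

variable {F : Phase d → ℂ} {T : L2 d →L[ℂ] L2 d}

theorem integrable_mul_inner_tfShift (hF : MemLp F 2 volume) (p q : L2 d) :
    Integrable fun ζ => F ζ * inner ℂ q (tfShift ζ p) := by
  simp only [← conj_stft]
  exact MemLp.integrable_mul hF (memLp_stft p q).star

/-- `T = ∫ F(ζ) π(ζ) dζ`, as a weak integral. -/
def IsWeyl (F : Phase d → ℂ) (T : L2 d →L[ℂ] L2 d) : Prop :=
  ∀ p q : L2 d, inner ℂ q (T p) = ∫ ζ, F ζ * inner ℂ q (tfShift ζ p)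

theorem exists_isWeyl (hF : MemLp F 2 volume) : ∃ T, IsWeyl F T := by
  obtain ⟨T, hT⟩ := exists_clm_of_weak (fun ζ p => F ζ • tfShift ζ p)
    (fun z p q => by rw [tfShift_add, smul_add])
    (fun z c p => by rw [tfShift_smul, smul_comm])
    (fun p q => by simpa only [inner_smul_right] using integrable_mul_inner_tfShift hF p q)
    (√(∫ z, ‖F z‖ ^ 2)) (fun p q => by
      simp only [inner_smul_right, ← conj_stft]
      refine (norm_integral_le_integral_norm _).trans ?_
      simp only [norm_mul, RCLike.norm_conj]
      refine (integral_norm_mul_norm_le hF (memLp_stft p q)).trans ?_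
      rw [integral_norm_sq_stft, Real.sqrt_sq (by positivity)]
      exact le_of_eq (by ring))
  exact ⟨T, fun p q => by simpa only [inner_smul_right] using hT p q⟩

/-- The Hilbert–Schmidt norm of an operator is bounded by the `L²`-norm of its spreading
function. -/
theorem IsWeyl.schattenNorm_two_le (hT : IsWeyl F T) (hF : MemLp F 2 volume) :
    schattenNorm 2 T ≤ eLpNorm F 2 volume := by
  let e := onb (L2 d)
  let w : basisIndex (L2 d) × basisIndex (L2 d) → Lp ℂ 2 (volume : Measure (Phase d)) :=
    fun k => (memLp_stft (e k.1) (e k.2)).toLp _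
  -- By Moyal the functions `stft (e i) (e j)` are orthonormal. The matrix entries of `T` are the
  -- coefficients of `F` in this system, so Bessel bounds the Hilbert–Schmidt norm.
  have hw : Orthonormal ℂ w := by
    classical
    rw [orthonormal_iff_ite]
    intro k l
    have : inner ℂ (w k) (w l)
        = ∫ z, stft (e l.1) (e l.2) z * starRingEnd ℂ (stft (e k.1) (e k.2) z) := by
      rw [L2.inner_def]
      refine integral_congr_ae ?_
      filter_upwards [(memLp_stft (e k.1) (e k.2)).coeFn_toLp,
        (memLp_stft (e l.1) (e l.2)).coeFn_toLp] with z h1 h2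
      rw [h1, h2, RCLike.inner_apply]
    rw [this, integral_stft_mul, orthonormal_iff_ite.1 e.orthonormal,
      orthonormal_iff_ite.1 e.orthonormal]
    by_cases h1 : k.1 = l.1 <;> by_cases h2 : k.2 = l.2 <;> simp [h1, h2, Prod.ext_iff, eq_comm]
  have hinner : ∀ k, inner ℂ (w k) (hF.toLp F) = inner ℂ (e k.2) (T (e k.1)) := by
    intro k
    rw [hT, L2.inner_def]
    refine integral_congr_ae ?_
    filter_upwards [(memLp_stft (e k.1) (e k.2)).coeFn_toLp, hF.coeFn_toLp] with z h1 h2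
    rw [h1, h2, RCLike.inner_apply, conj_stft]
  have hle : ∑' i, ENNReal.ofReal (‖T (e i)‖ ^ 2) ≤ ENNReal.ofReal (‖hF.toLp F‖ ^ 2) := by
    simp only [fun i => ofReal_norm_sq_eq_tsum e (T (e i))]
    rw [← ENNReal.tsum_prod (f := fun i j => ENNReal.ofReal (‖inner ℂ (e j) (T (e i))‖ ^ 2)),
      ENNReal.tsum_eq_iSup_sum]
    refine iSup_le fun s => ?_
    rw [← ENNReal.ofReal_sum_of_nonneg fun _ _ => sq_nonneg _]
    refine ENNReal.ofReal_le_ofReal ?_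
    simp only [← hinner]
    exact hw.sum_inner_products_le _
  rw [schattenNorm_two_eq]
  calc _ ≤ (ENNReal.ofReal (‖hF.toLp F‖ ^ 2)) ^ (1 / 2 : ℝ) := by gcongr
    _ = ENNReal.ofReal ‖hF.toLp F‖ := by
        rw [ENNReal.ofReal_rpow_of_nonneg (sq_nonneg _) (by norm_num), ← Real.sqrt_eq_rpow,
          Real.sqrt_sq (norm_nonneg _)]
    _ = eLpNorm F 2 volume := by
        rw [ofReal_norm, Lp.enorm_def, eLpNorm_congr_ae hF.coeFn_toLp]

open scoped ContDiff in
-- Every test function is a transform by `sft_sft`, so the multiplication formula moves the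
-- transform onto `f`, where it is zero.
theorem ae_eq_zero_of_sft_eq_zero {f : Phase d → ℂ} (hf : Integrable f)
    (h : ∀ ζ, sft f ζ = 0) : f =ᵐ[volume] 0 := by
  refine ae_eq_zero_of_integral_contDiff_smul_eq_zero hf.locallyIntegrable fun G hG hGc => ?_
  have hG' : ContDiff ℝ ∞ fun ζ => (G ζ : ℂ) := Complex.ofRealCLM.contDiff.comp hG
  have hGc' : HasCompactSupport fun ζ => (G ζ : ℂ) := hGc.comp_left Complex.ofReal_zero
  have h1 := integral_mul_integral_chi (integrable_sft hG' hGc') hf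
  rw [sft_sft hG' hGc'] at h1
  have h2 : ∀ z, ∫ ζ, chi z ζ * f ζ = sft f (-z) := fun z => by
    rw [sft]
    congr 1
    funext ζ
    rw [chi_neg_right]
  simp only [h2, h, mul_zero, integral_zero] at h1
  rw [h1]
  simp

theorem exists_ne_zero_L2 (d : ℕ) : ∃ ψ : L2 d, ψ ≠ 0 := by
  refine ⟨indicatorConstLp 2 (measurableSet_ball (x := (0 : Space d)) (ε := 1))
    measure_ball_lt_top.ne (1 : ℂ), ?_⟩
  rw [← norm_pos_iff, norm_indicatorConstLp (by simp) (by simp), norm_one, one_mul]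
  refine Real.rpow_pos_of_pos ?_ _
  exact ENNReal.toReal_pos (Metric.measure_ball_pos _ _ one_pos).ne' measure_ball_lt_top.ne

/-- The spreading function of an operator is unique. -/
theorem IsWeyl.ae_eq_zero (hT : IsWeyl F 0) (hF : MemLp F 2 volume) : F =ᵐ[volume] 0 := by
  have h1 : ∀ p q : L2 d, (fun ζ => F ζ * inner ℂ q (tfShift ζ p)) =ᵐ[volume] 0 := by
    intro p q
    refine ae_eq_zero_of_sft_eq_zero (integrable_mul_inner_tfShift hF p q) fun z => ?_
    -- Evaluating between vectors shifted by `z` inserts `chi ζ z`: this is the symplectic Fourier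
    -- transform at `z` of the product.
    have h2 := hT (tfShift z p) (tfShift z q)
    rw [zero_apply, inner_zero_right] at h2
    rw [h2, sft]
    refine integral_congr_ae (Filter.Eventually.of_forall fun ζ => ?_)
    simp only
    rw [tfShift_comm, inner_smul_right, inner_tfShift]
    ring
  obtain ⟨ψ, hψ⟩ := exists_ne_zero_L2 d
  -- The factor `⟨π(ζ₀)ψ, π(ζ)ψ⟩` is nonzero at `ζ₀`, hence nearby, and can be divided out locally.
  refine measure_null_of_locally_null _ fun ζ₀ _ => ?_
  have hcont : Continuous fun ζ => (inner ℂ (tfShift ζ₀ ψ) (tfShift ζ ψ) : ℂ) :=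
    continuous_const.inner (continuous_tfShift ψ)
  have hne : (inner ℂ (tfShift ζ₀ ψ) (tfShift ζ₀ ψ) : ℂ) ≠ 0 := by
    rw [inner_tfShift]; exact inner_self_ne_zero.2 hψ
  have hU := hcont.continuousAt.eventually_ne hne
  refine ⟨_, Filter.inter_mem self_mem_nhdsWithin (mem_nhdsWithin_of_mem_nhds hU), ?_⟩
  refine measure_mono_null (fun ζ hζ => ?_) (h1 ψ (tfShift ζ₀ ψ))
  exact mul_ne_zero hζ.1 hζ.2

end Weyl

end LocOp

namespace LocOp

variable {d : ℕ} {φ₁ φ₂ : L2 d}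

/-! ### The zero set and operators orthogonal to all localization operators. -/

theorem mem_ambiguityZeros_iff {z : Phase d} : z ∈ ambiguityZeros φ₁ φ₂ ↔ stft φ₁ φ₂ z = 0 := by
  simp [ambiguityZeros, crossAmbiguity]

theorem isClosed_ambiguityZeros : IsClosed (ambiguityZeros φ₁ φ₂) := by
  have : ambiguityZeros φ₁ φ₂ = {z | stft φ₁ φ₂ z = 0} := by
    ext z; exact mem_ambiguityZeros_iff
  rw [this]
  exact isClosed_eq (continuous_stft _ _) continuous_const

instance countable_basisIndex_L2 : Countable (basisIndex (L2 d)) := by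
  have : Fact ((2 : ℝ≥0∞) ≠ ⊤) := ⟨by simp⟩
  exact countable_basisIndex

/-- The Weyl form of a localization operator with integrable symbol. -/
theorem IsLocalizationOperator.isWeyl {f : Phase d → ℂ} {T : L2 d →L[ℂ] L2 d}
    (hT : IsLocalizationOperator φ₁ φ₂ f T) (hf : Integrable f) :
    IsWeyl (fun ζ => sft f ζ * stft φ₁ φ₂ ζ) T := fun p q => by
  rw [← (isLocalizationOperator_iff.1 hT p q).2, integral_mul_stft_mul hf]
  simp only [mul_assoc]

/-- As a function of `z`, the conjugate of this inner product is the symplectic Fourier transform of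
`F · conj (stft φ₁ φ₂)`, a product that vanishes identically. -/
theorem inner_isWeyl_tfShift {F : Phase d → ℂ} {S : L2 d →L[ℂ] L2 d} (hS : IsWeyl F S)
    (h : ∀ ζ, F ζ = 0 ∨ stft φ₁ φ₂ ζ = 0) (z : Phase d) :
    inner ℂ (S (tfShift z φ₁)) (tfShift z φ₂) = 0 := by
  rw [← inner_conj_symm, hS, integral_eq_zero_of_ae, map_zero]
  refine Filter.Eventually.of_forall fun ζ => ?_
  simp only [Pi.zero_apply]
  rw [tfShift_comm, inner_smul_right, inner_tfShift]
  rcases h ζ with h | h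
  · rw [h, zero_mul]
  · rw [← inner_conj_symm, show inner ℂ (tfShift ζ φ₁) φ₂ = 0 from h]
    simp

/-- The pairing of a localization operator with an operator `S`. -/
theorem tsum_inner_localizationOperator_eq_zero {f : Phase d → ℂ} {T S : L2 d →L[ℂ] L2 d}
    (hT : IsLocalizationOperator φ₁ φ₂ f T)
    (hs : Summable fun j => ∫ z, ‖f z * (stft φ₁ (onb (L2 d) j) z *
      starRingEnd ℂ (stft φ₂ (S (onb (L2 d) j)) z))‖)
    (hz : ∀ z, inner ℂ (S (tfShift z φ₁)) (tfShift z φ₂) = 0) :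
    ∑' j, inner ℂ (S (onb (L2 d) j)) (T (onb (L2 d) j)) = 0 := by
  rw [isLocalizationOperator_iff] at hT
  simp only [← fun j => (hT (onb (L2 d) j) (S (onb (L2 d) j))).2]
  rw [integral_tsum_of_summable_integral_norm (fun j => (hT _ _).1) hs]
  refine integral_eq_zero_of_ae (Filter.Eventually.of_forall fun z => ?_)
  -- After exchanging sum and integral, Parseval reassembles the sum over `j` into `f z` times the
  -- vanishing inner product `hz`.
  have h1 := (onb (L2 d)).hasSum_inner_mul_inner (tfShift z φ₁)
    (ContinuousLinearMap.adjoint S (tfShift z φ₂))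
  rw [ContinuousLinearMap.adjoint_inner_right, hz] at h1
  have h2 := (h1.mul_left (f z)).tsum_eq
  rw [mul_zero] at h2
  rw [Pi.zero_apply, ← h2]
  refine tsum_congr fun j => ?_
  rw [conj_stft, ContinuousLinearMap.adjoint_inner_right]
  rfl

/-! ### Density in the trace class. -/

section TraceClass

open Filter Topology
open scoped ContDiff

theorem summable_integral_norm_mul_stft_one {f : Phase d → ℂ} (hf : Integrable f)
    (S : L2 d →L[ℂ] L2 d) :
    Summable fun j => ∫ z, ‖f z * (stft φ₁ (onb (L2 d) j) z *
      starRingEnd ℂ (stft φ₂ (S (onb (L2 d) j)) z))‖ := by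
  have hint : ∀ j, Integrable fun z => f z * (stft φ₁ (onb (L2 d) j) z *
      starRingEnd ℂ (stft φ₂ (S (onb (L2 d) j)) z)) := fun j =>
    hf.mul_bdd (integrable_stft_mul _ _ _ _).1
      (Filter.Eventually.of_forall fun z => norm_stft_mul_le _ _ z)
  refine summable_of_sum_le (c := ∫ z, ‖f z‖ * (‖S‖ * ‖φ₂‖ * ‖φ₁‖))
    (fun j => integral_nonneg fun _ => norm_nonneg _) fun F => ?_
  rw [← integral_finsetSum _ fun j _ => (hint j).norm]
  refine integral_mono (integrable_finsetSum _ fun j _ => (hint j).norm)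
    (hf.norm.mul_const _) fun z => ?_
  simp only [norm_mul (f z), ← Finset.mul_sum]
  gcongr
  have h := sum_norm_inner_mul_inner_le (onb (L2 d)).orthonormal (tfShift z φ₁)
    (ContinuousLinearMap.adjoint S (tfShift z φ₂)) F
  rw [norm_tfShift] at h
  refine le_trans (le_of_eq ?_) (h.trans ?_)
  · refine Finset.sum_congr rfl fun j _ => ?_
    rw [conj_stft, ContinuousLinearMap.adjoint_inner_right, mul_comm]
    rfl
  · gcongr
    refine (ContinuousLinearMap.le_opNorm _ _).trans_eq ?_
    rw [LinearIsometryEquiv.norm_map, norm_tfShift]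

/-- At a zero `ζ₀`, the trace norm continuous functional `A ↦ tr(π(ζ₀)* A)` kills all localization
operators, but not all of `𝒯¹`. -/
theorem ambiguityZeros_eq_empty_of_dense
    (h : DenseInSchatten 1 (localizationOperators φ₁ φ₂ 1)) : ambiguityZeros φ₁ φ₂ = ∅ := by
  by_contra hne
  obtain ⟨ζ₀, hζ₀⟩ := Set.nonempty_iff_ne_empty.2 hne
  rw [mem_ambiguityZeros_iff] at hζ₀
  obtain ⟨ψ, hψ⟩ := exists_ne_zero_L2 d
  set V := ContinuousLinearMap.adjoint (tfCLM ζ₀) with hV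
  have hzero : ∀ A ∈ localizationOperators φ₁ φ₂ 1, HasSum
      (fun j => inner ℂ (onb (L2 d) j) ((V ∘L A) (onb (L2 d) j))) 0 := by
    intro A hA
    obtain ⟨f, hf, hT⟩ := (mem_localizationOperators_iff (Or.inl rfl)).1 hA
    have hf' := memLp_one_iff_integrable.1 hf
    obtain ⟨u, v, hn, -⟩ := exists_isNuclear (schattenNorm_one_lt_top hf' hT)
    have h1 := (hn.comp_left V).hasSum_trace (onb (L2 d))
    rw [← h1.tsum_eq] at h1
    convert h1 using 1
    have h2 := tsum_inner_localizationOperator_eq_zero (S := tfCLM ζ₀) hT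
      (summable_integral_norm_mul_stft_one hf' _) (fun z => by
        rw [tfCLM_apply, tfShift_comm, inner_smul_left, inner_tfShift,
          show inner ℂ (tfShift ζ₀ φ₁) φ₂ = 0 from hζ₀, mul_zero])
    rw [← h2]
    refine tsum_congr fun j => ?_
    rw [ContinuousLinearMap.comp_apply, hV, ContinuousLinearMap.adjoint_inner_right]
  -- Chosen so that `tr(π(ζ₀)* R) = ‖ψ‖²`; no operator killed by the functional can be closer to `R`
  -- than this.
  set R := rankOne (tfShift ζ₀ ψ) ψ with hR
  have hRn := isNuclear_rankOne (tfShift ζ₀ ψ) ψ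
  have hRt : HasSum (fun j => inner ℂ (onb (L2 d) j) ((V ∘L R) (onb (L2 d) j)))
      (inner ℂ ψ ψ) := by
    have := (hRn.comp_left V).hasSum_trace (onb (L2 d))
    simpa [hV, adjoint_tfCLM_tfShift] using this
  have hpos : (0 : ℝ≥0∞) < ENNReal.ofReal (‖ψ‖ ^ 2) := by
    rw [ENNReal.ofReal_pos]
    have := norm_pos_iff.2 hψ
    positivity
  obtain ⟨A, hA, hlt⟩ := h.2 R (hRn.schattenNorm_le.trans_lt ENNReal.ofReal_lt_top) _ hpos
  have h1 := norm_trace_comp_le (hlt.trans ENNReal.ofReal_lt_top) (norm_adjoint_tfCLM_le ζ₀)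
  have h2 : trace (V ∘L (R - A)) = inner ℂ ψ ψ := by
    have h3 := hRt.sub (hzero A hA)
    rw [sub_zero] at h3
    rw [trace, ← h3.tsum_eq]
    refine tsum_congr fun j => ?_
    simp
  rw [← hV, h2, inner_self_eq_norm_sq_to_K] at h1
  have h4 := (ENNReal.toReal_lt_toReal (hlt.trans ENNReal.ofReal_lt_top).ne
    ENNReal.ofReal_ne_top).2 hlt
  rw [ENNReal.toReal_ofReal (sq_nonneg _)] at h4
  simp at h1
  exact absurd (h1.trans_lt h4) (lt_irrefl _)

/-- Wiener's lemma needs transforms of `L¹` functions. Products of two short-time Fourier transforms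
are of this kind, which is why the conjugate factor is carried along. -/
theorem exists_sft_eq_stft_mul (a b p q : L2 d) :
    ∃ m : Phase d → ℂ, Integrable m ∧
      ∀ ζ, sft m ζ = starRingEnd ℂ (stft p q ζ) * stft a b ζ := by
  refine ⟨fun z => stft a p (-z) * starRingEnd ℂ (stft b q (-z)),
    (integrable_stft_mul a b p q).comp_neg, fun ζ => ?_⟩
  rw [conj_stft, ← integral_chi_mul_stft, sft, ← integral_neg_eq_self]
  simp only [neg_neg, chi_neg_left]

/-- Change of windows. -/
theorem mem_localizationOperators_of_bandlimited (h0 : ∀ ζ, stft φ₁ φ₂ ζ ≠ 0) {u v : L2 d}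
    {g : Phase d → ℂ} (hg : Integrable g) (hG : ContDiff ℝ ∞ (sft g))
    (hGc : HasCompactSupport (sft g)) {T : L2 d →L[ℂ] L2 d}
    (hT : IsLocalizationOperator v u g T) : T ∈ localizationOperators φ₁ φ₂ 1 := by
  obtain ⟨m₀, hm₀, hm₀s⟩ := exists_sft_eq_stft_mul φ₁ φ₂ φ₁ φ₂
  obtain ⟨m₁, hm₁, hm₁s⟩ := exists_sft_eq_stft_mul v u φ₁ φ₂
  obtain ⟨k, hk, hks⟩ := exists_sft_mul_eq hm₀ (fun ζ => by
    rw [hm₀s]; exact mul_ne_zero ((map_ne_zero _).2 (h0 ζ)) (h0 ζ)) hG hGc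
  have hf := integrable_conv hk hm₁
  refine (mem_localizationOperators_iff (Or.inl rfl)).2
    -- With `V = stft φ₁ φ₂`: `sft k · |V|² = sft g`, so the transform of `k * m₁` times `V` is `sft
    -- k · |V|² · stft v u = sft g · stft v u`, the spreading function of `T`.
    ⟨conv k m₁, memLp_one_iff_integrable.2 hf, isLocalizationOperator_iff.2 fun p q => ⟨?_, ?_⟩⟩
  · exact hf.mul_bdd (integrable_stft_mul _ _ _ _).1
      (Filter.Eventually.of_forall fun z => norm_stft_mul_le p q z)
  · rw [integral_mul_stft_mul hf, hT.isWeyl hg p q]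
    refine integral_congr_ae (Filter.Eventually.of_forall fun ζ => ?_)
    simp only [sft_conv hk hm₁, ← hks, hm₀s, hm₁s]
    ring

/-- Since `∫ g = 1`, the difference is the integral of `g(z) (u⊗v - π(z)u⊗π(z)v)`, and the bracket
splits as `u⊗(v - π(z)v) + (u - π(z)u)⊗π(z)v`. -/
theorem schattenNorm_rankOne_sub_le {u v : L2 d} {g : Phase d → ℂ} (hg : Integrable g)
    (hg1 : ∫ z, g z = 1) {T : L2 d →L[ℂ] L2 d} (hT : IsLocalizationOperator v u g T) :
    schattenNorm 1 (rankOne u v - T) ≤ ENNReal.ofReal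
      (∫ z, ‖g z‖ * (‖u‖ * ‖tfShift z v - v‖ + ‖tfShift z u - u‖ * ‖v‖)) := by
  rw [isLocalizationOperator_iff] at hT
  have hW : ∀ (p q : L2 d) z,
      inner ℂ q (g z • (inner ℂ v p • u - stft v p z • tfShift z u))
      = g z * (inner ℂ q u * inner ℂ v p)
        - g z * (stft v p z * starRingEnd ℂ (stft u q z)) := fun p q z => by
    rw [inner_smul_right, inner_sub_right, inner_smul_right, inner_smul_right, conj_stft]
    ring
  have hcont : Continuous fun z : Phase d =>
      ‖u‖ * ‖tfShift z v - v‖ + ‖tfShift z u - u‖ * ‖v‖ :=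
    (continuous_const.mul ((continuous_tfShift v).sub continuous_const).norm).add
      (((continuous_tfShift u).sub continuous_const).norm.mul continuous_const)
  refine schattenNorm_one_le_of_weak
    (W := fun z p => g z • (inner ℂ v p • u - stft v p z • tfShift z u)) ?_ ?_ ?_ ?_
  · intro p q
    simp only [hW]
    exact (hg.mul_const _).sub (hT p q).1
  · intro p q
    simp only [hW]
    rw [integral_sub (hg.mul_const _) (hT p q).1, (hT p q).2, integral_mul_const, hg1, one_mul,
      sub_apply, inner_sub_right, inner_rankOne]
  · refine hg.norm.mul_bdd hcont.aestronglyMeasurable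
      (c := ‖u‖ * (‖v‖ + ‖v‖) + (‖u‖ + ‖u‖) * ‖v‖) (Filter.Eventually.of_forall fun z => ?_)
    rw [Real.norm_of_nonneg (by positivity)]
    gcongr
    · exact (norm_sub_le _ _).trans_eq (by rw [norm_tfShift])
    · exact (norm_sub_le _ _).trans_eq (by rw [norm_tfShift])
  · intro z V hV F
    simp only [map_smul, inner_smul_right, ← Finset.mul_sum, norm_mul]
    gcongr
    have h1 := norm_sum_inner_mul_inner_le (onb (L2 d)).orthonormal (v - tfShift z v) (V u) F
    have h2 := norm_sum_inner_mul_inner_le (onb (L2 d)).orthonormal (tfShift z v)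
      (V (u - tfShift z u)) F
    have h3 := norm_apply_le_of_contraction hV u
    have h4 := norm_apply_le_of_contraction hV (u - tfShift z u)
    rw [norm_sub_rev] at h1
    rw [norm_sub_rev u, norm_tfShift] at *
    have e : ∀ j, (inner ℂ (onb (L2 d) j) (V (inner ℂ v (onb (L2 d) j) • u
          - stft v (onb (L2 d) j) z • tfShift z u)) : ℂ)
        = inner ℂ (onb (L2 d) j) (V u) * inner ℂ (v - tfShift z v) (onb (L2 d) j)
          + inner ℂ (onb (L2 d) j) (V (u - tfShift z u))
            * inner ℂ (tfShift z v) (onb (L2 d) j) := fun j => by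
      simp only [map_sub, map_smul, inner_sub_right, inner_sub_left, inner_smul_right, stft]
      ring
    simp only [e, Finset.sum_add_distrib]
    refine (norm_add_le _ _).trans (add_le_add (h1.trans ?_) (h2.trans ?_)) <;> gcongr

theorem denseInSchatten_one_of_ambiguityZeros_eq_empty (h : ambiguityZeros φ₁ φ₂ = ∅) :
    DenseInSchatten 1 (localizationOperators φ₁ φ₂ 1) := by
  have h0 : ∀ ζ, stft φ₁ φ₂ ζ ≠ 0 := fun ζ hζ => by
    have : ζ ∈ ambiguityZeros φ₁ φ₂ := mem_ambiguityZeros_iff.2 hζ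
    simp [h] at this
  refine denseInSchatten_of_rankOne (fun S T => (schattenNorm_one_add_le S T).trans ?_)
    (fun T hT => schattenApprox_one_finiteRankSums hT) ?_
    (zero_mem_localizationOperators (Or.inl rfl))
    (fun A hA B hB => add_mem_localizationOperators (Or.inl rfl) hA hB) ?_ schattenNorm_one_zero
  · rw [two_mul]; exact le_self_add
  · intro T hT
    obtain ⟨f, hf, hT⟩ := (mem_localizationOperators_iff (Or.inl rfl)).1 hT
    exact schattenNorm_one_lt_top (memLp_one_iff_integrable.1 hf) hT
  intro u v ε hε
  obtain ⟨G, hG, hGc, hG1, -⟩ := exists_bump (0 : Phase d) one_pos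
  have hs := integrable_sft hG hGc
  have hcont : Continuous fun z : Phase d =>
      ‖u‖ * ‖tfShift z v - v‖ + ‖tfShift z u - u‖ * ‖v‖ :=
    (continuous_const.mul ((continuous_tfShift v).sub continuous_const).norm).add
      (((continuous_tfShift u).sub continuous_const).norm.mul continuous_const)
  have hlim := tendsto_integral_norm_mul_dilate hs hcont
    (C := ‖u‖ * (‖v‖ + ‖v‖) + (‖u‖ + ‖u‖) * ‖v‖) (fun z => by
      rw [Real.norm_of_nonneg (by positivity)]
      gcongr
      · exact (norm_sub_le _ _).trans_eq (by rw [norm_tfShift])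
      · exact (norm_sub_le _ _).trans_eq (by rw [norm_tfShift])) (by simp [tfShift_zero])
  have hlim2 := (ENNReal.continuous_ofReal.tendsto 0).comp hlim
  rw [ENNReal.ofReal_zero] at hlim2
  -- The symbol is `sft G` dilated by `t⁻¹`: an approximate identity as `t → 0` whose transform `G(t
  -- ·)` is still smooth and compactly supported, with value `1` at the origin.
  obtain ⟨t, ht, ht0⟩ := ((hlim2.eventually (gt_mem_nhds hε)).and self_mem_nhdsWithin).exists
  have ht0 : 0 < t := ht0
  have hr : 0 < t⁻¹ := inv_pos.2 ht0
  have hcd : ContDiff ℝ ∞ fun ζ : Phase d => G ((t⁻¹)⁻¹ • ζ) := hG.comp (contDiff_const_smul _)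
  have hcc : HasCompactSupport fun ζ : Phase d => G ((t⁻¹)⁻¹ • ζ) :=
    hGc.comp_homeomorph (Homeomorph.smulOfNeZero (t⁻¹)⁻¹ (inv_ne_zero hr.ne'))
  have hdil : dilate t⁻¹ (sft G) = sft fun ζ => G ((t⁻¹)⁻¹ • ζ) := by
    funext z; rw [sft_comp_inv_smul G hr]; rfl
  have hgi := integrable_dilate hs hr
  have hsft : sft (dilate t⁻¹ (sft G)) = fun ζ => G ((t⁻¹)⁻¹ • ζ) := by
    rw [hdil, sft_sft hcd hcc]
  obtain ⟨T, hT⟩ := exists_isLocalizationOperator_one (φ₁ := v) (φ₂ := u)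
    (memLp_one_iff_integrable.2 hgi)
  refine ⟨T, mem_localizationOperators_of_bandlimited h0 hgi (by rw [hsft]; exact hcd)
    (by rw [hsft]; exact hcc) hT, ?_⟩
  refine (schattenNorm_rankOne_sub_le hgi ?_ hT).trans_lt (lt_of_le_of_lt (le_of_eq ?_) ht)
  · rw [← sft_zero, hsft]
    simpa using hG1 0 (by simp)
  · rw [Function.comp_apply]
    congr 1
    rw [← integral_dilate_mul hr fun z => ‖sft G z‖ * (‖u‖ * ‖tfShift (t • z) v - v‖
      + ‖tfShift (t • z) u - u‖ * ‖v‖)]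
    congr 1
    funext z
    rw [dilate, norm_mul, Complex.norm_of_nonneg (by positivity), smul_inv_smul₀ ht0.ne', mul_assoc]

end TraceClass

end LocOp

namespace LocOp

variable {d : ℕ} {φ₁ φ₂ : L2 d}

/-! ### Density in the Hilbert–Schmidt class. -/

section HilbertSchmidt

open scoped ContDiff

theorem memLp_two_mul_stft {G : Phase d → ℂ} (hG : Continuous G) (hGc : HasCompactSupport G)
    (a b : L2 d) : MemLp (fun ζ => G ζ * stft a b ζ) 2 volume :=
  (hG.mul (continuous_stft a b)).memLp_of_hasCompactSupport hGc.mul_right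

/-- The smooth, compactly supported multiples of a short-time Fourier transform. -/
def smoothMultiples (a b : L2 d) : Submodule ℂ (Lp ℂ 2 (volume : Measure (Phase d))) where
  carrier := {h | ∃ G : Phase d → ℂ, ContDiff ℝ ∞ G ∧ HasCompactSupport G ∧
    h =ᵐ[volume] fun ζ => G ζ * stft a b ζ}
  add_mem' := by
    rintro h k ⟨G, hG, hGc, hh⟩ ⟨G', hG', hGc', hk⟩
    refine ⟨fun ζ => G ζ + G' ζ, hG.add hG', hGc.add hGc', ?_⟩
    filter_upwards [Lp.coeFn_add h k, hh, hk] with ζ h1 h2 h3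
    rw [h1, Pi.add_apply, h2, h3, add_mul]
  zero_mem' := by
    refine ⟨fun _ => 0, contDiff_const, HasCompactSupport.zero, ?_⟩
    filter_upwards [Lp.coeFn_zero ℂ 2 (volume : Measure (Phase d))] with ζ h1
    rw [h1, Pi.zero_apply, zero_mul]
  smul_mem' := by
    rintro c h ⟨G, hG, hGc, hh⟩
    refine ⟨fun ζ => c * G ζ, contDiff_const.mul hG, hGc.mul_left, ?_⟩
    filter_upwards [Lp.coeFn_smul c h, hh] with ζ h1 h2
    rw [h1, Pi.smul_apply, h2, smul_eq_mul, mul_assoc]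

/-- If `h` is orthogonal to all multiples, then `h · conj (stft a b)` annihilates all test
functions, so it vanishes a.e., and so does `h`. -/
theorem topologicalClosure_smoothMultiples {a b : L2 d} (h0 : ∀ᵐ ζ, stft a b ζ ≠ 0) :
    (smoothMultiples a b).topologicalClosure = ⊤ := by
  rw [Submodule.topologicalClosure_eq_top_iff, Submodule.eq_bot_iff]
  intro h hh
  rw [Submodule.mem_orthogonal] at hh
  have hmem : MemLp (fun ζ => h ζ * starRingEnd ℂ (stft a b ζ)) 2 volume := by
    refine (Lp.memLp h).of_le_mul (c := ‖a‖ * ‖b‖) ((Lp.memLp h).1.mul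
      (continuous_stft a b).star.aestronglyMeasurable) (Filter.Eventually.of_forall fun ζ => ?_)
    rw [norm_mul, RCLike.norm_conj, mul_comm]
    gcongr
    exact norm_stft_le _ _ _
  have h1 := ae_eq_zero_of_integral_contDiff_smul_eq_zero
    (hmem.locallyIntegrable (by norm_num)) fun G hG hGc => by
      have hG' : ContDiff ℝ ∞ fun ζ => (G ζ : ℂ) := Complex.ofRealCLM.contDiff.comp hG
      have hGc' : HasCompactSupport fun ζ => (G ζ : ℂ) := hGc.comp_left Complex.ofReal_zero
      have hm := memLp_two_mul_stft hG'.continuous hGc' a b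
      have h2 := hh (hm.toLp _) ⟨_, hG', hGc', hm.coeFn_toLp⟩
      rw [← h2, L2.inner_def]
      refine integral_congr_ae ?_
      filter_upwards [hm.coeFn_toLp] with ζ h3
      rw [h3, RCLike.inner_apply, map_mul, Complex.conj_ofReal, Complex.real_smul]
      ring
  rw [Lp.eq_zero_iff_ae_eq_zero]
  filter_upwards [h1, h0] with ζ h2 h3
  exact (mul_eq_zero.1 h2).resolve_right ((map_ne_zero _).2 h3)

theorem exists_eLpNorm_sub_mul_stft_lt {a b : L2 d} (h0 : ∀ᵐ ζ, stft a b ζ ≠ 0)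
    {F : Phase d → ℂ} (hF : MemLp F 2 volume) {ε : ℝ≥0∞} (hε : 0 < ε) :
    ∃ G : Phase d → ℂ, ContDiff ℝ ∞ G ∧ HasCompactSupport G ∧
      eLpNorm (fun ζ => F ζ - G ζ * stft a b ζ) 2 volume < ε := by
  have hmem : hF.toLp F ∈ (smoothMultiples a b).topologicalClosure := by
    rw [topologicalClosure_smoothMultiples h0]; trivial
  obtain ⟨h, ⟨G, hG, hGc, hh⟩, hlt⟩ := EMetric.mem_closure_iff.1 hmem ε hε
  refine ⟨G, hG, hGc, ?_⟩
  rw [Lp.edist_def] at hlt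
  refine lt_of_eq_of_lt (eLpNorm_congr_ae ?_) hlt
  filter_upwards [hF.coeFn_toLp, hh] with ζ h1 h2
  rw [Pi.sub_apply, h1, h2]

theorem denseInSchatten_two_of_ae_ne_zero (h0 : ∀ᵐ ζ, stft φ₁ φ₂ ζ ≠ 0) :
    DenseInSchatten 2 (localizationOperators φ₁ φ₂ 2) := by
  refine denseInSchatten_of_rankOne schattenNorm_two_add_le
    (fun T hT => schattenApprox_two_finiteRankSums hT) ?_
    (zero_mem_localizationOperators (Or.inr (Or.inl rfl)))
    (fun A hA B hB => add_mem_localizationOperators (Or.inr (Or.inl rfl)) hA hB) ?_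
    schattenNorm_two_zero
  · intro T hT
    obtain ⟨f, hf, hT⟩ := (mem_localizationOperators_iff (Or.inr (Or.inl rfl))).1 hT
    exact schattenNorm_two_lt_top hf hT
  intro u v ε hε
  -- `stft v u` is the spreading function of `rankOne u v`. The symbol `sft G` lies in `L¹ ∩ L²`, so
  -- the Weyl form for integrable symbols suffices.
  obtain ⟨G, hG, hGc, hlt⟩ := exists_eLpNorm_sub_mul_stft_lt h0 (memLp_stft v u) hε
  have hf := memLp_sft hG hGc 2
  have hT := isLocalizationOperator_localizationOperator (φ₁ := φ₁) (φ₂ := φ₂)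
    (Or.inr (Or.inl rfl)) hf
  refine ⟨_, (mem_localizationOperators_iff (Or.inr (Or.inl rfl))).2 ⟨_, hf, hT⟩, ?_⟩
  have hm := memLp_two_mul_stft hG.continuous hGc φ₁ φ₂
  have hW : IsWeyl (fun ζ => stft v u ζ - G ζ * stft φ₁ φ₂ ζ)
      (rankOne u v - localizationOperator φ₁ φ₂ (sft G)) := by
    intro p q
    have hTw := hT.isWeyl (integrable_sft hG hGc) p q
    rw [sft_sft hG hGc] at hTw
    rw [sub_apply, inner_sub_right, inner_rankOne, hTw, ← integral_stft_mul_inner]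
    simp only [sub_mul]
    exact (integral_sub (integrable_mul_inner_tfShift (memLp_stft v u) p q)
      (integrable_mul_inner_tfShift hm p q)).symm
  exact (hW.schattenNorm_two_le ((memLp_stft v u).sub hm)).trans_lt hlt

theorem summable_integral_norm_mul_stft_two {f : Phase d → ℂ} (hf : MemLp f 2 volume)
    {S : L2 d →L[ℂ] L2 d} (hS : schattenNorm 2 S < ⊤) :
    Summable fun j => ∫ z, ‖f z * (stft φ₁ (onb (L2 d) j) z *
      starRingEnd ℂ (stft φ₂ (S (onb (L2 d) j)) z))‖ := by
  refine Summable.of_nonneg_of_le (fun j => integral_nonneg fun _ => norm_nonneg _) (fun j => ?_)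
    ((summable_integral_norm_sq_mul_stft hf φ₁).add
      ((summable_of_schattenNorm_two_lt_top hS).mul_left (‖φ₂‖ ^ 2)))
  simp only [← mul_assoc, norm_mul _ (starRingEnd ℂ _), RCLike.norm_conj]
  refine (integral_norm_mul_norm_le (memLp_mul_stft hf φ₁ _) (memLp_stft φ₂ _)).trans ?_
  have h0 : 0 ≤ ∫ z, ‖f z * stft φ₁ (onb (L2 d) j) z‖ ^ 2 := integral_nonneg fun _ => sq_nonneg _
  have h1 := two_mul_le_add_sq (√(∫ z, ‖f z * stft φ₁ (onb (L2 d) j) z‖ ^ 2))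
    (‖φ₂‖ * ‖S (onb (L2 d) j)‖)
  rw [Real.sq_sqrt h0, mul_pow] at h1
  rw [integral_norm_sq_stft, Real.sqrt_sq (by positivity)]
  refine le_trans ?_ h1
  have : 0 ≤ √(∫ z, ‖f z * stft φ₁ (onb (L2 d) j) z‖ ^ 2) * (‖φ₂‖ * ‖S (onb (L2 d) j)‖) := by
    positivity
  linarith

theorem summable_inner_of_schattenNorm_two_lt_top {S T : L2 d →L[ℂ] L2 d}
    (hS : schattenNorm 2 S < ⊤) (hT : schattenNorm 2 T < ⊤) :
    Summable fun j => (inner ℂ (S (onb (L2 d) j)) (T (onb (L2 d) j)) : ℂ) := by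
  refine Summable.of_norm_bounded ((summable_of_schattenNorm_two_lt_top hS).add
    (summable_of_schattenNorm_two_lt_top hT)) fun j => (norm_inner_le_norm _ _).trans ?_
  nlinarith [sq_nonneg (‖S (onb (L2 d) j)‖ - ‖T (onb (L2 d) j)‖),
    mul_nonneg (norm_nonneg (S (onb (L2 d) j))) (norm_nonneg (T (onb (L2 d) j)))]

/-- Pythagoras: the Hilbert–Schmidt distance to an orthogonal operator. -/
theorem schattenNorm_two_le_sub {S T : L2 d →L[ℂ] L2 d}
    (hS : schattenNorm 2 S < ⊤) (hT : schattenNorm 2 T < ⊤)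
    (h : ∑' j, inner ℂ (S (onb (L2 d) j)) (T (onb (L2 d) j)) = 0) :
    schattenNorm 2 S ≤ schattenNorm 2 (S - T) := by
  have hs1 := summable_of_schattenNorm_two_lt_top hS
  have hs2 := summable_of_schattenNorm_two_lt_top hT
  have hc := summable_inner_of_schattenNorm_two_lt_top hS hT
  have hre : HasSum (fun j => (inner ℂ (S (onb (L2 d) j)) (T (onb (L2 d) j)) : ℂ).re) 0 := by
    have := Complex.hasSum_re hc.hasSum
    rwa [h] at this
  have hsum := (hs1.hasSum.sub (hre.mul_left 2)).add hs2.hasSum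
  have he : ∀ j, ‖S (onb (L2 d) j)‖ ^ 2 - 2 * (inner ℂ (S (onb (L2 d) j)) (T (onb (L2 d) j)) : ℂ).re
      + ‖T (onb (L2 d) j)‖ ^ 2 = ‖(S - T) (onb (L2 d) j)‖ ^ 2 := fun j => by
    rw [sub_apply, @norm_sub_sq ℂ]; rfl
  simp only [he] at hsum
  rw [schattenNorm_two_eq, schattenNorm_two_eq,
    ← ENNReal.ofReal_tsum_of_nonneg (fun _ => sq_nonneg _) hs1,
    ← ENNReal.ofReal_tsum_of_nonneg (fun _ => sq_nonneg _) hsum.summable, hsum.tsum_eq]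
  gcongr
  have : 0 ≤ ∑' j, ‖T (onb (L2 d) j)‖ ^ 2 := tsum_nonneg fun _ => sq_nonneg _
  linarith

theorem eq_zero_of_schattenNorm_two_eq_zero {S : L2 d →L[ℂ] L2 d} (h : schattenNorm 2 S = 0) :
    S = 0 := by
  rw [schattenNorm_two_eq, ENNReal.rpow_eq_zero_iff_of_pos (by norm_num), ENNReal.tsum_eq_zero] at h
  have h1 : ∀ j, S (onb (L2 d) j) = 0 := fun j => by
    have h2 := ENNReal.ofReal_eq_zero.1 (h j)
    exact norm_eq_zero.1 (pow_eq_zero_iff two_ne_zero |>.1 (h2.antisymm (sq_nonneg _)))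
  have hd := (onb (L2 d)).dense_span
  rw [Submodule.dense_iff_topologicalClosure_eq_top.symm] at hd
  refine ContinuousLinearMap.ext_on hd ?_
  rintro _ ⟨j, rfl⟩
  exact h1 j

/-- The operator whose spreading function is the indicator of zeros of positive finite measure is
nonzero, Hilbert–Schmidt and orthogonal to all localization operators; by Pythagoras its distance to
them is at least its norm. -/
theorem volume_ambiguityZeros_eq_zero_of_dense
    (h : DenseInSchatten 2 (localizationOperators φ₁ φ₂ 2)) :
    volume (ambiguityZeros φ₁ φ₂) = 0 := by
  by_contra hne
  obtain ⟨Z, hZm, hZs, hZ0, hZt⟩ :=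
    Measure.exists_subset_measure_lt_top isClosed_ambiguityZeros.measurableSet
      (pos_iff_ne_zero.2 hne)
  have hF : MemLp (Z.indicator fun _ : Phase d => (1 : ℂ)) 2 volume :=
    memLp_indicator_const 2 hZm 1 (Or.inr hZt.ne)
  obtain ⟨S, hS⟩ := exists_isWeyl hF
  have hSf : schattenNorm 2 S < ⊤ := (hS.schattenNorm_two_le hF).trans_lt hF.2
  have hpos : 0 < schattenNorm 2 S := by
    refine pos_iff_ne_zero.2 fun h0 => hZ0.ne' ?_
    rw [eq_zero_of_schattenNorm_two_eq_zero h0] at hS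
    have h1 := hS.ae_eq_zero hF
    refine measure_mono_null (fun ζ hζ => ?_) h1
    simp [hζ]
  obtain ⟨A, hA, hlt⟩ := h.2 S hSf _ hpos
  obtain ⟨f, hf, hT⟩ := (mem_localizationOperators_iff (Or.inr (Or.inl rfl))).1 hA
  refine hlt.not_ge (schattenNorm_two_le_sub hSf (schattenNorm_two_lt_top hf hT)
    (tsum_inner_localizationOperator_eq_zero hT (summable_integral_norm_mul_stft_two hf hSf)
      (inner_isWeyl_tfShift hS fun ζ => ?_)))
  by_cases hζ : ζ ∈ Z
  · exact Or.inr (mem_ambiguityZeros_iff.1 (hZs hζ))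
  · exact Or.inl (Set.indicator_of_notMem hζ _)

end HilbertSchmidt

end LocOp

namespace LocOp

/-! ### Annihilators and weak* density. -/

section WeakStar

variable {H : Type*} [NormedAddCommGroup H] [InnerProductSpace ℂ H] [CompleteSpace H]

theorem summable_inner_comp_adjoint {S : H →L[ℂ] H} (hS : schattenNorm 1 S < ∞)
    (A : H →L[ℂ] H) : Summable fun j => (inner ℂ (onb H j)
      ((A ∘L ContinuousLinearMap.adjoint S) (onb H j)) : ℂ) := by
  obtain ⟨u, v, h, -⟩ := exists_isNuclear hS
  exact ((h.adjoint.comp_left A).hasSum_trace (onb H)).summable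

/-- The functional `A ↦ tr (A S*)` for a trace class operator `S`. -/
def traceFunctional (S : schattenClass H 1) : (H →L[ℂ] H) →ₗ[ℂ] ℂ where
  toFun A := trace (A ∘L ContinuousLinearMap.adjoint (S : H →L[ℂ] H))
  map_add' A B := by
    rw [trace, trace, trace, ← (summable_inner_comp_adjoint S.2 A).tsum_add
      (summable_inner_comp_adjoint S.2 B)]
    simp only [ContinuousLinearMap.comp_apply, add_apply, inner_add_right]
  map_smul' c A := by
    rw [RingHom.id_apply, smul_eq_mul, trace, trace, ← tsum_mul_left]
    simp only [ContinuousLinearMap.comp_apply, smul_apply, inner_smul_right]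

theorem schattenNorm_one_sum_smul_lt_top {ι : Type*} (s : Finset ι) (c : ι → ℂ)
    {S : ι → H →L[ℂ] H} (hS : ∀ i, schattenNorm 1 (S i) < ∞) :
    schattenNorm 1 (∑ i ∈ s, c i • S i) < ∞ := by
  induction s using Finset.cons_induction with
  | empty => simp [schattenNorm_one_zero]
  | cons i s his ih =>
    rw [Finset.sum_cons]
    exact (schattenNorm_one_add_le _ _).trans_lt
      (ENNReal.add_lt_top.2 ⟨schattenNorm_one_smul_lt_top _ (hS i), ih⟩)

theorem trace_comp_adjoint_sum_smul {ι : Type*} (s : Finset ι) (c : ι → ℂ)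
    {S : ι → H →L[ℂ] H} (hS : ∀ i, schattenNorm 1 (S i) < ∞) (A : H →L[ℂ] H) :
    trace (A ∘L ContinuousLinearMap.adjoint (∑ i ∈ s, c i • S i))
      = ∑ i ∈ s, starRingEnd ℂ (c i) * trace (A ∘L ContinuousLinearMap.adjoint (S i)) := by
  simp only [trace, ← tsum_mul_left]
  rw [← Summable.tsum_finsetSum fun i _ => (summable_inner_comp_adjoint (hS i) A).mul_left _]
  refine tsum_congr fun j => ?_
  simp only [map_sum, map_smulₛₗ, ContinuousLinearMap.comp_apply, sum_apply,
    smul_apply, inner_sum, inner_smul_right, RingHom.id_apply]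

theorem weakStarTopology_eq_induced : weakStarTopology H = TopologicalSpace.induced
    (fun A (S : schattenClass H 1) => traceFunctional S A) Pi.topologicalSpace := by
  rw [weakStarTopology, iInf_subtype', Pi.topologicalSpace, induced_iInf]
  simp only [induced_compose]
  rfl

/-- A subspace is weak* dense if its annihilator in the trace class is trivial. -/
theorem weakStarDense_of_forall_trace (M : Submodule ℂ (H →L[ℂ] H))
    (h : ∀ S : H →L[ℂ] H, schattenNorm 1 S < ∞ →
      (∀ A ∈ M, trace (A ∘L ContinuousLinearMap.adjoint S) = 0) → S = 0) :
    WeakStarDense (M : Set (H →L[ℂ] H)) := by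
  classical
  intro B
  rw [weakStarTopology_eq_induced, closure_induced, mem_closure_iff]
  intro U hU hBU
  obtain ⟨I, u, hIu, hIU⟩ := isOpen_pi_iff.1 hU _ hBU
  -- A basic neighbourhood involves finitely many traces only. If `L B` were outside `L(M)`, a
  -- functional on the finite-dimensional space would separate them; pulled back by `L`, it is the
  -- trace against one trace class operator annihilating `M`.
  let L : (H →L[ℂ] H) →ₗ[ℂ] I → ℂ := LinearMap.pi fun i => traceFunctional i.1
  have hL : L B ∈ M.map L := by
    by_contra hB
    obtain ⟨f, hfB, hf⟩ := Submodule.exists_dual_map_eq_bot_of_notMem hB inferInstance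
    have hfL : ∀ A, f (L A) = trace (A ∘L ContinuousLinearMap.adjoint
        (∑ i : I, starRingEnd ℂ (f (Pi.single i 1)) • (i.1 : H →L[ℂ] H))) := fun A => by
      rw [trace_comp_adjoint_sum_smul _ _ fun i : I => i.1.2]
      conv_lhs => rw [pi_eq_sum_univ' (L A)]
      rw [map_sum]
      refine Finset.sum_congr rfl fun i _ => ?_
      rw [map_smul, smul_eq_mul, mul_comm, Complex.conj_conj]
      rfl
    have h0 := h _ (schattenNorm_one_sum_smul_lt_top _ _ fun i : I => i.1.2) fun A hA => by
      rw [← hfL]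
      have : f (L A) ∈ (M.map L).map f := Submodule.mem_map_of_mem (Submodule.mem_map_of_mem hA)
      rwa [hf] at this
    rw [hfL, h0] at hfB
    simp [trace] at hfB
  obtain ⟨A, hA, hAB⟩ := hL
  refine ⟨_, hIU fun i hi => ?_, A, hA, rfl⟩
  have : traceFunctional i A = traceFunctional i B := congrFun hAB ⟨i, hi⟩
  simp only [this]
  exact (hIu i hi).2

theorem eq_zero_of_weakStarDense {M : Set (H →L[ℂ] H)} (hM : WeakStarDense M)
    {S : H →L[ℂ] H} (hS : schattenNorm 1 S < ∞)
    (h : ∀ A ∈ M, trace (A ∘L ContinuousLinearMap.adjoint S) = 0) : S = 0 := by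
  have hall : ∀ A : H →L[ℂ] H, trace (A ∘L ContinuousLinearMap.adjoint S) = 0 := by
    let _ := weakStarTopology H
    have hc : Continuous fun A : H →L[ℂ] H => trace (A ∘L ContinuousLinearMap.adjoint S) :=
      continuous_iff_le_induced.2 (iInf₂_le (α := TopologicalSpace (H →L[ℂ] H)) S hS)
    intro A
    exact closure_minimal (fun A hA => h A hA) (isClosed_eq hc continuous_const) (hM A)
  obtain ⟨u, v, hn, -⟩ := exists_isNuclear hS
  have h0 : ContinuousLinearMap.adjoint S = 0 := by
    ext1 x
    refine ext_inner_left ℂ fun y => ?_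
    -- Rank one test operators recover the matrix coefficients `⟨y, S* x⟩`.
    have h1 := ((hn.adjoint.comp_left (rankOne x y)).hasSum_trace (onb H)).tsum_eq
    rw [← trace, hall] at h1
    rw [zero_apply, inner_zero_right, h1, ← (hn.adjoint.hasSum x y).tsum_eq]
    exact tsum_congr fun i => by rw [inner_rankOne, mul_comm]
  rw [← ContinuousLinearMap.adjoint_adjoint S, h0, map_zero]

end WeakStar

/-! ### Weak* density of localization operators with bounded symbols. -/

variable {d : ℕ} {φ₁ φ₂ : L2 d}

/-- Time-frequency shifts as localization operators. -/
theorem tfCLM_mem_localizationOperators {ζ : Phase d} (hζ : stft φ₁ φ₂ ζ ≠ 0) :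
    tfCLM ζ ∈ localizationOperators φ₁ φ₂ ∞ := by
  -- Formally, the transform of the character `chi ζ` is a point mass at `ζ`;
  -- `integral_chi_mul_stft` makes this exact.
  have hc : Continuous fun z : Phase d => (stft φ₁ φ₂ ζ)⁻¹ * chi ζ z :=
    continuous_const.mul (continuous_chi_right ζ)
  have hb : ∀ z : Phase d, ‖(stft φ₁ φ₂ ζ)⁻¹ * chi ζ z‖ ≤ ‖(stft φ₁ φ₂ ζ)⁻¹‖ := fun z => by
    rw [norm_mul, norm_chi, mul_one]
  refine (mem_localizationOperators_iff (Or.inr (Or.inr rfl))).2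
    ⟨_, memLp_top_of_bound hc.aestronglyMeasurable _ (Filter.Eventually.of_forall hb),
      isLocalizationOperator_iff.2 fun p q => ⟨?_, ?_⟩⟩
  · exact (integrable_stft_mul φ₁ φ₂ p q).bdd_mul hc.aestronglyMeasurable
      (Filter.Eventually.of_forall hb)
  · simp only [mul_assoc]
    rw [integral_const_mul, integral_chi_mul_stft, tfCLM_apply]
    field_simp

/-- `ζ ↦ tr(π(ζ) W)` is continuous, so it vanishes everywhere; integrating it against `stft a b`
recovers `⟨a, W b⟩` by the reproducing formula. -/
theorem eq_zero_of_trace_tfCLM_comp {W : L2 d →L[ℂ] L2 d} {u v : basisIndex (L2 d) → L2 d}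
    (hW : IsNuclear W u v) {Y : Set (Phase d)} (hY : Dense Y)
    (h : ∀ ζ ∈ Y, trace (tfCLM ζ ∘L W) = 0) : W = 0 := by
  have htr : ∀ ζ, trace (tfCLM ζ ∘L W) = ∑' i, inner ℂ (v i) (tfShift ζ (u i)) := fun ζ =>
    ((hW.comp_left (tfCLM ζ)).hasSum_trace (onb (L2 d))).tsum_eq
  have hb : ∀ i ζ, ‖(inner ℂ (v i) (tfShift ζ (u i)) : ℂ)‖ ≤ ‖u i‖ * ‖v i‖ := fun i ζ => by
    refine (norm_inner_le_norm _ _).trans_eq ?_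
    rw [norm_tfShift, mul_comm]
  have hcont : Continuous fun ζ => ∑' i, (inner ℂ (v i) (tfShift ζ (u i)) : ℂ) :=
    continuous_tsum (fun i => continuous_const.inner (continuous_tfShift (u i))) hW.summable hb
  have hall : ∀ ζ, ∑' i, (inner ℂ (v i) (tfShift ζ (u i)) : ℂ) = 0 := by
    refine congrFun (hcont.ext_on hY continuous_const fun ζ hζ => ?_)
    simp only
    rw [← htr, h ζ hζ]
  ext1 b
  refine ext_inner_left ℂ fun a => ?_
  rw [zero_apply, inner_zero_right, ← (hW.hasSum b a).tsum_eq]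
  have hint : ∀ i, Integrable fun ζ => stft a b ζ * inner ℂ (v i) (tfShift ζ (u i)) := fun i =>
    integrable_stft_mul_inner a b (u i) (v i)
  have hs : Summable fun i => ∫ ζ, ‖stft a b ζ * inner ℂ (v i) (tfShift ζ (u i))‖ := by
    refine (hW.summable.mul_left (‖a‖ * ‖b‖)).of_nonneg_of_le
      (fun i => integral_nonneg fun _ => norm_nonneg _) fun i => ?_
    simp only [← conj_stft, norm_mul, RCLike.norm_conj]
    refine (integral_norm_mul_norm_le (memLp_stft a b) (memLp_stft (u i) (v i))).trans_eq ?_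
    rw [integral_norm_sq_stft, integral_norm_sq_stft, Real.sqrt_sq (by positivity),
      Real.sqrt_sq (by positivity)]
  calc ∑' i, inner ℂ a (u i) * inner ℂ (v i) b
      = ∑' i, ∫ ζ, stft a b ζ * inner ℂ (v i) (tfShift ζ (u i)) :=
        tsum_congr fun i => by rw [integral_stft_mul_inner, mul_comm]
    _ = ∫ ζ, ∑' i, stft a b ζ * inner ℂ (v i) (tfShift ζ (u i)) :=
        (integral_tsum_of_summable_integral_norm hint hs)
    _ = 0 := by simp only [tsum_mul_left, hall, mul_zero, integral_zero]

theorem weakStarDense_of_dense_compl (h : Dense (ambiguityZeros φ₁ φ₂)ᶜ) :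
    WeakStarDense (localizationOperators φ₁ φ₂ ∞) := by
  let M : Submodule ℂ (L2 d →L[ℂ] L2 d) :=
    { carrier := localizationOperators φ₁ φ₂ ∞
      add_mem' := fun hA hB => add_mem_localizationOperators (Or.inr (Or.inr rfl)) hA hB
      zero_mem' := zero_mem_localizationOperators (Or.inr (Or.inr rfl))
      smul_mem' := fun c A hA => smul_mem_localizationOperators (Or.inr (Or.inr rfl)) c hA }
  refine weakStarDense_of_forall_trace M fun S hS hM => ?_
  obtain ⟨u, v, hn, -⟩ := exists_isNuclear hS
  have h0 := eq_zero_of_trace_tfCLM_comp hn.adjoint h fun ζ hζ =>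
    hM _ (tfCLM_mem_localizationOperators fun h0 => hζ (mem_ambiguityZeros_iff.2 h0))
  rw [← ContinuousLinearMap.adjoint_adjoint S, h0, map_zero]

/-- For bounded `f` the trace is expanded along a nuclear representation of `S`, not along the
basis: Moyal bounds each term by a multiple of `‖u i‖ * ‖v i‖`, which is summable. -/
theorem trace_localizationOperator_comp_adjoint_eq_zero {f : Phase d → ℂ}
    (hf : MemLp f ∞ volume) {A S : L2 d →L[ℂ] L2 d} (hA : IsLocalizationOperator φ₁ φ₂ f A)
    (hS : schattenNorm 1 S < ∞) (hz : ∀ z, inner ℂ (S (tfShift z φ₁)) (tfShift z φ₂) = 0) :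
    trace (A ∘L ContinuousLinearMap.adjoint S) = 0 := by
  obtain ⟨u, v, hn, -⟩ := exists_isNuclear hS
  rw [trace, ((hn.adjoint.comp_left A).hasSum_trace (onb (L2 d))).tsum_eq]
  rw [isLocalizationOperator_iff] at hA
  simp only [← fun j => (hA (v j) (u j)).2]
  rw [integral_tsum_of_summable_integral_norm (fun j => (hA _ _).1)]
  · refine integral_eq_zero_of_ae (Filter.Eventually.of_forall fun z => ?_)
    have h1 := (hn.hasSum (tfShift z φ₁) (tfShift z φ₂)).map
      (starRingEnd ℂ) Complex.continuous_conj
    rw [inner_conj_symm, hz] at h1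
    have h2 := (h1.mul_left (f z)).tsum_eq
    rw [mul_zero] at h2
    rw [Pi.zero_apply, ← h2]
    refine tsum_congr fun j => ?_
    rw [Function.comp_apply, map_mul, inner_conj_symm, inner_conj_symm, conj_stft, mul_comm (inner ℂ (u j) _)]
    rfl
  · set C := (eLpNorm f ∞ volume).toReal
    have hC : ∀ᵐ z, ‖f z‖ ≤ C := by
      filter_upwards [ae_le_eLpNormEssSup (f := f) (μ := volume)] with z hz
      rw [← toReal_enorm]
      exact ENNReal.toReal_mono hf.2.ne (by rwa [eLpNorm_exponent_top])
    refine (hn.summable.mul_left (C * (‖φ₁‖ * ‖φ₂‖))).of_nonneg_of_le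
      (fun i => integral_nonneg fun _ => norm_nonneg _) fun i => ?_
    calc _ ≤ ∫ z, C * ‖stft φ₁ (v i) z * starRingEnd ℂ (stft φ₂ (u i) z)‖ := by
          refine integral_mono_ae (hA _ _).1.norm ((integrable_stft_mul _ _ _ _).norm.const_mul _) ?_
          filter_upwards [hC] with z hz
          rw [norm_mul]
          gcongr
      _ ≤ C * ((‖φ₁‖ * ‖v i‖) * (‖φ₂‖ * ‖u i‖)) := by
          rw [integral_const_mul]
          gcongr
          simp only [norm_mul, RCLike.norm_conj]
          refine (integral_norm_mul_norm_le (memLp_stft _ _) (memLp_stft _ _)).trans_eq ?_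
          rw [integral_norm_sq_stft, integral_norm_sq_stft, Real.sqrt_sq (by positivity),
            Real.sqrt_sq (by positivity)]
      _ = _ := by ring

theorem dense_compl_of_weakStarDense (h : WeakStarDense (localizationOperators φ₁ φ₂ ∞)) :
    Dense (ambiguityZeros φ₁ φ₂)ᶜ := by
  rw [← interior_eq_empty_iff_dense_compl]
  by_contra hne
  obtain ⟨ζ₀, hζ₀⟩ := Set.nonempty_iff_ne_empty.2 hne
  obtain ⟨r, hr, hball⟩ := Metric.isOpen_iff.1 isOpen_interior ζ₀ hζ₀
  obtain ⟨G, hG, hGc, hG1, hG0⟩ := exists_bump ζ₀ hr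
  obtain ⟨ψ, hψ⟩ := exists_ne_zero_L2 d
  have hg := integrable_sft hG hGc
  -- The annihilating operator is a localization operator with other windows: this makes it trace
  -- class, with spreading function `G · stft ψ (π(ζ₀)ψ)`, supported in the zero set and equal to
  -- `‖ψ‖²` at `ζ₀`.
  have hT := isLocalizationOperator_localizationOperator (φ₁ := ψ) (φ₂ := tfShift ζ₀ ψ)
    (Or.inl rfl) (memLp_one_iff_integrable.2 hg)
  have hW := hT.isWeyl hg
  rw [sft_sft hG hGc] at hW
  have hS := schattenNorm_one_lt_top hg hT
  have hS0 := eq_zero_of_weakStarDense h hS fun A hA => by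
    obtain ⟨f, hf, hA⟩ := (mem_localizationOperators_iff (Or.inr (Or.inr rfl))).1 hA
    refine trace_localizationOperator_comp_adjoint_eq_zero hf hA hS
      (inner_isWeyl_tfShift hW fun ζ => ?_)
    by_cases hζ : ζ ∈ Metric.ball ζ₀ r
    · exact Or.inr (mem_ambiguityZeros_iff.1 (interior_subset (hball hζ)))
    · exact Or.inl (by rw [hG0 ζ hζ, zero_mul])
  rw [hS0] at hW
  have hF := hW.ae_eq_zero (memLp_two_mul_stft hG.continuous hGc _ _)
  have h1 := (Continuous.ae_eq_iff_eq volume (hG.continuous.mul (continuous_stft _ _))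
    continuous_const).1 hF
  have h2 : G ζ₀ * stft ψ (tfShift ζ₀ ψ) ζ₀ = 0 := congrFun h1 ζ₀
  rw [hG1 ζ₀ (Metric.mem_ball_self (half_pos hr)), one_mul] at h2
  exact hψ (by simpa [stft, inner_tfShift] using h2)

end LocOp

end

theorem mainTheorem1 (d : ℕ) (φ₁ φ₂ : LocOp.L2 d) :
    (∀ p : ℝ≥0∞, p = 1 ∨ p = 2 ∨ p = ∞ → ∀ f : LocOp.Phase d → ℂ, MemLp f p volume →
      LocOp.IsLocalizationOperator φ₁ φ₂ f (LocOp.localizationOperator φ₁ φ₂ f)) ∧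
    (LocOp.DenseInSchatten 1 (LocOp.localizationOperators φ₁ φ₂ 1) ↔
      LocOp.ambiguityZeros φ₁ φ₂ = ∅) ∧
    (LocOp.DenseInSchatten 2 (LocOp.localizationOperators φ₁ φ₂ 2) ↔
      volume (LocOp.ambiguityZeros φ₁ φ₂) = 0) ∧
    (LocOp.WeakStarDense (LocOp.localizationOperators φ₁ φ₂ ∞) ↔
      Dense (LocOp.ambiguityZeros φ₁ φ₂)ᶜ) := by
  refine ⟨fun p hp f hf => LocOp.isLocalizationOperator_localizationOperator hp hf,
    ⟨LocOp.ambiguityZeros_eq_empty_of_dense,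
      LocOp.denseInSchatten_one_of_ambiguityZeros_eq_empty⟩,
    ⟨LocOp.volume_ambiguityZeros_eq_zero_of_dense, fun h =>
      LocOp.denseInSchatten_two_of_ae_ne_zero ?_⟩,
    ⟨LocOp.dense_compl_of_weakStarDense, LocOp.weakStarDense_of_dense_compl⟩⟩
  filter_upwards [measure_eq_zero_iff_ae_notMem.1 h] with z hz h0
  exact hz (LocOp.mem_ambiguityZeros_iff.2 h0)
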